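/- **Setting.** Let $T>0$, $\alpha>1/3$, $\Delta=\{(s,t):0\le s\le t\le T\}$. A *control* is a continuous map $\omega:\Delta\to[0,\infty)$ with $\omega(s,\theta)+\omega(\theta,t)\le\omega(s,t)$ for $s\le\theta\le t$. Let $\mathbb D_1$ be the space of operators $X^i\partial_i+Y$ on $\mathbb R^d$ with $(X,Y)\in (W^{3,\infty})^d\times W^{2,\infty}$, and $\mathbb D_2$ the space of operators $\mathbb X^{ij}\partial_{ij}+\mathbb Y^i\partial_i+\mathbb Z$ with $(\mathbb X,\mathbb Y,\mathbb Z)\in (W^{3,\infty})^{d\times d}\times (W^{2,\infty})^d\times W^{1,\infty}$. Write $|\cdot|_{\mathbb D_i}$ for the norm of the coefficients in these spaces. A *differential rough driver* with control $\omega$ is a family $\mathbf B=(B^1_{st},B^2_{st})_{(s,t)\in\Delta}$ with $B^i_{st}\in\mathbb D_i$ such that $|B^i_{st}|_{\mathscr L(H^k,H^{k-i})}\le\omega(s,t)^{i\alpha}$ for $i=1,2$, $k=-3+i,\dots,3$, and, for $s\le\theta\le t$, $B^1_{st}=B^1_{s\theta}+B^1_{\theta t}$ and $B^2_{st}-B^2_{s\theta}-B^2_{\theta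 t}=B^1_{\theta t}\circ B^1_{s\theta}$. It is *geometric* if $B^1_{st}=B_t-B_s$ for a path $B$ in $\mathbb D_1$ and there are paths $B(n)\in C^1(0,T;\mathbb D_1)$ whose canonical lifts $B^1(n)_{st}=B(n)_t-B(n)_s$, $B^2(n)_{st}=\int_s^t dB(n)_r\circ(B(n)_r-B(n)_s)\in\mathbb D_2$ satisfy $$\sum_{k=-2}^3\sup_{t\in[0,T]}|B(n)_t-B_t|_{\mathscr L(H^k,H^{k-1})}+\sum_{i=1}^2\sum_{k=-3+i}^3\|B^i(n)-B^i\|_{\mathcal V^{i\alpha}(0,T;\mathscr L(H^k,H^{k-i}))}\to0 ,$$ where $\|g\|_{\mathcal V^{\beta}}$ is the infimum of $w(0,T)^\beta$ over the controls $w$ with $|g_{st}|\le w(s,t)^\beta$ on $\Delta$; the $C^1$ property and the integral (a Riemann–Stieltjes integral) refer to the operator norms of $\mathscr L(H^k,H^{k-i})$, $k=-3+i,\dots,3$. Let $U\subset\mathbb R^d$ be open, $D\subset U$ open and bounded with $\mathrm{dist}(D,\partial U)>0$, and $$\Omega_1^D=\Big\{(x,y)\in U\times U:\ \tfrac{x+y}2\in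 D,\ \big|\tfrac{x-y}2\big|<1\Big\}.$$ For $\epsilon\in(0,1]$ put $T_\epsilon\Phi(x,y)=(2\epsilon)^{-d}\,\Phi\big(\tfrac{x+y}2+\tfrac{x-y}{2\epsilon},\tfrac{x+y}2-\tfrac{x-y}{2\epsilon}\big)$, and let $T_\epsilon^*$ be its adjoint. For an integer $k\le0$, $W^{k,1}(\Omega)$ is the space of distributions $v=\sum_{|\gamma|\le-k}\partial_\gamma f^\gamma$ on $\Omega$ with $f^\gamma\in L^1(\Omega)$, normed by the infimum of the $L^1$-norms of such families $(f^\gamma)$. **Theorem.** Let $\mathbf B$ be a geometric differential rough driver of regularity $\alpha>1/3$ with control $\omega_B$, and suppose that for some constant $K$ one has $|B^i_{st}|_{\mathbb D_i}\le K\,\omega_B(s,t)^{i\alpha}$ for $i=1,2$ and $(s,t)\in\Delta$. For $(s,t)\in\Delta$ set $$\Gamma^1_{st}(\mathbf B)=B^1_{st}\otimes\mathrm{id}+\mathrm{id}\otimes B^1_{st},\qquad \Gamma^2_{st}(\mathbf B)=B^2_{st}\otimes\mathrm{id}+B^1_{st}\otimes B^1_{st}+\mathrm{id}\otimes B^2_{st}.$$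 Then $\Gamma(\mathbf B)=(\Gamma^1(\mathbf B),\Gamma^2(\mathbf B))$ is a differential rough driver on $\mathbb R^d\times\mathbb R^d$ of regularity $\alpha$, with a control that is a constant multiple of $\omega_B$. Moreover, there is a constant $C>0$, independent of $\epsilon\in(0,1]$ and of $(s,t)\in\Delta$, such that for $i=1,2$ and $k=-3+i,\dots,0$ the operator $T_\epsilon^{*}\,\Gamma^i_{st}(\mathbf B)\,(T_\epsilon^{*})^{-1}$ is well defined and bounded from $W^{k,1}(\Omega^D_1)$ to $W^{k-i,1}(\Omega^D_1)$, with $$\big|T_\epsilon^{*}\,\Gamma^i_{st}(\mathbf B)\,(T_\epsilon^{*})^{-1}\big|_{\mathscr L(W^{k,1}(\Omega^D_1),\,W^{k-i,1}(\Omega^D_1))}\le C\,\omega_B(s,t)^{i\alpha}.$$ -/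

import Mathlib

open MeasureTheory TopologicalSpace Filter Topology
open scoped ENNReal Distributions LineDeriv

noncomputable section

set_option linter.unusedSectionVars false

namespace RoughDriver

variable {ι : Type} [Fintype ι] [DecidableEq ι]

/-- The Euclidean space whose coordinates are indexed by `ι`. -/
abbrev Eu (ι : Type) : Type := EuclideanSpace ℝ ι

/-- The coordinate directions `(e_{s 0}, …, e_{s (n-1)})` for a tuple of indices `s`. -/
def dirs {n : ℕ} (s : Fin n → ι) : Fin n → Eu ι := fun l => EuclideanSpace.single (s l) (1 : ℝ)

/-! ### Weak derivatives and Sobolev norms -/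

/-- `g` is the weak derivative `∂_{s 0} ⋯ ∂_{s (n-1)} f` of `f` on the open set `O`. -/
def HasWeakDeriv (O : Opens (Eu ι)) {n : ℕ} (s : Fin n → ι) (f g : Eu ι → ℝ) : Prop :=
  LocallyIntegrableOn f O ∧ LocallyIntegrableOn g O ∧
    ∀ φ : 𝓓(O, ℝ), ∫ x in O, f x * (∂^{dirs s} φ) x = (-1) ^ n * ∫ x in O, g x * φ x

open Classical in
/-- The weak derivative of `f` on `O` (determined up to a null set), with value `0` when there is
none. -/
def weakDeriv (O : Opens (Eu ι)) {n : ℕ} (s : Fin n → ι) (f : Eu ι → ℝ) : Eu ι → ℝ :=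
  if h : ∃ g, HasWeakDeriv O s f g then h.choose else 0

open Classical in
/-- The `W^{m,p}(O)`-norm: the sum of the `L^p(O)`-norms of all weak derivatives of order at most
`m`, which is `∞` if one of these derivatives does not exist. Partial derivatives are indexed by
tuples of directions. -/
def sobNorm (O : Opens (Eu ι)) (m : ℕ) (p : ℝ≥0∞) (f : Eu ι → ℝ) : ℝ≥0∞ :=
  if ∀ j ≤ m, ∀ s : Fin j → ι, ∃ g, HasWeakDeriv O s f g then
    ∑ j ∈ Finset.range (m + 1), ∑ s : Fin j → ι,
      eLpNorm (weakDeriv O s f) p (volume.restrict (O : Set (Eu ι)))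
  else ⊤

open Classical in
/-- The norm of `H^k` on the whole space, for an integer `k`. For `k ≥ 0` it is the
`W^{k,2}`-norm, for `k < 0` it is the norm dual to `H^{-k}`. -/
def hNorm : ℤ → (Eu ι → ℝ) → ℝ≥0∞
  | Int.ofNat m, f => sobNorm ⊤ m 2 f
  | Int.negSucc m, f =>
      if LocallyIntegrable f then
        ⨆ (ψ : 𝓓((⊤ : Opens (Eu ι)), ℝ)) (_ : sobNorm ⊤ (m + 1) 2 (ψ : Eu ι → ℝ) ≤ 1),
          ‖∫ x, f x * ψ x‖ₑ
      else ⊤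

/-- `P` has norm at most `M` in `𝓛(H^k, H^{k-i})` for every `k = -3+i, …, 3`. The bound is imposed
on test functions, which are dense in each `H^k`. -/
def OpBound (i : ℕ) (P : (Eu ι → ℝ) → Eu ι → ℝ) (M : ℝ) : Prop :=
  ∀ k : ℤ, -3 + (i : ℤ) ≤ k → k ≤ 3 → ∀ φ : 𝓓((⊤ : Opens (Eu ι)), ℝ),
    hNorm (k - i) (P φ) ≤ ENNReal.ofReal M * hNorm k (φ : Eu ι → ℝ)

/-! ### Differential operators -/

/-- The operator `∑ i, X i ∂_i + Y`, given by its coefficients. -/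
@[ext]
structure Op1 (ι : Type) where
  /-- coefficients of the first derivatives -/
  X : ι → Eu ι → ℝ
  /-- coefficient of order zero -/
  Y : Eu ι → ℝ

/-- The operator `∑ i j, X i j ∂_i ∂_j + ∑ i, Y i ∂_i + Z`, given by its coefficients. -/
@[ext]
structure Op2 (ι : Type) where
  /-- coefficients of the second derivatives -/
  X : ι → ι → Eu ι → ℝ
  /-- coefficients of the first derivatives -/
  Y : ι → Eu ι → ℝ
  /-- coefficient of order zero -/
  Z : Eu ι → ℝ

instance : Add (Op1 ι) := ⟨fun V W => ⟨V.X + W.X, V.Y + W.Y⟩⟩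
instance : Sub (Op1 ι) := ⟨fun V W => ⟨V.X - W.X, V.Y - W.Y⟩⟩
instance : SMul ℝ (Op1 ι) := ⟨fun c V => ⟨c • V.X, c • V.Y⟩⟩
instance : Add (Op2 ι) := ⟨fun V W => ⟨V.X + W.X, V.Y + W.Y, V.Z + W.Z⟩⟩
instance : Sub (Op2 ι) := ⟨fun V W => ⟨V.X - W.X, V.Y - W.Y, V.Z - W.Z⟩⟩

/-- The action of a first order operator on (weakly differentiable) functions. -/
def Op1.apply (V : Op1 ι) (f : Eu ι → ℝ) : Eu ι → ℝ := fun x =>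
  ∑ i, V.X i x * weakDeriv ⊤ ![i] f x + V.Y x * f x

/-- The action of a second order operator on (weakly differentiable) functions. -/
def Op2.apply (V : Op2 ι) (f : Eu ι → ℝ) : Eu ι → ℝ := fun x =>
  ∑ i, ∑ j, V.X i j x * weakDeriv ⊤ ![i, j] f x + ∑ i, V.Y i x * weakDeriv ⊤ ![i] f x + V.Z x * f x

/-- The formal adjoint `Ψ ↦ -∑ i, ∂_i (X i Ψ) + Y Ψ`. -/
def Op1.adjoint (V : Op1 ι) (Ψ : Eu ι → ℝ) : Eu ι → ℝ := fun x =>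
  -∑ i, weakDeriv ⊤ ![i] (fun z => V.X i z * Ψ z) x + V.Y x * Ψ x

/-- The formal adjoint `Ψ ↦ ∑ i j, ∂_i ∂_j (X i j Ψ) - ∑ i, ∂_i (Y i Ψ) + Z Ψ`. -/
def Op2.adjoint (V : Op2 ι) (Ψ : Eu ι → ℝ) : Eu ι → ℝ := fun x =>
  ∑ i, ∑ j, weakDeriv ⊤ ![i, j] (fun z => V.X i j z * Ψ z) x
    - ∑ i, weakDeriv ⊤ ![i] (fun z => V.Y i z * Ψ z) x + V.Z x * Ψ x

/-- The norm of the coefficients of a first order operator in `(W^{3,∞})^d × W^{2,∞}`. -/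
def Op1.coefNorm (V : Op1 ι) : ℝ≥0∞ := ∑ i, sobNorm ⊤ 3 ⊤ (V.X i) + sobNorm ⊤ 2 ⊤ V.Y

/-- The norm of the coefficients of a second order operator in
`(W^{3,∞})^{d × d} × (W^{2,∞})^d × W^{1,∞}`. -/
def Op2.coefNorm (V : Op2 ι) : ℝ≥0∞ :=
  ∑ i, ∑ j, sobNorm ⊤ 3 ⊤ (V.X i j) + ∑ i, sobNorm ⊤ 2 ⊤ (V.Y i) + sobNorm ⊤ 1 ⊤ V.Z

/-- The space `𝔻₁`: coefficients in `(W^{3,∞})^d × W^{2,∞}`. -/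
def Op1.MemD (V : Op1 ι) : Prop := V.coefNorm < ⊤

/-- The space `𝔻₂`: coefficients in `(W^{3,∞})^{d × d} × (W^{2,∞})^d × W^{1,∞}`. -/
def Op2.MemD (V : Op2 ι) : Prop := V.coefNorm < ⊤

/-! ### Rough drivers -/

/-- The simplex `Δ = {(s, t) : 0 ≤ s ≤ t ≤ T}`. -/
def simplex (T : ℝ) : Set (ℝ × ℝ) := {q | 0 ≤ q.1 ∧ q.1 ≤ q.2 ∧ q.2 ≤ T}

/-- Controls: continuous, nonnegative, superadditive functions on the simplex. -/
structure IsControl (T : ℝ) (ω : ℝ → ℝ → ℝ) : Prop where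
  continuousOn : ContinuousOn (fun q : ℝ × ℝ => ω q.1 q.2) (simplex T)
  nonneg : ∀ s t, (s, t) ∈ simplex T → 0 ≤ ω s t
  superadd : ∀ s θ t, 0 ≤ s → s ≤ θ → θ ≤ t → t ≤ T → ω s θ + ω θ t ≤ ω s t

/-- `(B1, B2)` is a differential rough driver of regularity `α` on `[0, T]`, with control `ω`. -/
structure IsDifferentialRoughDriver (T α : ℝ) (ω : ℝ → ℝ → ℝ)
    (B1 : ℝ → ℝ → Op1 ι) (B2 : ℝ → ℝ → Op2 ι) : Prop where
  control : IsControl T ω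
  mem1 : ∀ s t, (s, t) ∈ simplex T → (B1 s t).MemD
  mem2 : ∀ s t, (s, t) ∈ simplex T → (B2 s t).MemD
  bound1 : ∀ s t, (s, t) ∈ simplex T → OpBound 1 (B1 s t).apply (ω s t ^ α)
  bound2 : ∀ s t, (s, t) ∈ simplex T → OpBound 2 (B2 s t).apply (ω s t ^ (2 * α))
  chen1 : ∀ s θ t, 0 ≤ s → s ≤ θ → θ ≤ t → t ≤ T → ∀ φ : 𝓓((⊤ : Opens (Eu ι)), ℝ),
    (B1 s t).apply φ - (B1 s θ).apply φ - (B1 θ t).apply φ =ᵐ[volume] 0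
  chen2 : ∀ s θ t, 0 ≤ s → s ≤ θ → θ ≤ t → t ≤ T → ∀ φ : 𝓓((⊤ : Opens (Eu ι)), ℝ),
    (B2 s t).apply φ - (B2 s θ).apply φ - (B2 θ t).apply φ
      =ᵐ[volume] (B1 θ t).apply ((B1 s θ).apply φ)

/-- `B` is a path in `C¹(0, T; 𝔻₁)`, where `𝔻₁` carries the operator norm topology. -/
def IsC1Path (T : ℝ) (B : ℝ → Op1 ι) : Prop :=
  (∀ t ∈ Set.Icc 0 T, (B t).MemD) ∧
  ∃ dB : ℝ → Op1 ι, (∀ t ∈ Set.Icc 0 T, (dB t).MemD) ∧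
    (∀ t ∈ Set.Icc 0 T, ∀ η > 0, ∃ δ > 0, ∀ r ∈ Set.Icc 0 T, |r - t| < δ →
      OpBound 1 (dB r - dB t).apply η) ∧
    (∀ t ∈ Set.Icc 0 T, ∀ η > 0, ∃ δ > 0, ∀ r ∈ Set.Icc 0 T, |r - t| < δ →
      OpBound 1 (B r - B t - (r - t) • dB t).apply (η * |r - t|))

/-- The `N`-th left Riemann sum of `∫_s^t dB_r ∘ (B_r - B_s)`, over the partition of `[s, t]` into
`N` intervals of equal length, as an operator. -/
def riemannSum (B : ℝ → Op1 ι) (s t : ℝ) (N : ℕ) (f : Eu ι → ℝ) : Eu ι → ℝ :=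
  ∑ l ∈ Finset.range N,
    (B (s + (l + 1) * ((t - s) / N)) - B (s + l * ((t - s) / N))).apply
      ((B (s + l * ((t - s) / N)) - B s).apply f)

/-- `(δB, L)` is the canonical lift of the `C¹` path `B`: `L s t` belongs to `𝔻₂` and is the
Riemann--Stieltjes integral `∫_s^t dB_r ∘ (B_r - B_s)`, in the operator norm topology. -/
def IsCanonicalLift (T : ℝ) (B : ℝ → Op1 ι) (L : ℝ → ℝ → Op2 ι) : Prop :=
  IsC1Path T B ∧ ∀ s t, (s, t) ∈ simplex T → (L s t).MemD ∧
    ∀ η > 0, ∃ N₀ : ℕ, ∀ N ≥ N₀,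
      OpBound 2 (fun f => riemannSum B s t N f - (L s t).apply f) η

/-- Geometric drivers: those which are limits of canonical lifts of `C¹` paths, in the uniform
norm for the path and in the `1/(iα)`-variation norms for the components `i = 1, 2`, where the
variation norm of `g` is the infimum of `w 0 T ^ (iα)` over all controls `w` such that
`|g s t| ≤ w s t ^ (iα)`. -/
def IsGeometric (T α : ℝ) (B1 : ℝ → ℝ → Op1 ι) (B2 : ℝ → ℝ → Op2 ι) : Prop :=
  ∃ B : ℝ → Op1 ι, (∀ t ∈ Set.Icc 0 T, (B t).MemD) ∧
    (∀ s t, (s, t) ∈ simplex T → ∀ φ : 𝓓((⊤ : Opens (Eu ι)), ℝ),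
      (B1 s t).apply φ =ᵐ[volume] (B t - B s).apply φ) ∧
    ∃ (Bn : ℕ → ℝ → Op1 ι) (Ln : ℕ → ℝ → ℝ → Op2 ι) (η : ℕ → ℝ),
      (∀ n, IsCanonicalLift T (Bn n) (Ln n)) ∧ Tendsto η atTop (𝓝 0) ∧
      ∀ n, (∀ t ∈ Set.Icc 0 T, OpBound 1 (Bn n t - B t).apply (η n)) ∧
        (∃ w, IsControl T w ∧ w 0 T ^ α ≤ η n ∧ ∀ s t, (s, t) ∈ simplex T →
          OpBound 1 (Bn n t - Bn n s - B1 s t).apply (w s t ^ α)) ∧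
        (∃ w, IsControl T w ∧ w 0 T ^ (2 * α) ≤ η n ∧ ∀ s t, (s, t) ∈ simplex T →
          OpBound 2 (Ln n s t - B2 s t).apply (w s t ^ (2 * α)))

/-- The convention that the coefficients of the driver obey the same regularity in time as the
driver: up to a constant `K`, the control `ω` also dominates the coefficients of `B1` in
`(W^{3,∞})^d × W^{2,∞}`, and those of `B2` in `(W^{3,∞})^{d × d} × (W^{2,∞})^d × W^{1,∞}`. -/
def CoefficientsControlled (T α : ℝ) (ω : ℝ → ℝ → ℝ)
    (B1 : ℝ → ℝ → Op1 ι) (B2 : ℝ → ℝ → Op2 ι) : Prop :=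
  ∃ K : ℝ, ∀ s t, (s, t) ∈ simplex T →
    (B1 s t).coefNorm ≤ ENNReal.ofReal (K * ω s t ^ α) ∧
    (B2 s t).coefNorm ≤ ENNReal.ofReal (K * ω s t ^ (2 * α))

/-! ### Doubling of variables -/

/-- The first component `x` of a point `z = (x, y)`. -/
def xPart (z : Eu (ι ⊕ ι)) : Eu ι := WithLp.toLp 2 fun i => z (Sum.inl i)

/-- The second component `y` of a point `z = (x, y)`. -/
def yPart (z : Eu (ι ⊕ ι)) : Eu ι := WithLp.toLp 2 fun i => z (Sum.inr i)

/-- The point `(x, y)`. -/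
def mkPair (x y : Eu ι) : Eu (ι ⊕ ι) := WithLp.toLp 2 (Sum.elim (fun i => x i) fun i => y i)

/-- `V ⊗ id`. -/
def Op1.onX (V : Op1 ι) : Op1 (ι ⊕ ι) where
  X := Sum.elim (fun i z => V.X i (xPart z)) fun _ _ => 0
  Y := fun z => V.Y (xPart z)

/-- `id ⊗ V`. -/
def Op1.onY (V : Op1 ι) : Op1 (ι ⊕ ι) where
  X := Sum.elim (fun _ _ => 0) fun i z => V.X i (yPart z)
  Y := fun z => V.Y (yPart z)

/-- `V ⊗ id`. -/
def Op2.onX (V : Op2 ι) : Op2 (ι ⊕ ι) where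
  X := Sum.elim (fun i => Sum.elim (fun j z => V.X i j (xPart z)) fun _ _ => 0) fun _ _ _ => 0
  Y := Sum.elim (fun i z => V.Y i (xPart z)) fun _ _ => 0
  Z := fun z => V.Z (xPart z)

/-- `id ⊗ V`. -/
def Op2.onY (V : Op2 ι) : Op2 (ι ⊕ ι) where
  X := Sum.elim (fun _ _ _ => 0) fun i => Sum.elim (fun _ _ => 0) fun j z => V.X i j (yPart z)
  Y := Sum.elim (fun _ _ => 0) fun i z => V.Y i (yPart z)
  Z := fun z => V.Z (yPart z)

/-- `V ⊗ W`, that is `(V.X i(x) ∂_{x_i} + V.Y(x)) (W.X j(y) ∂_{y_j} + W.Y(y))`. -/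
def Op1.tensor (V W : Op1 ι) : Op2 (ι ⊕ ι) where
  X := Sum.elim
    (fun i => Sum.elim (fun _ _ => 0) fun j z => V.X i (xPart z) * W.X j (yPart z))
    fun _ _ _ => 0
  Y := Sum.elim (fun i z => V.X i (xPart z) * W.Y (yPart z))
    fun j z => V.Y (xPart z) * W.X j (yPart z)
  Z := fun z => V.Y (xPart z) * W.Y (yPart z)

/-- `Γ¹(B) = B¹ ⊗ id + id ⊗ B¹`. -/
def Gamma1 (B1 : ℝ → ℝ → Op1 ι) (s t : ℝ) : Op1 (ι ⊕ ι) := (B1 s t).onX + (B1 s t).onY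

/-- `Γ²(B) = B² ⊗ id + B¹ ⊗ B¹ + id ⊗ B²`. -/
def Gamma2 (B1 : ℝ → ℝ → Op1 ι) (B2 : ℝ → ℝ → Op2 ι) (s t : ℝ) : Op2 (ι ⊕ ι) :=
  (B2 s t).onX + (B1 s t).tensor (B1 s t) + (B2 s t).onY

/-- The set `Ω_ε^D = {(x, y) ∈ U × U : (x + y) / 2 ∈ D, |(x - y) / 2| < ε}`. -/
def OmegaD (U D : Opens (Eu ι)) (ε : ℝ) : Opens (Eu (ι ⊕ ι)) where
  carrier := {z | xPart z ∈ U ∧ yPart z ∈ U ∧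
    (1 / 2 : ℝ) • (xPart z + yPart z) ∈ D ∧
    (1 / 2 : ℝ) • (xPart z - yPart z) ∈ Metric.ball (0 : Eu ι) ε}
  is_open' := by
    have hx : Continuous (xPart : Eu (ι ⊕ ι) → Eu ι) := by unfold xPart; fun_prop
    have hy : Continuous (yPart : Eu (ι ⊕ ι) → Eu ι) := by unfold yPart; fun_prop
    have hp : Continuous fun z : Eu (ι ⊕ ι) => (1 / 2 : ℝ) • (xPart z + yPart z) := by
      fun_prop
    have hm : Continuous fun z : Eu (ι ⊕ ι) => (1 / 2 : ℝ) • (xPart z - yPart z) := by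
      fun_prop
    exact (U.isOpen.preimage hx).inter ((U.isOpen.preimage hy).inter
      ((D.isOpen.preimage hp).inter (Metric.isOpen_ball.preimage hm)))

/-- The point with `(x + y) / 2` unchanged and `(x - y) / 2` multiplied by `c`. -/
def stretch (c : ℝ) (z : Eu (ι ⊕ ι)) : Eu (ι ⊕ ι) :=
  mkPair ((1 / 2 : ℝ) • (xPart z + yPart z) + c • (1 / 2 : ℝ) • (xPart z - yPart z))
    ((1 / 2 : ℝ) • (xPart z + yPart z) - c • (1 / 2 : ℝ) • (xPart z - yPart z))

/-- The blow-up map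
`T_ε Φ (x, y) = (2ε)^{-d} Φ((x + y)/2 + (x - y)/(2ε), (x + y)/2 - (x - y)/(2ε))`. -/
def blowUp (ε : ℝ) (Φ : Eu (ι ⊕ ι) → ℝ) : Eu (ι ⊕ ι) → ℝ := fun z =>
  ((2 * ε) ^ Fintype.card ι)⁻¹ * Φ (stretch ε⁻¹ z)

/-- The inverse of the blow-up map `T_ε`. -/
def blowUpInv (ε : ℝ) (Ψ : Eu (ι ⊕ ι) → ℝ) : Eu (ι ⊕ ι) → ℝ := fun z =>
  (2 * ε) ^ Fintype.card ι * Ψ (stretch ε z)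

theorem stretch_stretch (a b : ℝ) (z : Eu (ι ⊕ ι)) :
    stretch a (stretch b z) = stretch (a * b) z := by
  ext i
  rcases i with i | i <;> simp [stretch, mkPair, xPart, yPart] <;> ring

theorem stretch_one (z : Eu (ι ⊕ ι)) : stretch 1 z = z := by
  ext i
  rcases i with i | i <;> simp [stretch, mkPair, xPart, yPart] <;> ring

theorem blowUpInv_blowUp {ε : ℝ} (hε : 0 < ε) (Φ : Eu (ι ⊕ ι) → ℝ) :
    blowUpInv ε (blowUp ε Φ) = Φ := by
  funext z
  have h : (2 * ε) ^ Fintype.card ι ≠ 0 := by positivity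
  simp [blowUpInv, blowUp, stretch_stretch, hε.ne', stretch_one, h]

theorem blowUp_blowUpInv {ε : ℝ} (hε : 0 < ε) (Φ : Eu (ι ⊕ ι) → ℝ) :
    blowUp ε (blowUpInv ε Φ) = Φ := by
  funext z
  have h : (2 * ε) ^ Fintype.card ι ≠ 0 := by positivity
  simp [blowUpInv, blowUp, stretch_stretch, hε.ne', stretch_one, h]

/-! ### Sobolev spaces of negative order based on `L¹` -/

/-- A family of functions, one for each partial derivative of order at most `m`. -/
abbrev Antideriv (ι : Type) (m : ℕ) : Type := (j : Fin (m + 1)) → (Fin j → ι) → Eu ι → ℝ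

/-- The pairing `∑ (-1)^j ∫_O f_s ∂_s Ψ` of the distribution `∑ ∂_s f_s` with a function `Ψ`
in `W^{m,∞}` with compact support in `O`. -/
def pairing (O : Opens (Eu ι)) {m : ℕ} (f : Antideriv ι m) (Ψ : Eu ι → ℝ) : ℝ :=
  ∑ j : Fin (m + 1), ∑ s : Fin j → ι,
    (-1) ^ (j : ℕ) * ∫ x in O, f j s x * weakDeriv O s Ψ x

/-- `v = ∑ ∂_s f_s` in the sense of distributions on `O`, with all `f_s` in `L¹(O)`. -/
def IsAntideriv {O : Opens (Eu ι)} {m : ℕ} (v : 𝓓'(O, ℝ)) (f : Antideriv ι m) : Prop :=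
  (∀ j s, IntegrableOn (f j s) O) ∧
    ∀ φ : 𝓓(O, ℝ), v φ = ∑ j : Fin (m + 1), ∑ s : Fin j → ι,
      (-1) ^ (j : ℕ) * ∫ x in O, f j s x * (∂^{dirs s} φ) x

/-- The norm of `W^{-m,1}(O)`: the infimum of the `L¹`-norms of the antiderivatives. It is `∞`
exactly when `v` does not belong to `W^{-m,1}(O)`. -/
def negNorm {O : Opens (Eu ι)} (m : ℕ) (v : 𝓓'(O, ℝ)) : ℝ≥0∞ :=
  ⨅ (f : Antideriv ι m) (_ : IsAntideriv v f),
    ∑ j : Fin (m + 1), ∑ s : Fin j → ι, ∫⁻ x in O, ‖f j s x‖ₑ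

/-- `w = P v` on `O`, for a distribution `v` in `W^{-m,1}(O)` and the operator `P` whose formal
adjoint is `Padj`: one has `⟨w, Φ⟩ = ⟨v, Padj Φ⟩` for every test function `Φ`, where the right
hand side is computed through any antiderivative of `v`. -/
def IsImage {O : Opens (Eu ι)} (m : ℕ) (Padj : (Eu ι → ℝ) → Eu ι → ℝ) (v w : 𝓓'(O, ℝ)) : Prop :=
  ∀ f : Antideriv ι m, IsAntideriv v f → ∀ Φ : 𝓓(O, ℝ), w Φ = pairing O f (Padj Φ)

/-- The operator with formal adjoint `Padj` maps `W^{-m,1}(O)` to `W^{-(m+i),1}(O)` with operator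
norm at most `M`. -/
def NegOpBound (O : Opens (Eu ι)) (m i : ℕ) (Padj : (Eu ι → ℝ) → Eu ι → ℝ) (M : ℝ) : Prop :=
  ∀ v : 𝓓'(O, ℝ), negNorm m v < ⊤ → ∃ w : 𝓓'(O, ℝ), IsImage m Padj v w ∧
    negNorm (m + i) w ≤ ENNReal.ofReal M * negNorm m v

/-- The adjoint `T_ε⁻¹ P* T_ε` of the conjugated operator `T_ε* P (T_ε*)⁻¹`, where `Padj = P*`. -/
def conjAdjoint (ε : ℝ) (Padj : (Eu (ι ⊕ ι) → ℝ) → Eu (ι ⊕ ι) → ℝ)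
    (Φ : Eu (ι ⊕ ι) → ℝ) : Eu (ι ⊕ ι) → ℝ :=
  blowUpInv ε (Padj (blowUp ε Φ))

end RoughDriver

end

noncomputable section

open scoped ContDiff

set_option linter.unusedSectionVars false

namespace RoughDriver

variable {ι κ : Type} [Fintype ι] [DecidableEq ι] [Fintype κ] [DecidableEq κ]

/-! ### Partial derivatives of smooth functions -/

section

/-! The first assertion is algebra combined with product estimates. Operators acting on different
variables commute, so `(W ⊗ id + id ⊗ W) ∘ (V ⊗ id + id ⊗ V)` equals `W ∘ V ⊗ id + W ⊗ V + V ⊗ W +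
id ⊗ W ∘ V`. The mixed terms are exactly the ones produced by expanding `B¹_st ⊗ B¹_st` with `B¹_st
= B¹_sθ + B¹_θt`, and Chen's relation for `Γ(B)` follows from that for `B`. The bounds in `𝓛(H^k,
H^(k-i))` come from the coefficients, because multiplication by a function in `W^{m,∞}` is bounded
on `H^k` for `|k| ≤ m` (`hNorm_mul_le`).

For the uniform bound, put `p = (x + y)/2` and `v = (x - y)/2`. Conjugation by the blow-up rescales
`v`, so each derivative in `v` costs a factor `1/ε`. For a doubled first order operator this
derivative comes with a difference of coefficients, and together they form the quotient `(X(p + εv)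
- X(p - εv)) / 2ε`, which on `|v| < 1` is bounded by one more derivative of `X`
(`Op1.conjAdjoint_dbl_cl`, `jet_diffQuot_le`). A general second order operator would meet an
uncompensated `1/ε²`. Geometricity rules this out: integration by parts shows that the second order
coefficients of `B²` have symmetric part `X i X j / 2`, with `X` the coefficients of `B¹`
(`IsGeometric.ae_symm`). Hence `B² - (B¹ ∘ B¹)/2` has order one and `Γ² = (Γ¹ ∘ Γ¹)/2 + R`, with `R`
a doubled first order operator. As conjugation respects composition, the first order estimate
suffices (`negOpBound_conj_two`).

The identity for the symmetric part is checked on canonical lifts, where the Riemann sums for `(i,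
j)` and `(j, i)` telescope up to a sum of products of increments, of size `1/N`. It survives the
limit since operator norms control coefficients in `L²` on balls: these are recovered by applying
the operator to cut-offs of `1`, `x i`, `x i * x j`.

Coefficients are only weakly differentiable. They are therefore carried along by mollified sequences
with uniform bounds and derivatives converging almost everywhere (`Reg`, `exists_reg`). Identities
are proved for smooth coefficients and passed to the limit. On the dual side, a limit of operators
of order `i` with such coefficients, acting on test functions, induces a bounded map from `W^{-m,1}`
to `W^{-(m+i),1}` (`RegOp.negOpBound`). -/

/-- Smooth real functions on a Euclidean space. -/
abbrev Smooth (f : Eu κ → ℝ) : Prop := ContDiff ℝ ∞ f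

/-- The classical partial derivative `∂_i f`. -/
def pd1 (i : κ) (f : Eu κ → ℝ) : Eu κ → ℝ := fun x => fderiv ℝ f x (EuclideanSpace.single i 1)

/-- The classical iterated partial derivative `∂_{s 0} ⋯ ∂_{s (n-1)} f`. -/
def pd : {n : ℕ} → (Fin n → κ) → (Eu κ → ℝ) → Eu κ → ℝ
  | 0, _, f => f
  | _ + 1, s, f => pd1 (s 0) (pd (Fin.tail s) f)

@[simp] theorem pd_zero (s : Fin 0 → κ) (f : Eu κ → ℝ) : pd s f = f := rfl

theorem pd_succ {n : ℕ} (s : Fin (n + 1) → κ) (f : Eu κ → ℝ) :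
    pd s f = pd1 (s 0) (pd (Fin.tail s) f) := rfl

@[simp] theorem pd_one (i : κ) (f : Eu κ → ℝ) : pd ![i] f = pd1 i f := rfl

@[simp] theorem pd_two (i j : κ) (f : Eu κ → ℝ) : pd ![i, j] f = pd1 i (pd1 j f) := rfl

theorem Smooth.pd1 {f : Eu κ → ℝ} (hf : Smooth f) (i : κ) : Smooth (pd1 i f) :=
  (hf.fderiv_right (m := ∞) le_rfl).clm_apply contDiff_const

theorem Smooth.pd {f : Eu κ → ℝ} (hf : Smooth f) {n : ℕ} (s : Fin n → κ) : Smooth (pd s f) := by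
  induction n with
  | zero => exact hf
  | succ n ih => exact (ih (Fin.tail s)).pd1 (s 0)

theorem Smooth.add {f g : Eu κ → ℝ} (hf : Smooth f) (hg : Smooth g) : Smooth (f + g) :=
  ContDiff.add hf hg

theorem Smooth.sub {f g : Eu κ → ℝ} (hf : Smooth f) (hg : Smooth g) : Smooth (f - g) :=
  ContDiff.sub hf hg

theorem Smooth.mul {f g : Eu κ → ℝ} (hf : Smooth f) (hg : Smooth g) : Smooth (f * g) :=
  ContDiff.mul hf hg

theorem Smooth.neg {f : Eu κ → ℝ} (hf : Smooth f) : Smooth (-f) := ContDiff.neg hf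

theorem Smooth.smul {f : Eu κ → ℝ} (hf : Smooth f) (c : ℝ) : Smooth (c • f) :=
  ContDiff.const_smul c hf

theorem Smooth.sum {α : Type*} {s : Finset α} {f : α → Eu κ → ℝ} (hf : ∀ a ∈ s, Smooth (f a)) :
    Smooth (∑ a ∈ s, f a) := by
  have := ContDiff.sum (s := s) (f := f) (n := ∞) (𝕜 := ℝ) hf
  convert this using 1
  funext x; simp

theorem Smooth.differentiableAt {f : Eu κ → ℝ} (hf : Smooth f) (x : Eu κ) :
    DifferentiableAt ℝ f x := (hf.differentiable (by simp)).differentiableAt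

theorem pd1_add {f g : Eu κ → ℝ} (hf : Smooth f) (hg : Smooth g) (i : κ) :
    pd1 i (f + g) = pd1 i f + pd1 i g := by
  funext x
  simp [pd1, fderiv_add (hf.differentiableAt x) (hg.differentiableAt x)]

theorem pd1_sub {f g : Eu κ → ℝ} (hf : Smooth f) (hg : Smooth g) (i : κ) :
    pd1 i (f - g) = pd1 i f - pd1 i g := by
  funext x
  simp [pd1, fderiv_sub (hf.differentiableAt x) (hg.differentiableAt x)]

theorem pd1_smul {f : Eu κ → ℝ} (hf : Smooth f) (c : ℝ) (i : κ) :
    pd1 i (c • f) = c • pd1 i f := by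
  funext x
  simp [pd1, fderiv_const_smul (hf.differentiableAt x)]

theorem pd1_mul {f g : Eu κ → ℝ} (hf : Smooth f) (hg : Smooth g) (i : κ) :
    pd1 i (f * g) = pd1 i f * g + f * pd1 i g := by
  funext x
  simp [pd1, fderiv_mul (hf.differentiableAt x) (hg.differentiableAt x)]
  ring

theorem pd1_sum {α : Type*} (s : Finset α) {f : α → Eu κ → ℝ} (hf : ∀ a ∈ s, Smooth (f a)) (i : κ) :
    pd1 i (∑ a ∈ s, f a) = ∑ a ∈ s, pd1 i (f a) := by
  funext x
  simp [pd1, fderiv_sum fun a ha => (hf a ha).differentiableAt x]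

@[simp] theorem pd1_const (c : ℝ) (i : κ) : pd1 i (fun _ : Eu κ => c) = 0 := by
  funext x; simp [pd1]

@[simp] theorem pd1_zero (i : κ) : pd1 i (0 : Eu κ → ℝ) = 0 := pd1_const 0 i

theorem pd1_comm {f : Eu κ → ℝ} (hf : Smooth f) (i j : κ) : pd1 i (pd1 j f) = pd1 j (pd1 i f) := by
  funext x
  have hd : DifferentiableAt ℝ (fderiv ℝ f) x :=
    ((hf.fderiv_right (m := ∞) le_rfl).differentiable (by simp)).differentiableAt
  have h : ∀ a b : κ, pd1 a (pd1 b f) x =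
      fderiv ℝ (fderiv ℝ f) x (EuclideanSpace.single a 1) (EuclideanSpace.single b 1) := by
    intro a b
    unfold pd1
    rw [fderiv_clm_apply hd (differentiableAt_const _)]
    simp
  rw [h, h]
  exact (hf.contDiffAt.isSymmSndFDerivAt (by simp only [minSmoothness_of_isRCLikeNormedField]; exact WithTop.coe_le_coe.2 le_top)).eq _ _

theorem pd1_pd {f : Eu κ → ℝ} (hf : Smooth f) (i : κ) {n : ℕ} (s : Fin n → κ) :
    pd1 i (pd s f) = pd s (pd1 i f) := by
  induction n with
  | zero => rfl
  | succ n ih => rw [pd_succ, pd1_comm (hf.pd _), ih, ← pd_succ]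

theorem pd_sub {f g : Eu κ → ℝ} (hf : Smooth f) (hg : Smooth g) {n : ℕ} (s : Fin n → κ) :
    pd s (f - g) = pd s f - pd s g := by
  induction n with
  | zero => rfl
  | succ n ih => rw [pd_succ, ih, pd1_sub (hf.pd _) (hg.pd _)]; rfl

theorem tsupport_pd1_subset (i : κ) (f : Eu κ → ℝ) : tsupport (pd1 i f) ⊆ tsupport f :=
  tsupport_fderiv_apply_subset ℝ _

theorem tsupport_pd_subset {n : ℕ} (s : Fin n → κ) (f : Eu κ → ℝ) :
    tsupport (pd s f) ⊆ tsupport f := by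
  induction n with
  | zero => exact subset_rfl
  | succ n ih => exact (tsupport_pd1_subset _ _).trans (ih _)

theorem HasCompactSupport.pd {f : Eu κ → ℝ} (hf : HasCompactSupport f) {n : ℕ} (s : Fin n → κ) :
    HasCompactSupport (pd s f) := hf.of_isClosed_subset (isClosed_tsupport _) (tsupport_pd_subset s f)

theorem HasCompactSupport.pd1 {f : Eu κ → ℝ} (hf : HasCompactSupport f) (i : κ) :
    HasCompactSupport (pd1 i f) := HasCompactSupport.pd hf ![i]

/-! ### Test functions -/

theorem smooth_test {O : Opens (Eu κ)} (φ : 𝓓(O, ℝ)) : Smooth φ := φ.contDiff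

/-- A smooth function with compact support in `O`, as a test function. -/
def mkTest {O : Opens (Eu κ)} (f : Eu κ → ℝ) (h1 : Smooth f) (h2 : HasCompactSupport f)
    (h3 : tsupport f ⊆ O) : 𝓓(O, ℝ) := ⟨f, h1, h2, h3⟩

@[simp] theorem coe_mkTest {O : Opens (Eu κ)} (f : Eu κ → ℝ) (h1 : Smooth f)
    (h2 : HasCompactSupport f) (h3 : tsupport f ⊆ O) : (mkTest f h1 h2 h3 : Eu κ → ℝ) = f := rfl

/-- The product of a smooth function and a test function. -/
def mulTest {O : Opens (Eu κ)} (f : Eu κ → ℝ) (hf : Smooth f) (φ : 𝓓(O, ℝ)) : 𝓓(O, ℝ) :=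
  mkTest (f * φ) (hf.mul (smooth_test φ)) φ.hasCompactSupport.mul_left
    ((tsupport_mul_subset_right).trans φ.tsupport_subset)

@[simp] theorem coe_mulTest {O : Opens (Eu κ)} (f : Eu κ → ℝ) (hf : Smooth f) (φ : 𝓓(O, ℝ)) :
    (mulTest f hf φ : Eu κ → ℝ) = f * φ := rfl

/-- The partial derivative of a test function. -/
def pdTest {O : Opens (Eu κ)} {n : ℕ} (s : Fin n → κ) (φ : 𝓓(O, ℝ)) : 𝓓(O, ℝ) :=
  mkTest (pd s φ) ((smooth_test φ).pd s) (HasCompactSupport.pd φ.hasCompactSupport s)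
    ((tsupport_pd_subset s φ).trans φ.tsupport_subset)

@[simp] theorem coe_pdTest {O : Opens (Eu κ)} {n : ℕ} (s : Fin n → κ) (φ : 𝓓(O, ℝ)) :
    (pdTest s φ : Eu κ → ℝ) = pd s φ := rfl

theorem coe_lineDerivOp {O : Opens (Eu κ)} (i : κ) (φ : 𝓓(O, ℝ)) :
    ((∂_{EuclideanSpace.single i (1 : ℝ)} φ : 𝓓(O, ℝ)) : Eu κ → ℝ) = pd1 i φ := by
  funext x
  rw [TestFunction.lineDerivOp_eq_lineDerivCLM ℝ, TestFunction.lineDerivCLM_eq_fderivCLM,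
    TestFunction.fderivCLM_apply]
  simp [pd1]

theorem coe_iteratedLineDerivOp {O : Opens (Eu κ)} {n : ℕ} (s : Fin n → κ) (φ : 𝓓(O, ℝ)) :
    ((∂^{dirs s} φ : 𝓓(O, ℝ)) : Eu κ → ℝ) = pd s φ := by
  induction n with
  | zero => rfl
  | succ n ih =>
    rw [LineDeriv.iteratedLineDerivOp_succ_left, pd_succ, ← ih (Fin.tail s)]
    exact coe_lineDerivOp _ _

theorem integral_pd1_mul {f φ : Eu κ → ℝ} (hf : Smooth f) (hφ : Smooth φ)
    (hc : HasCompactSupport φ) (i : κ) :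
    ∫ x, pd1 i f x * φ x = -∫ x, f x * pd1 i φ x := by
  have hi : ∀ {g ψ : Eu κ → ℝ}, Smooth g → Smooth ψ → HasCompactSupport ψ →
      Integrable (fun x => g x * ψ x) := fun hg hψ hψc =>
    (hg.continuous.mul hψ.continuous).integrable_of_hasCompactSupport hψc.mul_left
  have := integral_mul_fderiv_eq_neg_fderiv_mul_of_integrable (μ := volume) (f := f) (g := φ)
    (v := EuclideanSpace.single i (1 : ℝ)) (hi (hf.pd1 i) hφ hc)
    (hi hf (hφ.pd1 i) (HasCompactSupport.pd1 hc i)) (hi hf hφ hc)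
    (fun x _ => hf.differentiableAt x) (fun x _ => hφ.differentiableAt x)
  rw [← neg_eq_iff_eq_neg]
  exact this.symm

theorem integral_pd_mul {f φ : Eu κ → ℝ} (hf : Smooth f) (hφ : Smooth φ)
    (hc : HasCompactSupport φ) {n : ℕ} (s : Fin n → κ) :
    ∫ x, pd s f x * φ x = (-1) ^ n * ∫ x, f x * pd s φ x := by
  induction n generalizing φ with
  | zero => simp
  | succ n ih =>
    rw [pd_succ, integral_pd1_mul (hf.pd _) hφ hc, ih (hφ.pd1 _) (HasCompactSupport.pd1 hc _),
      ← pd1_pd hφ, ← pd_succ]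
    ring

/-! ### Jets -/

/-- The sum of the absolute values of all iterated partial derivatives of order at most `m`. -/
def jet : ℕ → (Eu κ → ℝ) → Eu κ → ℝ
  | 0, f, x => |f x|
  | m + 1, f, x => |f x| + ∑ i, jet m (pd1 i f) x

theorem jet_succ (m : ℕ) (f : Eu κ → ℝ) (x : Eu κ) :
    jet (m + 1) f x = |f x| + ∑ i, jet m (pd1 i f) x := rfl

theorem jet_nonneg (m : ℕ) (f : Eu κ → ℝ) (x : Eu κ) : 0 ≤ jet m f x := by
  induction m generalizing f with
  | zero => exact abs_nonneg _
  | succ m ih => exact add_nonneg (abs_nonneg _) (Finset.sum_nonneg fun i _ => ih _)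

theorem abs_le_jet (m : ℕ) (f : Eu κ → ℝ) (x : Eu κ) : |f x| ≤ jet m f x := by
  cases m with
  | zero => exact le_rfl
  | succ m => exact le_add_of_nonneg_right (Finset.sum_nonneg fun i _ => jet_nonneg _ _ _)

theorem jet_pd1_le (m : ℕ) (f : Eu κ → ℝ) (x : Eu κ) (i : κ) :
    jet m (pd1 i f) x ≤ jet (m + 1) f x :=
  (Finset.single_le_sum (f := fun i => jet m (pd1 i f) x) (fun _ _ => jet_nonneg _ _ _)
    (Finset.mem_univ i)).trans (le_add_of_nonneg_left (abs_nonneg _))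

theorem jet_le_succ (m : ℕ) (f : Eu κ → ℝ) (x : Eu κ) : jet m f x ≤ jet (m + 1) f x := by
  induction m generalizing f with
  | zero => exact abs_le_jet 1 f x
  | succ m ih => exact add_le_add le_rfl (Finset.sum_le_sum fun i _ => ih _)

theorem jet_mono {m n : ℕ} (h : m ≤ n) (f : Eu κ → ℝ) (x : Eu κ) : jet m f x ≤ jet n f x :=
  monotone_nat_of_le_succ (f := fun m => jet m f x) (fun m => jet_le_succ m f x) h

theorem abs_pd_le_jet {f : Eu κ → ℝ} (hf : Smooth f) {n : ℕ} (s : Fin n → κ) (x : Eu κ) :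
    |pd s f x| ≤ jet n f x := by
  induction n generalizing f with
  | zero => exact le_rfl
  | succ n ih =>
    rw [pd_succ, pd1_pd hf]
    exact (ih (hf.pd1 _) _).trans (jet_pd1_le _ _ _ _)

theorem jet_add_le {f g : Eu κ → ℝ} (hf : Smooth f) (hg : Smooth g) (m : ℕ) (x : Eu κ) :
    jet m (f + g) x ≤ jet m f x + jet m g x := by
  induction m generalizing f g with
  | zero => exact abs_add_le _ _
  | succ m ih =>
    simp only [jet_succ, pd1_add hf hg]
    have h1 := Finset.sum_le_sum fun i (_ : i ∈ Finset.univ) => ih (hf.pd1 i) (hg.pd1 i)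
    rw [Finset.sum_add_distrib] at h1
    have h2 := abs_add_le (f x) (g x)
    simp only [Pi.add_apply] at *
    linarith

theorem jet_smul {f : Eu κ → ℝ} (hf : Smooth f) (c : ℝ) (m : ℕ) (x : Eu κ) :
    jet m (c • f) x = |c| * jet m f x := by
  induction m generalizing f with
  | zero => simp [jet, abs_mul]
  | succ m ih =>
    simp only [jet_succ, pd1_smul hf, ih (hf.pd1 _), Pi.smul_apply, smul_eq_mul, abs_mul, mul_add,
      Finset.mul_sum]

theorem jet_sub_le {f g : Eu κ → ℝ} (hf : Smooth f) (hg : Smooth g) (m : ℕ) (x : Eu κ) :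
    jet m (f - g) x ≤ jet m f x + jet m g x := by
  have h : f - g = f + (-1 : ℝ) • g := by simp [sub_eq_add_neg]
  rw [h]
  refine (jet_add_le hf (hg.smul (-1 : ℝ)) m x).trans_eq ?_
  rw [jet_smul hg]
  simp

@[simp] theorem jet_zero_fun (m : ℕ) (x : Eu κ) : jet m (0 : Eu κ → ℝ) x = 0 := by
  induction m with
  | zero => simp [jet]
  | succ m ih => simp [jet_succ, ih]

theorem jet_mul_le {f g : Eu κ → ℝ} (hf : Smooth f) (hg : Smooth g) (m : ℕ) (x : Eu κ) :
    jet m (f * g) x ≤ 2 ^ m * (jet m f x * jet m g x) := by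
  induction m generalizing f g with
  | zero => simp [jet, abs_mul]
  | succ m ih =>
    have h1 : ∀ i, jet m (pd1 i (f * g)) x ≤
        2 ^ m * (jet m (pd1 i f) x * jet (m + 1) g x) +
          2 ^ m * (jet (m + 1) f x * jet m (pd1 i g) x) := by
      intro i
      rw [pd1_mul hf hg]
      refine (jet_add_le ((hf.pd1 i).mul hg) (hf.mul (hg.pd1 i)) m x).trans (add_le_add ?_ ?_)
      · refine (ih (hf.pd1 i) hg).trans ?_
        have := mul_le_mul_of_nonneg_left (jet_le_succ m g x) (jet_nonneg m (pd1 i f) x)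
        gcongr
      · refine (ih hf (hg.pd1 i)).trans ?_
        have := mul_le_mul_of_nonneg_right (jet_le_succ m f x) (jet_nonneg m (pd1 i g) x)
        gcongr
    have h2 := Finset.sum_le_sum fun i (_ : i ∈ Finset.univ) => h1 i
    rw [Finset.sum_add_distrib, ← Finset.mul_sum, ← Finset.mul_sum, ← Finset.sum_mul,
      ← Finset.mul_sum] at h2
    have hF := jet_succ m f x
    have hG := jet_succ m g x
    rw [jet_succ m (f * g) x, Pi.mul_apply, abs_mul]
    set F := jet (m + 1) f x
    set G := jet (m + 1) g x
    have hfF : 0 ≤ |f x| := abs_nonneg _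
    have hgG : 0 ≤ |g x| := abs_nonneg _
    have hgG' : |g x| ≤ G := abs_le_jet _ _ _
    have hF0 : 0 ≤ F := jet_nonneg _ _ _
    have hG0 : 0 ≤ G := jet_nonneg _ _ _
    have e1 : ∑ i, jet m (pd1 i f) x = F - |f x| := by linarith
    have e2 : ∑ i, jet m (pd1 i g) x = G - |g x| := by linarith
    rw [e1, e2] at h2
    have h3 : (1 : ℝ) ≤ 2 ^ m := one_le_pow₀ (by norm_num)
    -- The Leibniz sum `h2` is `2 ^ m * ((F - |f|) * G + F * (G - |g|))`. The missing `|f| * G`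
    -- absorbs the term of order zero, so each order costs only a factor two.
    have h4 : |f x| * |g x| ≤ 2 ^ m * (|f x| * G) := by
      calc |f x| * |g x| ≤ 1 * (|f x| * G) := by rw [one_mul]; gcongr
        _ ≤ _ := by gcongr
    have h5 : 0 ≤ 2 ^ m * (F * |g x|) := by positivity
    calc _ ≤ _ := add_le_add h4 h2
      _ ≤ _ := by rw [pow_succ]; nlinarith

/-! ### Linear changes of variables -/

/-- The linear map `(x, y) ↦ a x + b y`. -/
def comb (a b : ℝ) : Eu (ι ⊕ ι) →L[ℝ] Eu ι :=
  LinearMap.toContinuousLinearMap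
    { toFun := fun z => a • xPart z + b • yPart z
      map_add' := by intro z w; ext i; simp [xPart, yPart]; ring
      map_smul' := by intro c z; ext i; simp [xPart, yPart]; ring }

theorem comb_apply (a b : ℝ) (z : Eu (ι ⊕ ι)) : comb a b z = a • xPart z + b • yPart z := rfl

@[simp] theorem comb_one_zero (z : Eu (ι ⊕ ι)) : comb 1 0 z = xPart z := by simp [comb_apply]

@[simp] theorem comb_zero_one (z : Eu (ι ⊕ ι)) : comb 0 1 z = yPart z := by simp [comb_apply]

theorem comb_single_inl (a b : ℝ) (i : ι) :
    comb a b (EuclideanSpace.single (Sum.inl i) 1) = a • EuclideanSpace.single i (1 : ℝ) := by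
  ext j; simp [comb_apply, xPart, yPart]

theorem comb_single_inr (a b : ℝ) (i : ι) :
    comb a b (EuclideanSpace.single (Sum.inr i) 1) = b • EuclideanSpace.single i (1 : ℝ) := by
  ext j; simp [comb_apply, xPart, yPart]

theorem comb_surjective {a b : ℝ} (h : a ≠ 0 ∨ b ≠ 0) :
    Function.Surjective (comb a b : Eu (ι ⊕ ι) → Eu ι) := by
  intro x
  rcases h with h | h
  · refine ⟨mkPair (a⁻¹ • x) 0, ?_⟩
    ext i; simp [comb_apply, xPart, yPart, mkPair, h]
  · refine ⟨mkPair 0 (b⁻¹ • x), ?_⟩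
    ext i; simp [comb_apply, xPart, yPart, mkPair, h]

theorem Smooth.comp_comb {f : Eu ι → ℝ} (hf : Smooth f) (a b : ℝ) :
    Smooth (fun z => f (comb a b z)) := by
  have h : ContDiff ℝ ∞ (fun z : Eu (ι ⊕ ι) => comb a b z) := by fun_prop
  exact ContDiff.comp (g := f) hf h

theorem pd1_inl_comp_comb {f : Eu ι → ℝ} (hf : Smooth f) (a b : ℝ) (i : ι) :
    pd1 (Sum.inl i) (fun z => f (comb a b z)) = a • fun z => pd1 i f (comb a b z) := by
  funext z
  have := fderiv_comp z (hf.differentiableAt (comb a b z)) (comb a b).differentiableAt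
  unfold pd1
  erw [this]
  simp [comb_single_inl]

theorem pd1_inr_comp_comb {f : Eu ι → ℝ} (hf : Smooth f) (a b : ℝ) (i : ι) :
    pd1 (Sum.inr i) (fun z => f (comb a b z)) = b • fun z => pd1 i f (comb a b z) := by
  funext z
  have := fderiv_comp z (hf.differentiableAt (comb a b z)) (comb a b).differentiableAt
  unfold pd1
  erw [this]
  simp [comb_single_inr]

/-- The derivatives in `x_i` and `y_i` carry the factors `a` and `b`. Added up they give at most
`|a| + |b| ≤ 1` times one derivative of `f`, so no constant accumulates with the order. -/
theorem jet_comp_comb_le {f : Eu ι → ℝ} (hf : Smooth f) {a b : ℝ} (hab : |a| + |b| ≤ 1) (m : ℕ)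
    (z : Eu (ι ⊕ ι)) : jet m (fun z => f (comb a b z)) z ≤ jet m f (comb a b z) := by
  induction m generalizing f with
  | zero => exact le_rfl
  | succ m ih =>
    rw [jet_succ, jet_succ, Fintype.sum_sum_type, ← Finset.sum_add_distrib]
    refine add_le_add le_rfl (Finset.sum_le_sum fun i _ => ?_)
    rw [pd1_inl_comp_comb hf, pd1_inr_comp_comb hf, jet_smul ((hf.pd1 i).comp_comb a b),
      jet_smul ((hf.pd1 i).comp_comb a b), ← add_mul]
    calc _ ≤ 1 * jet m (fun z => pd1 i f (comb a b z)) z :=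
          mul_le_mul_of_nonneg_right hab (jet_nonneg _ _ _)
      _ ≤ _ := by rw [one_mul]; exact ih (hf.pd1 i)

/-- The difference quotient `(f(p + εv) - f(p - εv)) / 2ε`, for `p = (x + y)/2`, `v = (x - y)/2`. -/
def diffQuot (ε : ℝ) (f : Eu ι → ℝ) : Eu (ι ⊕ ι) → ℝ :=
  (2 * ε)⁻¹ • ((fun z => f (comb ((1 + ε) / 2) ((1 - ε) / 2) z)) -
    fun z => f (comb ((1 - ε) / 2) ((1 + ε) / 2) z))

theorem Smooth.diffQuot {f : Eu ι → ℝ} (hf : Smooth f) (ε : ℝ) : Smooth (diffQuot ε f) :=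
  ((hf.comp_comb _ _).sub (hf.comp_comb _ _)).smul _

theorem norm_fderiv_le_jet (f : Eu κ → ℝ) (x : Eu κ) : ‖fderiv ℝ f x‖ ≤ jet 1 f x := by
  refine ContinuousLinearMap.opNorm_le_bound _ (jet_nonneg _ _ _) fun v => ?_
  have hv : v = ∑ i, v i • EuclideanSpace.single i (1 : ℝ) := by
    ext j; simp [Finset.sum_apply, Pi.single_apply]
  have h1 : fderiv ℝ f x v = ∑ i, v i * pd1 i f x := by
    conv_lhs => rw [hv]
    simp [pd1]
  rw [h1]
  calc ‖∑ i, v i * pd1 i f x‖ ≤ ∑ i, ‖v‖ * |pd1 i f x| := by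
        refine (norm_sum_le _ _).trans (Finset.sum_le_sum fun i _ => ?_)
        rw [norm_mul]
        exact mul_le_mul_of_nonneg_right (PiLp.norm_apply_le v i) (abs_nonneg _)
    _ = (∑ i, |pd1 i f x|) * ‖v‖ := by rw [← Finset.mul_sum, mul_comm]
    _ ≤ jet 1 f x * ‖v‖ := by
        refine mul_le_mul_of_nonneg_right ?_ (norm_nonneg _)
        exact le_add_of_nonneg_left (abs_nonneg _)

/-- The strip `|(x - y)/2| < 1`. -/
def strip (ι : Type) [Fintype ι] : Set (Eu (ι ⊕ ι)) :=
  {z | ‖(1 / 2 : ℝ) • (xPart z - yPart z)‖ < 1}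

/-- At order zero this is the mean value inequality: on the strip the two points are at distance
less than `2ε`, which cancels the denominator. A derivative in `x_i` or `y_i` turns the quotient of
`f` into half the quotient of `∂_i f` plus or minus a quarter of the sum of the two values of `∂_i
f`. No new power of `1/ε` appears, and induction applies to `∂_i f`. -/
theorem jet_diffQuot_le {ε : ℝ} (h0 : 0 < ε) (h1 : ε ≤ 1) {f : Eu ι → ℝ} (hf : Smooth f) {M : ℝ}
    (m : ℕ) (hM : ∀ x, jet (m + 1) f x ≤ M) {z : Eu (ι ⊕ ι)} (hz : z ∈ strip ι) :
    jet m (diffQuot ε f) z ≤ (2 * Fintype.card ι + 1) ^ m * M := by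
  have hab : |(1 + ε) / 2| + |(1 - ε) / 2| ≤ 1 := by
    rw [abs_of_nonneg (by linarith), abs_of_nonneg (by linarith)]; linarith
  have hab' : |(1 - ε) / 2| + |(1 + ε) / 2| ≤ 1 := by rw [add_comm]; exact hab
  have base : ∀ {g : Eu ι → ℝ} {M : ℝ}, Smooth g → (∀ x, jet 1 g x ≤ M) →
      |diffQuot ε g z| ≤ M := by
    intro g M hg hM
    have hM0 : 0 ≤ M := (jet_nonneg _ _ _).trans (hM 0)
    have := Convex.norm_image_sub_le_of_norm_fderiv_le (𝕜 := ℝ) (f := g) (s := Set.univ) (C := M)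
      (fun x _ => hg.differentiableAt x) (fun x _ => (norm_fderiv_le_jet g x).trans (hM x))
      convex_univ (Set.mem_univ (comb ((1 - ε) / 2) ((1 + ε) / 2) z))
      (Set.mem_univ (comb ((1 + ε) / 2) ((1 - ε) / 2) z))
    have h2 : comb ((1 + ε) / 2) ((1 - ε) / 2) z - comb ((1 - ε) / 2) ((1 + ε) / 2) z =
        (2 * ε) • ((1 / 2 : ℝ) • (xPart z - yPart z)) := by
      ext i; simp [comb_apply]; ring
    rw [h2, norm_smul, Real.norm_of_nonneg (by linarith : (0 : ℝ) ≤ 2 * ε)] at this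
    have h3 : |diffQuot ε g z| = (2 * ε)⁻¹ * ‖g (comb ((1 + ε) / 2) ((1 - ε) / 2) z) -
        g (comb ((1 - ε) / 2) ((1 + ε) / 2) z)‖ := by
      have : 0 < (2 * ε)⁻¹ := by positivity
      simp only [diffQuot, Pi.smul_apply, Pi.sub_apply, smul_eq_mul, abs_mul, abs_of_pos this]
      rfl
    rw [h3]
    calc _ ≤ (2 * ε)⁻¹ * (M * (2 * ε * 1)) := by
          have hz' : ‖(1 / 2 : ℝ) • (xPart z - yPart z)‖ ≤ 1 := le_of_lt hz
          refine mul_le_mul_of_nonneg_left (le_trans this ?_) (by positivity)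
          exact mul_le_mul_of_nonneg_left (mul_le_mul_of_nonneg_left hz' (by positivity)) hM0
      _ = M := by field_simp
  induction m generalizing f M with
  | zero => simpa [jet] using base hf hM
  | succ m ih =>
    have hM0 : 0 ≤ M := (jet_nonneg _ _ _).trans (hM 0)
    set A : ι → Eu (ι ⊕ ι) → ℝ := fun i z => pd1 i f (comb ((1 + ε) / 2) ((1 - ε) / 2) z)
    set B : ι → Eu (ι ⊕ ι) → ℝ := fun i z => pd1 i f (comb ((1 - ε) / 2) ((1 + ε) / 2) z)
    have hA : ∀ i, Smooth (A i) := fun i => (hf.pd1 i).comp_comb _ _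
    have hB : ∀ i, Smooth (B i) := fun i => (hf.pd1 i).comp_comb _ _
    have hD : ∀ i, Smooth (diffQuot ε (pd1 i f)) := fun i => (hf.pd1 i).diffQuot ε
    have hl : ∀ i, pd1 (Sum.inl i) (diffQuot ε f) =
        (1 / 2 : ℝ) • diffQuot ε (pd1 i f) + (1 / 4 : ℝ) • (A i + B i) := by
      intro i
      rw [diffQuot, pd1_smul ((hf.comp_comb _ _).sub (hf.comp_comb _ _)),
        pd1_sub (hf.comp_comb _ _) (hf.comp_comb _ _), pd1_inl_comp_comb hf, pd1_inl_comp_comb hf]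
      funext z
      simp only [diffQuot, A, B, Pi.smul_apply, Pi.sub_apply, Pi.add_apply, smul_eq_mul]
      field_simp; ring
    have hr : ∀ i, pd1 (Sum.inr i) (diffQuot ε f) =
        (1 / 2 : ℝ) • diffQuot ε (pd1 i f) - (1 / 4 : ℝ) • (A i + B i) := by
      intro i
      rw [diffQuot, pd1_smul ((hf.comp_comb _ _).sub (hf.comp_comb _ _)),
        pd1_sub (hf.comp_comb _ _) (hf.comp_comb _ _), pd1_inr_comp_comb hf, pd1_inr_comp_comb hf]
      funext z
      simp only [diffQuot, A, B, Pi.smul_apply, Pi.sub_apply, Pi.add_apply, smul_eq_mul]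
      field_simp; ring
    have hM' : ∀ i x, jet (m + 1) (pd1 i f) x ≤ M := fun i x => (jet_pd1_le _ _ _ _).trans (hM x)
    have hA' : ∀ i, jet m (A i) z ≤ M := fun i =>
      (jet_comp_comb_le (hf.pd1 i) hab m z).trans ((jet_le_succ _ _ _).trans (hM' i _))
    have hB' : ∀ i, jet m (B i) z ≤ M := fun i =>
      (jet_comp_comb_le (hf.pd1 i) hab' m z).trans ((jet_le_succ _ _ _).trans (hM' i _))
    have hAB : ∀ i, jet m ((1 / 4 : ℝ) • (A i + B i)) z ≤ M / 2 := by
      intro i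
      rw [jet_smul ((hA i).add (hB i))]
      have := (jet_add_le (hA i) (hB i) m z).trans (add_le_add (hA' i) (hB' i))
      norm_num
      linarith
    set c : ℝ := (2 * Fintype.card ι + 1) ^ m
    have hc1 : 1 ≤ c := one_le_pow₀ (by have : (0:ℝ) ≤ Fintype.card ι := by positivity
                                        linarith)
    have hDD : ∀ i, jet m ((1 / 2 : ℝ) • diffQuot ε (pd1 i f)) z ≤ c * M / 2 := by
      intro i
      rw [jet_smul (hD i)]
      have := ih (hf.pd1 i) (hM' i)
      norm_num
      linarith
    have hb : |diffQuot ε f z| ≤ M := base hf fun x => (jet_mono (by omega) _ _).trans (hM x)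
    rw [jet_succ, Fintype.sum_sum_type, ← Finset.sum_add_distrib]
    have hMc : M ≤ c * M := le_mul_of_one_le_left hM0 hc1
    -- Each of the two derivatives is at most `c * M / 2 + M / 2 ≤ c * M`. With the term of order
    -- zero, every order contributes a factor `2 * card ι + 1`.
    have hs : ∀ i ∈ Finset.univ, jet m (pd1 (Sum.inl i) (diffQuot ε f)) z +
        jet m (pd1 (Sum.inr i) (diffQuot ε f)) z ≤ 2 * (c * M) := by
      intro i _
      rw [hl, hr]
      have s1 := jet_add_le ((hD i).smul (1 / 2 : ℝ)) (((hA i).add (hB i)).smul (1 / 4 : ℝ)) m z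
      have s2 := jet_sub_le ((hD i).smul (1 / 2 : ℝ)) (((hA i).add (hB i)).smul (1 / 4 : ℝ)) m z
      have := hAB i
      have := hDD i
      linarith
    have hs' := Finset.sum_le_sum hs
    rw [Finset.sum_const, Finset.card_univ, nsmul_eq_mul] at hs'
    rw [pow_succ]
    change _ ≤ c * _ * M
    nlinarith

/-- This crude bound degenerates as `ε` tends to zero, but it involves the two points only. It
serves for almost everywhere convergence at fixed `ε`, where no bound along the segment joining the
points is at hand. -/
theorem jet_diffQuot_le_of_comp {ε : ℝ} (h0 : 0 < ε) (h1 : ε ≤ 1) {f : Eu ι → ℝ} (hf : Smooth f)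
    (m : ℕ) (z : Eu (ι ⊕ ι)) : jet m (diffQuot ε f) z ≤
      (2 * ε)⁻¹ * (jet m f (comb ((1 + ε) / 2) ((1 - ε) / 2) z) +
        jet m f (comb ((1 - ε) / 2) ((1 + ε) / 2) z)) := by
  have hab : |(1 + ε) / 2| + |(1 - ε) / 2| ≤ 1 := by
    rw [abs_of_nonneg (by linarith), abs_of_nonneg (by linarith)]; linarith
  have hab' : |(1 - ε) / 2| + |(1 + ε) / 2| ≤ 1 := by rw [add_comm]; exact hab
  have : 0 < (2 * ε)⁻¹ := by positivity
  rw [diffQuot, jet_smul ((hf.comp_comb _ _).sub (hf.comp_comb _ _)), abs_of_pos this]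
  refine mul_le_mul_of_nonneg_left ?_ this.le
  exact (jet_sub_le (hf.comp_comb _ _) (hf.comp_comb _ _) m z).trans
    (add_le_add (jet_comp_comb_le hf hab m z) (jet_comp_comb_le hf hab' m z))

end

/-! ### Weak derivatives -/

section

theorem integrable_mul_test {O : Opens (Eu κ)} {g : Eu κ → ℝ}
    (hg : LocallyIntegrableOn g (O : Set (Eu κ))) (φ : 𝓓(O, ℝ)) :
    Integrable (fun x => g x * φ x) := by
  have := TestFunction.integrable_bilin (ContinuousLinearMap.mul ℝ ℝ) hg φ
  simpa [mul_comm] using this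

theorem setIntegral_mul_test {O : Opens (Eu κ)} (g : Eu κ → ℝ) (φ : 𝓓(O, ℝ)) :
    ∫ x in O, g x * φ x = ∫ x, g x * φ x := by
  refine setIntegral_eq_integral_of_forall_compl_eq_zero fun x hx => ?_
  rw [image_eq_zero_of_notMem_tsupport fun h => hx (φ.tsupport_subset h), mul_zero]

theorem HasWeakDeriv.integral_eq {O : Opens (Eu κ)} {n : ℕ} {s : Fin n → κ} {f g : Eu κ → ℝ}
    (h : HasWeakDeriv O s f g) (φ : 𝓓(O, ℝ)) :
    ∫ x, f x * pd s φ x = (-1) ^ n * ∫ x, g x * φ x := by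
  have := h.2.2 φ
  rw [setIntegral_mul_test, setIntegral_mul_test, coe_iteratedLineDerivOp] at this
  exact this

theorem hasWeakDeriv_iff {O : Opens (Eu κ)} {n : ℕ} {s : Fin n → κ} {f g : Eu κ → ℝ} :
    HasWeakDeriv O s f g ↔ LocallyIntegrableOn f (O : Set (Eu κ)) ∧
      LocallyIntegrableOn g (O : Set (Eu κ)) ∧
      ∀ φ : 𝓓(O, ℝ), ∫ x, f x * pd s φ x = (-1) ^ n * ∫ x, g x * φ x := by
  refine ⟨fun h => ⟨h.1, h.2.1, h.integral_eq⟩, fun h => ⟨h.1, h.2.1, fun φ => ?_⟩⟩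
  rw [setIntegral_mul_test, setIntegral_mul_test, coe_iteratedLineDerivOp]
  exact h.2.2 φ

theorem ae_eq_of_integral_test_eq {O : Opens (Eu κ)} {g g' : Eu κ → ℝ}
    (hg : LocallyIntegrableOn g (O : Set (Eu κ))) (hg' : LocallyIntegrableOn g' (O : Set (Eu κ)))
    (h : ∀ φ : 𝓓(O, ℝ), ∫ x, g x * φ x = ∫ x, g' x * φ x) :
    g =ᵐ[volume.restrict (O : Set (Eu κ))] g' := by
  have := IsOpen.ae_eq_zero_of_integral_contDiff_smul_eq_zero (μ := volume) O.isOpen (hg.sub hg') ?_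
  · rw [EventuallyEq, ae_restrict_iff' O.isOpen.measurableSet]
    filter_upwards [this] with x hx hxO
    exact sub_eq_zero.1 (hx hxO)
  · intro ψ h1 h2 h3
    have e1 := integrable_mul_test hg (mkTest ψ h1 h2 h3)
    have e2 := integrable_mul_test hg' (mkTest ψ h1 h2 h3)
    have e3 := h (mkTest ψ h1 h2 h3)
    rw [← sub_eq_zero, ← integral_sub e1 e2] at e3
    rw [← e3]
    congr 1
    funext x
    simp; ring

theorem HasWeakDeriv.ae_unique {O : Opens (Eu κ)} {n : ℕ} {s : Fin n → κ} {f g g' : Eu κ → ℝ}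
    (h : HasWeakDeriv O s f g) (h' : HasWeakDeriv O s f g') :
    g =ᵐ[volume.restrict (O : Set (Eu κ))] g' := by
  refine ae_eq_of_integral_test_eq h.2.1 h'.2.1 fun φ => ?_
  have e := (h.integral_eq φ).symm.trans (h'.integral_eq φ)
  exact mul_left_cancel₀ (pow_ne_zero n (by norm_num)) e

theorem hasWeakDeriv_weakDeriv {O : Opens (Eu κ)} {n : ℕ} {s : Fin n → κ} {f : Eu κ → ℝ}
    (h : ∃ g, HasWeakDeriv O s f g) : HasWeakDeriv O s f (weakDeriv O s f) := by
  rw [weakDeriv, dif_pos h]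
  exact h.choose_spec

theorem HasWeakDeriv.weakDeriv_ae {O : Opens (Eu κ)} {n : ℕ} {s : Fin n → κ} {f g : Eu κ → ℝ}
    (h : HasWeakDeriv O s f g) : weakDeriv O s f =ᵐ[volume.restrict (O : Set (Eu κ))] g :=
  (hasWeakDeriv_weakDeriv ⟨g, h⟩).ae_unique h

theorem HasWeakDeriv.weakDeriv_ae_top {n : ℕ} {s : Fin n → κ} {f g : Eu κ → ℝ}
    (h : HasWeakDeriv ⊤ s f g) : weakDeriv ⊤ s f =ᵐ[volume] g := by
  simpa using h.weakDeriv_ae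

theorem locallyIntegrableOn_congr {O : Opens (Eu κ)} {f f' : Eu κ → ℝ}
    (h : f =ᵐ[volume.restrict (O : Set (Eu κ))] f') (hf : LocallyIntegrableOn f (O : Set (Eu κ))) :
    LocallyIntegrableOn f' (O : Set (Eu κ)) := by
  rw [locallyIntegrableOn_iff O.isOpen.isLocallyClosed] at hf ⊢
  exact fun K hK hKc => (hf K hK hKc).congr (ae_restrict_of_ae_restrict_of_subset hK h)

theorem integral_mul_test_congr {O : Opens (Eu κ)} {f f' : Eu κ → ℝ}
    (h : f =ᵐ[volume.restrict (O : Set (Eu κ))] f') (φ : 𝓓(O, ℝ)) :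
    ∫ x, f x * φ x = ∫ x, f' x * φ x := by
  rw [← setIntegral_mul_test, ← setIntegral_mul_test]
  exact integral_congr_ae (h.mono fun x hx => by simp only [hx])

theorem HasWeakDeriv.congr_left {O : Opens (Eu κ)} {n : ℕ} {s : Fin n → κ} {f f' g : Eu κ → ℝ}
    (hf : f =ᵐ[volume.restrict (O : Set (Eu κ))] f') (h : HasWeakDeriv O s f g) :
    HasWeakDeriv O s f' g := by
  rw [hasWeakDeriv_iff] at h ⊢
  refine ⟨locallyIntegrableOn_congr hf h.1, h.2.1, fun φ => ?_⟩
  rw [← h.2.2 φ, ← coe_pdTest]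
  exact integral_mul_test_congr hf.symm _

/-- The equality holds everywhere: functions that agree almost everywhere define the same predicate
`HasWeakDeriv O s f`, and the chosen derivative depends on that predicate alone. -/
theorem weakDeriv_congr {O : Opens (Eu κ)} {n : ℕ} {s : Fin n → κ} {f f' : Eu κ → ℝ}
    (hf : f =ᵐ[volume.restrict (O : Set (Eu κ))] f') : weakDeriv O s f = weakDeriv O s f' := by
  have : HasWeakDeriv O s f = HasWeakDeriv O s f' :=
    funext fun g => propext ⟨HasWeakDeriv.congr_left hf, HasWeakDeriv.congr_left hf.symm⟩
  unfold weakDeriv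
  rw [this]

theorem HasWeakDeriv.add {O : Opens (Eu κ)} {n : ℕ} {s : Fin n → κ} {f f' g g' : Eu κ → ℝ}
    (h : HasWeakDeriv O s f g) (h' : HasWeakDeriv O s f' g') :
    HasWeakDeriv O s (f + f') (g + g') := by
  rw [hasWeakDeriv_iff] at h h' ⊢
  refine ⟨h.1.add h'.1, h.2.1.add h'.2.1, fun φ => ?_⟩
  have a1 := integrable_mul_test h.1 (pdTest s φ)
  have a2 := integrable_mul_test h'.1 (pdTest s φ)
  have a3 := integrable_mul_test h.2.1 φ
  have a4 := integrable_mul_test h'.2.1 φ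
  simp only [Pi.add_apply, add_mul]
  rw [integral_add a3 a4, mul_add, ← h.2.2, ← h'.2.2]
  exact integral_add a1 a2

/-- Integration by parts holds for each `u k` and passes to the limit by dominated convergence, the
bound being taken on the support of the test function. Products and difference quotients of Sobolev
functions get their weak derivatives in this way. -/
theorem hasWeakDeriv_of_tendsto {O : Opens (Eu κ)} {n : ℕ} {s : Fin n → κ}
    {u : ℕ → Eu κ → ℝ} {f g : Eu κ → ℝ} (hu : ∀ k, Smooth (u k))
    (hb : ∀ K ⊆ (O : Set (Eu κ)), IsCompact K →
      ∃ C, ∀ k, ∀ x ∈ K, |u k x| ≤ C ∧ |pd s (u k) x| ≤ C)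
    (hf : ∀ᵐ x ∂volume.restrict (O : Set (Eu κ)), Tendsto (fun k => u k x) atTop (𝓝 (f x)))
    (hg : ∀ᵐ x ∂volume.restrict (O : Set (Eu κ)),
      Tendsto (fun k => pd s (u k) x) atTop (𝓝 (g x))) :
    HasWeakDeriv O s f g := by
  have key : ∀ {w : ℕ → Eu κ → ℝ} {h : Eu κ → ℝ}, (∀ k, Continuous (w k)) →
      (∀ K ⊆ (O : Set (Eu κ)), IsCompact K → ∃ C, ∀ k, ∀ x ∈ K, |w k x| ≤ C) →
      (∀ᵐ x ∂volume.restrict (O : Set (Eu κ)), Tendsto (fun k => w k x) atTop (𝓝 (h x))) →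
      LocallyIntegrableOn h (O : Set (Eu κ)) ∧ ∀ φ : 𝓓(O, ℝ),
        Tendsto (fun k => ∫ x, w k x * φ x) atTop (𝓝 (∫ x, h x * φ x)) := by
    intro w h hw hC hlim
    have hmeas : AEStronglyMeasurable h (volume.restrict (O : Set (Eu κ))) :=
      aestronglyMeasurable_of_tendsto_ae atTop (fun k => (hw k).aestronglyMeasurable) hlim
    constructor
    · rw [locallyIntegrableOn_iff O.isOpen.isLocallyClosed]
      intro K hK hKc
      obtain ⟨C, hC⟩ := hC K hK hKc
      have hfin : IsFiniteMeasure (volume.restrict K) :=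
        ⟨by simpa using hKc.measure_lt_top⟩
      refine Integrable.of_bound (C := C)
        (hmeas.mono_measure (Measure.restrict_mono hK le_rfl)) ?_
      filter_upwards [ae_restrict_of_ae_restrict_of_subset hK hlim,
        ae_restrict_mem hKc.measurableSet] with x hx hxK
      exact le_of_tendsto (hx.abs) (Eventually.of_forall fun k => hC k x hxK)
    · intro φ
      obtain ⟨C, hC⟩ := hC _ φ.tsupport_subset φ.hasCompactSupport
      simp_rw [← setIntegral_mul_test]
      refine tendsto_integral_of_dominated_convergence (fun x => C * |φ x|)
        (fun k => ((hw k).mul φ.continuous).aestronglyMeasurable) ?_ ?_ ?_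
      · exact ((φ.continuous.integrable_of_hasCompactSupport φ.hasCompactSupport).abs.const_mul
          C).integrableOn
      · intro k
        refine Eventually.of_forall fun x => ?_
        rw [Real.norm_eq_abs, abs_mul]
        by_cases hx : x ∈ tsupport φ
        · exact mul_le_mul_of_nonneg_right (hC k x hx) (abs_nonneg _)
        · simp [image_eq_zero_of_notMem_tsupport hx]
      · filter_upwards [hlim] with x hx
        exact hx.mul_const _
  obtain ⟨f1, f2⟩ := key (fun k => (hu k).continuous)
    (fun K hK hKc => (hb K hK hKc).imp fun C h k x hx => (h k x hx).1) hf
  obtain ⟨g1, g2⟩ := key (fun k => ((hu k).pd s).continuous)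
    (fun K hK hKc => (hb K hK hKc).imp fun C h k x hx => (h k x hx).2) hg
  rw [hasWeakDeriv_iff]
  refine ⟨f1, g1, fun φ => ?_⟩
  refine tendsto_nhds_unique (f2 (pdTest s φ)) ?_
  have : ∀ k, ∫ x, u k x * pdTest s φ x = (-1) ^ n * ∫ x, pd s (u k) x * φ x := by
    intro k
    rw [integral_pd_mul (hu k) (smooth_test φ) φ.hasCompactSupport, ← mul_assoc, ← mul_pow]
    simp
  simp_rw [this]
  exact (g2 φ).const_mul _

theorem Smooth.hasWeakDeriv {f : Eu κ → ℝ} (hf : Smooth f) (O : Opens (Eu κ)) {n : ℕ}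
    (s : Fin n → κ) : HasWeakDeriv O s f (RoughDriver.pd s f) := by
  refine hasWeakDeriv_of_tendsto (u := fun _ => f) (fun _ => hf) (fun K _ hK => ?_)
    (Eventually.of_forall fun x => tendsto_const_nhds)
    (Eventually.of_forall fun x => tendsto_const_nhds)
  obtain ⟨C, hC⟩ := hK.exists_bound_of_continuousOn hf.continuous.continuousOn
  obtain ⟨C', hC'⟩ := hK.exists_bound_of_continuousOn (hf.pd s).continuous.continuousOn
  exact ⟨max C C', fun k x hx => ⟨(hC x hx).trans (le_max_left _ _),
    (hC' x hx).trans (le_max_right _ _)⟩⟩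

theorem Smooth.weakDeriv_ae {f : Eu κ → ℝ} (hf : Smooth f) {n : ℕ} (s : Fin n → κ) :
    weakDeriv ⊤ s f =ᵐ[volume] RoughDriver.pd s f := (hf.hasWeakDeriv ⊤ s).weakDeriv_ae_top

/-! ### Sobolev norms -/

theorem sobNorm_congr {O : Opens (Eu κ)} {f f' : Eu κ → ℝ} (m : ℕ) (p : ℝ≥0∞)
    (hf : f =ᵐ[volume.restrict (O : Set (Eu κ))] f') : sobNorm O m p f = sobNorm O m p f' := by
  have : ∀ {n : ℕ} (s : Fin n → κ) (g : Eu κ → ℝ),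
      HasWeakDeriv O s f g ↔ HasWeakDeriv O s f' g := fun s g =>
    ⟨HasWeakDeriv.congr_left hf, HasWeakDeriv.congr_left hf.symm⟩
  have hc : (∀ j ≤ m, ∀ s : Fin j → κ, ∃ g, HasWeakDeriv O s f g) ↔
      ∀ j ≤ m, ∀ s : Fin j → κ, ∃ g, HasWeakDeriv O s f' g :=
    forall₃_congr fun j _ s => exists_congr fun g => this s g
  unfold sobNorm
  simp only [weakDeriv_congr hf]
  by_cases h : ∀ j ≤ m, ∀ s : Fin j → κ, ∃ g, HasWeakDeriv O s f g
  · rw [if_pos h, if_pos (hc.1 h)]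
  · rw [if_neg h, if_neg (mt hc.2 h)]

theorem sobNorm_of_hasWeakDeriv {m : ℕ} {p : ℝ≥0∞} {f : Eu κ → ℝ}
    {g : (j : ℕ) → (Fin j → κ) → Eu κ → ℝ}
    (h : ∀ j ≤ m, ∀ s : Fin j → κ, HasWeakDeriv ⊤ s f (g j s)) :
    sobNorm ⊤ m p f = ∑ j ∈ Finset.range (m + 1), ∑ s : Fin j → κ, eLpNorm (g j s) p volume := by
  rw [sobNorm, if_pos fun j hj s => ⟨_, h j hj s⟩]
  refine Finset.sum_congr rfl fun j hj => Finset.sum_congr rfl fun s _ => ?_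
  rw [Opens.coe_top, Measure.restrict_univ]
  exact eLpNorm_congr_ae (h j (Nat.lt_succ_iff.1 (Finset.mem_range.1 hj)) s).weakDeriv_ae_top

theorem sobNorm_smooth {f : Eu κ → ℝ} (hf : Smooth f) (m : ℕ) (p : ℝ≥0∞) :
    sobNorm ⊤ m p f =
      ∑ j ∈ Finset.range (m + 1), ∑ s : Fin j → κ, eLpNorm (pd s f) p volume :=
  sobNorm_of_hasWeakDeriv (g := fun _ s => pd s f) fun _ _ s => hf.hasWeakDeriv ⊤ s

theorem hasWeakDeriv_of_sobNorm_ne_top {O : Opens (Eu κ)} {m : ℕ} {p : ℝ≥0∞} {f : Eu κ → ℝ}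
    (h : sobNorm O m p f ≠ ⊤) {j : ℕ} (hj : j ≤ m) (s : Fin j → κ) :
    HasWeakDeriv O s f (weakDeriv O s f) := by
  refine hasWeakDeriv_weakDeriv ?_
  by_contra hs
  refine h ?_
  rw [sobNorm, if_neg]
  exact fun h' => hs (h' j hj s)

/-- The term of order zero in `sobNorm` is a chosen weak derivative along the empty tuple, not `f`
itself. The two are identified here. -/
theorem HasWeakDeriv.ae_eq_of_zero {O : Opens (Eu κ)} {s : Fin 0 → κ} {f g : Eu κ → ℝ}
    (h : HasWeakDeriv O s f g) : f =ᵐ[volume.restrict (O : Set (Eu κ))] g := by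
  refine ae_eq_of_integral_test_eq h.1 h.2.1 fun φ => ?_
  simpa using h.integral_eq φ

theorem eLpNorm_weakDeriv_le_sobNorm {m : ℕ} {p : ℝ≥0∞} {f : Eu κ → ℝ} {j : ℕ}
    (hj : j ≤ m) (s : Fin j → κ) : eLpNorm (weakDeriv ⊤ s f) p volume ≤ sobNorm ⊤ m p f := by
  by_cases h : ∀ j ≤ m, ∀ s : Fin j → κ, ∃ g, HasWeakDeriv ⊤ s f g
  · rw [sobNorm, if_pos h, Opens.coe_top, Measure.restrict_univ]
    refine (Finset.single_le_sum
      (f := fun s : Fin j → κ => eLpNorm (weakDeriv ⊤ s f) p volume) (fun _ _ => zero_le)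
      (Finset.mem_univ s)).trans ?_
    exact Finset.single_le_sum
      (f := fun j => ∑ s : Fin j → κ, eLpNorm (weakDeriv ⊤ s f) p volume) (fun _ _ => zero_le)
      (Finset.mem_range.2 (Nat.lt_succ_of_le hj))
  · rw [sobNorm, if_neg h]
    exact le_top

theorem locallyIntegrable_of_sobNorm_ne_top {m : ℕ} {p : ℝ≥0∞} {f : Eu κ → ℝ}
    (h : sobNorm ⊤ m p f ≠ ⊤) : LocallyIntegrable f := by
  have := (hasWeakDeriv_of_sobNorm_ne_top h (Nat.zero_le m) Fin.elim0).1
  rwa [Opens.coe_top, locallyIntegrableOn_univ] at this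

theorem eLpNorm_le_sobNorm {m : ℕ} {p : ℝ≥0∞} {f : Eu κ → ℝ} :
    eLpNorm f p volume ≤ sobNorm ⊤ m p f := by
  by_cases h : sobNorm ⊤ m p f = ⊤
  · rw [h]; exact le_top
  · have h0 := (hasWeakDeriv_of_sobNorm_ne_top h (Nat.zero_le m) Fin.elim0).ae_eq_of_zero
    rw [Opens.coe_top, Measure.restrict_univ] at h0
    rw [eLpNorm_congr_ae h0]
    exact eLpNorm_weakDeriv_le_sobNorm (Nat.zero_le m) _

theorem sobNorm_mono {m n : ℕ} (h : m ≤ n) (p : ℝ≥0∞) (f : Eu κ → ℝ) :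
    sobNorm ⊤ m p f ≤ sobNorm ⊤ n p f := by
  by_cases hn : ∀ j ≤ n, ∀ s : Fin j → κ, ∃ g, HasWeakDeriv ⊤ s f g
  · rw [sobNorm, sobNorm, if_pos hn, if_pos fun j hj => hn j (hj.trans h)]
    exact Finset.sum_le_sum_of_subset (Finset.range_mono (by omega))
  · rw [sobNorm.eq_1 ⊤ n, if_neg hn]
    exact le_top

theorem sobNorm_add_le {m : ℕ} {p : ℝ≥0∞} (hp : 1 ≤ p) (f g : Eu κ → ℝ) :
    sobNorm ⊤ m p (f + g) ≤ sobNorm ⊤ m p f + sobNorm ⊤ m p g := by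
  by_cases hf : sobNorm ⊤ m p f = ⊤
  · simp [hf]
  by_cases hg : sobNorm ⊤ m p g = ⊤
  · simp [hg]
  have hF : ∀ j ≤ m, ∀ s : Fin j → κ, HasWeakDeriv ⊤ s f (weakDeriv ⊤ s f) := fun j hj s =>
    hasWeakDeriv_of_sobNorm_ne_top hf hj s
  have hG : ∀ j ≤ m, ∀ s : Fin j → κ, HasWeakDeriv ⊤ s g (weakDeriv ⊤ s g) := fun j hj s =>
    hasWeakDeriv_of_sobNorm_ne_top hg hj s
  rw [sobNorm_of_hasWeakDeriv (g := fun _ s => weakDeriv ⊤ s f) hF,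
    sobNorm_of_hasWeakDeriv (g := fun _ s => weakDeriv ⊤ s g) hG,
    sobNorm_of_hasWeakDeriv (g := fun _ s => weakDeriv ⊤ s f + weakDeriv ⊤ s g)
      fun j hj s => (hF j hj s).add (hG j hj s), ← Finset.sum_add_distrib]
  refine Finset.sum_le_sum fun j hj => ?_
  rw [← Finset.sum_add_distrib]
  refine Finset.sum_le_sum fun s _ => ?_
  have hj' := Nat.lt_succ_iff.1 (Finset.mem_range.1 hj)
  have m1 := (hF j hj' s).2.1
  have m2 := (hG j hj' s).2.1
  rw [Opens.coe_top, locallyIntegrableOn_univ] at m1 m2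
  exact eLpNorm_add_le m1.aestronglyMeasurable m2.aestronglyMeasurable hp

theorem sobNorm_zero (m : ℕ) (p : ℝ≥0∞) : sobNorm ⊤ m p (0 : Eu κ → ℝ) = 0 := by
  rw [sobNorm_smooth (f := 0) contDiff_const]
  have : ∀ {j : ℕ} (s : Fin j → κ), pd s (0 : Eu κ → ℝ) = 0 := by
    intro j s
    induction j with
    | zero => rfl
    | succ j ih => rw [pd_succ, ih, pd1_zero]
  simp [this]

theorem sobNorm_test_ne_top (φ : 𝓓((⊤ : Opens (Eu κ)), ℝ)) (m : ℕ) (p : ℝ≥0∞) :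
    sobNorm ⊤ m p (φ : Eu κ → ℝ) ≠ ⊤ := by
  rw [sobNorm_smooth (smooth_test φ)]
  refine (ENNReal.sum_lt_top.2 fun j _ => ENNReal.sum_lt_top.2 fun s _ => ?_).ne
  exact (((smooth_test φ).pd s).continuous.memLp_of_hasCompactSupport
    (HasCompactSupport.pd φ.hasCompactSupport s)).2

end

/-! ### Regular sequences of smooth functions -/

section

theorem continuous_jet {f : Eu κ → ℝ} (hf : Smooth f) (m : ℕ) : Continuous (jet m f) := by
  induction m generalizing f with
  | zero => exact hf.continuous.abs
  | succ m ih => exact hf.continuous.abs.add (continuous_finsetSum _ fun i _ => ih (hf.pd1 i))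

theorem jet_eq_zero_of_notMem {f : Eu κ → ℝ} (m : ℕ) {x : Eu κ} (hx : x ∉ tsupport f) :
    jet m f x = 0 := by
  induction m generalizing f with
  | zero => simp [jet, image_eq_zero_of_notMem_tsupport hx]
  | succ m ih =>
    rw [jet_succ, image_eq_zero_of_notMem_tsupport hx,
      Finset.sum_eq_zero fun i _ => ih fun h => hx (tsupport_pd1_subset i f h)]
    simp

theorem exists_jet_le {f : Eu κ → ℝ} (hf : Smooth f) (hc : HasCompactSupport f) (m : ℕ) :
    ∃ C, 0 ≤ C ∧ ∀ x, jet m f x ≤ C := by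
  obtain ⟨C, hC⟩ := IsCompact.exists_bound_of_continuousOn hc (continuous_jet hf m).continuousOn
  refine ⟨max C 0, le_max_right _ _, fun x => ?_⟩
  by_cases hx : x ∈ tsupport f
  · exact (le_abs_self _).trans ((hC x hx).trans (le_max_left _ _))
  · rw [jet_eq_zero_of_notMem m hx]; exact le_max_right _ _

theorem sum_fin_succ_fun {n : ℕ} {A : Type*} [AddCommMonoid A] (F : (Fin (n + 1) → κ) → A) :
    ∑ s, F s = ∑ i, ∑ t : Fin n → κ, F (Fin.cons i t) := by
  rw [← Fintype.sum_prod_type']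
  exact (Fintype.sum_equiv (Fin.consEquiv fun _ => κ) _ _ fun p => rfl).symm

theorem jet_eq_sum {f : Eu κ → ℝ} (hf : Smooth f) (m : ℕ) (x : Eu κ) :
    jet m f x = ∑ j ∈ Finset.range (m + 1), ∑ s : Fin j → κ, |pd s f x| := by
  induction m generalizing f with
  | zero => simp [jet]
  | succ m ih =>
    rw [jet_succ, Finset.sum_range_succ', add_comm |f x|]
    congr 1
    · simp_rw [ih (hf.pd1 _)]
      rw [Finset.sum_comm]
      refine Finset.sum_congr rfl fun j _ => ?_
      rw [sum_fin_succ_fun]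
      refine Finset.sum_congr rfl fun i _ => Finset.sum_congr rfl fun t _ => ?_
      rw [pd_succ, Fin.cons_zero, Fin.tail_cons, pd1_pd hf]
    · simp

/-- `u` is a sequence of smooth functions whose derivatives of order at most `m` converge almost
everywhere and are bounded by `M` on `S`. -/
structure Reg (S : Set (Eu κ)) (m : ℕ) (M : ℝ) (u : ℕ → Eu κ → ℝ) : Prop where
  smooth : ∀ n, Smooth (u n)
  bound : ∀ n, ∀ x ∈ S, jet m (u n) x ≤ M
  cauchy : ∀ᵐ x, Tendsto (fun p : ℕ × ℕ => jet m (u p.1 - u p.2) x) atTop (𝓝 0)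

/-- `u n` converges to `a` almost everywhere. -/
def LimAE (u : ℕ → Eu κ → ℝ) (a : Eu κ → ℝ) : Prop :=
  ∀ᵐ x, Tendsto (fun n => u n x) atTop (𝓝 (a x))

variable {S S' : Set (Eu κ)} {m m' : ℕ} {M M' : ℝ} {u v : ℕ → Eu κ → ℝ} {a b : Eu κ → ℝ}

theorem Reg.of_le (h : Reg S m M u) (hm : m' ≤ m) (hM : M ≤ M') (hS : S' ⊆ S) : Reg S' m' M' u where
  smooth := h.smooth
  bound n _ hx := (jet_mono hm _ _).trans ((h.bound n _ (hS hx)).trans hM)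
  cauchy := h.cauchy.mono fun _ hx => squeeze_zero (fun _ => jet_nonneg _ _ _)
    (fun _ => jet_mono hm _ _) hx

theorem Reg.nonneg_bound (h : Reg S m M u) {x : Eu κ} (hx : x ∈ S) : 0 ≤ M :=
  (jet_nonneg _ _ _).trans (h.bound 0 x hx)

theorem Reg.add (hu : Reg S m M u) (hv : Reg S m M' v) :
    Reg S m (M + M') (fun n => u n + v n) where
  smooth n := (hu.smooth n).add (hv.smooth n)
  bound n _ hx := (jet_add_le (hu.smooth n) (hv.smooth n) m _).trans
    (add_le_add (hu.bound n _ hx) (hv.bound n _ hx))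
  cauchy := by
    filter_upwards [hu.cauchy, hv.cauchy] with x h1 h2
    refine squeeze_zero (fun _ => jet_nonneg _ _ _) (fun p => ?_) (by simpa using h1.add h2)
    rw [show u p.1 + v p.1 - (u p.2 + v p.2) = (u p.1 - u p.2) + (v p.1 - v p.2) by abel]
    exact jet_add_le ((hu.smooth _).sub (hu.smooth _)) ((hv.smooth _).sub (hv.smooth _)) m x

theorem Reg.smul (hu : Reg S m M u) (c : ℝ) : Reg S m (|c| * M) (fun n => c • u n) where
  smooth n := (hu.smooth n).smul c
  bound n x hx := by
    rw [jet_smul (hu.smooth n)]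
    exact mul_le_mul_of_nonneg_left (hu.bound n x hx) (abs_nonneg c)
  cauchy := by
    filter_upwards [hu.cauchy] with x h1
    simp_rw [← smul_sub]
    have : ∀ p : ℕ × ℕ, jet m (c • (u p.1 - u p.2)) x = |c| * jet m (u p.1 - u p.2) x := fun p =>
      jet_smul ((hu.smooth _).sub (hu.smooth _)) c m x
    simp_rw [this]
    simpa using h1.const_mul |c|

theorem Reg.neg (hu : Reg S m M u) : Reg S m M (fun n => -u n) := by
  simpa using hu.smul (-1)

theorem Reg.sub (hu : Reg S m M u) (hv : Reg S m M' v) :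
    Reg S m (M + M') (fun n => u n - v n) := by
  simpa [sub_eq_add_neg] using hu.add hv.neg

theorem Reg.fixed {f : Eu κ → ℝ} (hf : Smooth f) (h : ∀ x ∈ S, jet m f x ≤ M) :
    Reg S m M (fun _ => f) where
  smooth _ := hf
  bound _ := h
  cauchy := by simp

theorem Reg.zero (S : Set (Eu κ)) (m : ℕ) {M : ℝ} (hM : 0 ≤ M) :
    Reg S m M (fun _ => (0 : Eu κ → ℝ)) := Reg.fixed contDiff_const (by simp [hM])

theorem Reg.sum {α : Type*} {t : Finset α} {M : α → ℝ} {u : α → ℕ → Eu κ → ℝ}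
    (h : ∀ c ∈ t, Reg S m (M c) (u c)) : Reg S m (∑ c ∈ t, M c) (fun n => ∑ c ∈ t, u c n) := by
  classical
  induction t using Finset.induction_on with
  | empty => simpa using Reg.zero S m le_rfl
  | insert c t hc ih =>
    simp_rw [Finset.sum_insert hc]
    exact (h c (Finset.mem_insert_self c t)).add (ih fun d hd => h d (Finset.mem_insert_of_mem hd))

/-- Off `S` a regular sequence has no uniform bound, yet convergence of products is claimed almost
everywhere. The Cauchy property provides an eventual bound at almost every point. -/
theorem Reg.bounded_at (hu : Reg S m M u) : ∀ᵐ x, ∃ C, ∀ᶠ n in atTop, jet m (u n) x ≤ C := by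
  filter_upwards [hu.cauchy] with x hx
  have h1 : ∀ᶠ p : ℕ × ℕ in atTop, jet m (u p.1 - u p.2) x < 1 :=
    hx.eventually_lt_const one_pos
  obtain ⟨⟨N, N'⟩, hN⟩ := eventually_atTop.1 h1
  refine ⟨1 + jet m (u N') x, eventually_atTop.2 ⟨N, fun n hn => ?_⟩⟩
  have h2 := hN (n, N') ⟨hn, le_rfl⟩
  calc jet m (u n) x = jet m ((u n - u N') + u N') x := by rw [sub_add_cancel]
    _ ≤ _ := jet_add_le ((hu.smooth _).sub (hu.smooth _)) (hu.smooth _) m x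
    _ ≤ _ := by linarith

theorem Reg.mul (hu : Reg S m M u) (hv : Reg S m M' v) :
    Reg S m (2 ^ m * (M * M')) (fun n => u n * v n) where
  smooth n := (hu.smooth n).mul (hv.smooth n)
  bound n x hx := (jet_mul_le (hu.smooth n) (hv.smooth n) m x).trans (by
    have := mul_le_mul (hu.bound n x hx) (hv.bound n x hx) (jet_nonneg _ _ _) (hu.nonneg_bound hx)
    gcongr)
  cauchy := by
    filter_upwards [hu.cauchy, hv.cauchy, hu.bounded_at, hv.bounded_at] with x h1 h2 h3 h4
    obtain ⟨C, hC⟩ := h3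
    obtain ⟨C', hC'⟩ := h4
    have l := ((h1.mul_const C').add (h2.const_mul C)).const_mul (2 ^ m)
    simp only [zero_mul, mul_zero, add_zero] at l
    refine squeeze_zero' (Eventually.of_forall fun _ => jet_nonneg _ _ _) ?_ l
    rw [← prod_atTop_atTop_eq] at *
    filter_upwards [tendsto_fst.eventually hC', tendsto_snd.eventually hC] with p hp hq
    rw [show u p.1 * v p.1 - u p.2 * v p.2 = (u p.1 - u p.2) * v p.1 + u p.2 * (v p.1 - v p.2) by
      ring]
    have hd := (hu.smooth p.1).sub (hu.smooth p.2)
    have hd' := (hv.smooth p.1).sub (hv.smooth p.2)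
    refine (jet_add_le (hd.mul (hv.smooth _)) ((hu.smooth _).mul hd') m x).trans ?_
    have e1 := jet_mul_le hd (hv.smooth p.1) m x
    have e2 := jet_mul_le (hu.smooth p.2) hd' m x
    have e3 := mul_le_mul_of_nonneg_left hp (jet_nonneg m (u p.1 - u p.2) x)
    have e4 := mul_le_mul_of_nonneg_right hq (jet_nonneg m (v p.1 - v p.2) x)
    have e5 : (0 : ℝ) < 2 ^ m := by positivity
    rw [mul_add]
    exact add_le_add (e1.trans (mul_le_mul_of_nonneg_left e3 e5.le))
      (e2.trans (mul_le_mul_of_nonneg_left e4 e5.le))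

theorem Reg.pd1 (hu : Reg S (m + 1) M u) (i : κ) : Reg S m M (fun n => pd1 i (u n)) where
  smooth n := (hu.smooth n).pd1 i
  bound n x hx := (jet_pd1_le _ _ _ _).trans (hu.bound n x hx)
  cauchy := by
    filter_upwards [hu.cauchy] with x hx
    refine squeeze_zero (fun _ => jet_nonneg _ _ _) (fun p => ?_) hx
    rw [← pd1_sub (hu.smooth _) (hu.smooth _)]
    exact jet_pd1_le _ _ _ _

/-- The preimage of a null set under a linear surjection is null. The available criterion is for
measurable sets, hence the measurable null superset. -/
theorem ae_comp_linear {E F : Type*} [NormedAddCommGroup E] [InnerProductSpace ℝ E]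
    [FiniteDimensional ℝ E] [MeasurableSpace E] [BorelSpace E] [NormedAddCommGroup F]
    [InnerProductSpace ℝ F] [FiniteDimensional ℝ F] [MeasurableSpace F] [BorelSpace F]
    (L : E →ₗ[ℝ] F) (hL : Function.Surjective L) {p : F → Prop}
    (hp : ∀ᵐ y, p y) : ∀ᵐ x, p (L x) := by
  obtain ⟨t, ht, htm, ht0⟩ := exists_measurable_superset_of_null (ae_iff.1 hp)
  have h := (ae_comp_linearMap_mem_iff (μ := (volume : Measure E)) (ν := (volume : Measure F)) L hL
    htm.compl).2 (by rw [ae_iff]; simpa using ht0)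
  filter_upwards [h] with x hx
  by_contra hpx
  exact hx (ht hpx)

theorem ae_comp_comb {c d : ℝ} (h : c ≠ 0 ∨ d ≠ 0) {p : Eu ι → Prop} (hp : ∀ᵐ x, p x) :
    ∀ᵐ z : Eu (ι ⊕ ι), p (comb c d z) := by
  have := ae_comp_linear (comb c d).toLinearMap (comb_surjective h) hp
  exact this

theorem ae_comp_xPart {p : Eu ι → Prop} (hp : ∀ᵐ x, p x) : ∀ᵐ z : Eu (ι ⊕ ι), p (xPart z) := by
  simpa using ae_comp_comb (c := 1) (d := 0) (by simp) hp

theorem ae_comp_yPart {p : Eu ι → Prop} (hp : ∀ᵐ x, p x) : ∀ᵐ z : Eu (ι ⊕ ι), p (yPart z) := by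
  simpa using ae_comp_comb (c := 0) (d := 1) (by simp) hp

theorem Reg.comb {u : ℕ → Eu ι → ℝ} (hu : Reg Set.univ m M u) {c d : ℝ} (h : c ≠ 0 ∨ d ≠ 0)
    (hcd : |c| + |d| ≤ 1) : Reg Set.univ m M (fun n z => u n (comb c d z)) where
  smooth n := (hu.smooth n).comp_comb c d
  bound n z _ := (jet_comp_comb_le (hu.smooth n) hcd m z).trans (hu.bound n _ trivial)
  cauchy := by
    filter_upwards [ae_comp_comb h hu.cauchy] with z hz
    refine squeeze_zero (fun _ => jet_nonneg _ _ _) (fun p => ?_) hz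
    exact jet_comp_comb_le ((hu.smooth _).sub (hu.smooth _)) hcd m z

/-- One order of regularity buys uniformity in `ε`. The coefficients `X` can pay for it, since
`Op1.Approx` grants them one order more than `Y`. -/
theorem Reg.diffQuot {u : ℕ → Eu ι → ℝ} (hu : Reg Set.univ (m + 1) M u) {ε : ℝ} (h0 : 0 < ε)
    (h1 : ε ≤ 1) : Reg (strip ι) m ((2 * Fintype.card ι + 1) ^ m * M)
      (fun n => diffQuot ε (u n)) where
  smooth n := (hu.smooth n).diffQuot ε
  bound n z hz := jet_diffQuot_le h0 h1 (hu.smooth n) m (fun x => hu.bound n x trivial) hz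
  cauchy := by
    have hu' := hu.of_le (Nat.le_succ m) le_rfl subset_rfl
    filter_upwards [ae_comp_comb (c := (1 + ε) / 2) (d := (1 - ε) / 2) (Or.inl (by linarith))
      hu'.cauchy, ae_comp_comb (c := (1 - ε) / 2) (d := (1 + ε) / 2) (Or.inr (by linarith))
      hu'.cauchy] with z hz hz'
    have l := (hz.add hz').const_mul (2 * ε)⁻¹
    simp only [mul_zero, add_zero] at l
    refine squeeze_zero (fun _ => jet_nonneg _ _ _) (fun p => ?_) l
    have e : RoughDriver.diffQuot ε (u p.1) - RoughDriver.diffQuot ε (u p.2) =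
        RoughDriver.diffQuot ε (u p.1 - u p.2) := by
      funext z; simp [RoughDriver.diffQuot]; ring
    rw [e]
    exact jet_diffQuot_le_of_comp h0 h1 ((hu.smooth _).sub (hu.smooth _)) m z

/-- The pointwise limit of the derivatives `∂_s u_n`. -/
def limD {n : ℕ} (s : Fin n → κ) (u : ℕ → Eu κ → ℝ) : Eu κ → ℝ := fun x =>
  limUnder atTop fun k => pd s (u k) x

theorem Reg.tendsto_limD (hu : Reg S m M u) {j : ℕ} (hj : j ≤ m) (s : Fin j → κ) :
    LimAE (fun n => pd s (u n)) (limD s u) := by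
  filter_upwards [hu.cauchy] with x hx
  refine CauchySeq.tendsto_limUnder ?_
  rw [cauchySeq_iff_tendsto_dist_atTop_0]
  refine squeeze_zero (fun _ => dist_nonneg) (fun p => ?_) hx
  rw [Real.dist_eq]
  have := abs_pd_le_jet ((hu.smooth p.1).sub (hu.smooth p.2)) s x
  rw [pd_sub (hu.smooth _) (hu.smooth _)] at this
  exact this.trans (jet_mono hj _ _)

theorem LimAE.congr (h : LimAE u a) (hab : a =ᵐ[volume] b) : LimAE u b := by
  filter_upwards [h, hab] with x h1 h2
  rwa [← h2]

theorem LimAE.add (h : LimAE u a) (h' : LimAE v b) : LimAE (fun n => u n + v n) (a + b) := by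
  filter_upwards [h, h'] with x h1 h2 using h1.add h2

theorem LimAE.sub (h : LimAE u a) (h' : LimAE v b) : LimAE (fun n => u n - v n) (a - b) := by
  filter_upwards [h, h'] with x h1 h2 using h1.sub h2

theorem LimAE.mul (h : LimAE u a) (h' : LimAE v b) : LimAE (fun n => u n * v n) (a * b) := by
  filter_upwards [h, h'] with x h1 h2 using h1.mul h2

theorem LimAE.smul (h : LimAE u a) (c : ℝ) : LimAE (fun n => c • u n) (c • a) := by
  filter_upwards [h] with x h1 using h1.const_smul c

theorem LimAE.neg (h : LimAE u a) : LimAE (fun n => -u n) (-a) := by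
  filter_upwards [h] with x h1 using h1.neg

theorem LimAE.sum {α : Type*} {t : Finset α} {u : α → ℕ → Eu κ → ℝ} {a : α → Eu κ → ℝ}
    (h : ∀ c ∈ t, LimAE (u c) (a c)) : LimAE (fun n => ∑ c ∈ t, u c n) (∑ c ∈ t, a c) := by
  have : ∀ᵐ x, ∀ c ∈ t, Tendsto (fun n => u c n x) atTop (𝓝 (a c x)) :=
    (Finset.eventually_all t).2 h
  filter_upwards [this] with x hx
  simp only [Finset.sum_apply]
  exact tendsto_finsetSum t hx

theorem LimAE.fixed (a : Eu κ → ℝ) : LimAE (fun _ => a) a :=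
  Eventually.of_forall fun _ => tendsto_const_nhds

theorem LimAE.xPart {u : ℕ → Eu ι → ℝ} {a : Eu ι → ℝ} (h : LimAE u a) :
    LimAE (fun n z => u n (RoughDriver.xPart z)) (fun z => a (RoughDriver.xPart z)) :=
  ae_comp_xPart h

theorem LimAE.yPart {u : ℕ → Eu ι → ℝ} {a : Eu ι → ℝ} (h : LimAE u a) :
    LimAE (fun n z => u n (RoughDriver.yPart z)) (fun z => a (RoughDriver.yPart z)) :=
  ae_comp_yPart h

theorem Reg.xPart {u : ℕ → Eu ι → ℝ} (hu : Reg Set.univ m M u) :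
    Reg Set.univ m M (fun n (z : Eu (ι ⊕ ι)) => u n (RoughDriver.xPart z)) := by
  simpa using hu.comb (c := 1) (d := 0) (by simp) (by simp)

theorem Reg.yPart {u : ℕ → Eu ι → ℝ} (hu : Reg Set.univ m M u) :
    Reg Set.univ m M (fun n (z : Eu (ι ⊕ ι)) => u n (RoughDriver.yPart z)) := by
  simpa using hu.comb (c := 0) (d := 1) (by simp) (by simp)

theorem Reg.hasWeakDeriv {O : Opens (Eu κ)} (hu : Reg S m M u) (hO : (O : Set (Eu κ)) ⊆ S)
    {j : ℕ} (hj : j ≤ m) (s : Fin j → κ)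
    (ha : ∀ᵐ x ∂volume.restrict (O : Set (Eu κ)), Tendsto (fun n => u n x) atTop (𝓝 (a x))) :
    HasWeakDeriv O s a (limD s u) := by
  refine hasWeakDeriv_of_tendsto hu.smooth (fun K hK _ => ⟨M, fun k x hx => ⟨?_, ?_⟩⟩) ha
    (ae_restrict_of_ae (hu.tendsto_limD hj s))
  · exact (abs_le_jet m _ _).trans (hu.bound k x (hO (hK hx)))
  · exact (abs_pd_le_jet (hu.smooth k) s x).trans ((jet_mono hj _ _).trans
      (hu.bound k x (hO (hK hx))))

theorem Reg.hasWeakDeriv_top (hu : Reg Set.univ m M u) {j : ℕ} (hj : j ≤ m) (s : Fin j → κ)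
    (ha : LimAE u a) : HasWeakDeriv ⊤ s a (limD s u) :=
  hu.hasWeakDeriv (Set.subset_univ _) hj s (ae_restrict_of_ae ha)

theorem Reg.limAE_weakDeriv (hu : Reg Set.univ m M u) {j : ℕ} (hj : j ≤ m) (s : Fin j → κ)
    (ha : LimAE u a) : LimAE (fun n => pd s (u n)) (weakDeriv ⊤ s a) :=
  (hu.tendsto_limD hj s).congr (hu.hasWeakDeriv_top hj s ha).weakDeriv_ae_top.symm

theorem Reg.limAE_weakDeriv_one (hu : Reg Set.univ (m + 1) M u) (i : κ) (ha : LimAE u a) :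
    LimAE (fun n => RoughDriver.pd1 i (u n)) (weakDeriv ⊤ ![i] a) :=
  hu.limAE_weakDeriv (j := 1) (by omega) ![i] ha

theorem Reg.abs_limD_le (hu : Reg S m M u) {j : ℕ} (hj : j ≤ m) (s : Fin j → κ) :
    ∀ᵐ x, x ∈ S → |limD s u x| ≤ M := by
  filter_upwards [hu.tendsto_limD hj s] with x hx hxS
  refine le_of_tendsto hx.abs (Eventually.of_forall fun k => ?_)
  exact (abs_pd_le_jet (hu.smooth k) s x).trans ((jet_mono hj _ _).trans (hu.bound k x hxS))

theorem LimAE.aestronglyMeasurable (h : LimAE u a) (hu : ∀ n, Smooth (u n)) :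
    AEStronglyMeasurable a :=
  aestronglyMeasurable_of_tendsto_ae atTop (fun k => (hu k).continuous.aestronglyMeasurable) h

theorem Reg.sobNorm_lt_top (hu : Reg Set.univ m M u) (ha : LimAE u a) : sobNorm ⊤ m ⊤ a < ⊤ := by
  rw [sobNorm_of_hasWeakDeriv (g := fun _ s => limD s u) fun j hj s =>
    hu.hasWeakDeriv_top hj s ha]
  refine ENNReal.sum_lt_top.2 fun j hj => ENNReal.sum_lt_top.2 fun s _ => ?_
  have hj' := Nat.lt_succ_iff.1 (Finset.mem_range.1 hj)
  refine (memLp_top_of_bound ((hu.tendsto_limD hj' s).aestronglyMeasurable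
    fun n => (hu.smooth n).pd s) M ?_).2
  filter_upwards [hu.abs_limD_le hj' s] with x hx using hx trivial

end

/-! ### Mollification -/

section

open scoped Convolution

theorem pd1_comp_const_sub {f : Eu κ → ℝ} (hf : Smooth f) (x : Eu κ) (i : κ) :
    pd1 i (fun y => f (x - y)) = -fun y => pd1 i f (x - y) := by
  funext y
  have h : HasFDerivAt (fun y => f (x - y)) ((fderiv ℝ f (x - y)).comp
      (-ContinuousLinearMap.id ℝ (Eu κ))) y :=
    HasFDerivAt.comp y (hf.differentiableAt (x - y)).hasFDerivAt
      ((hasFDerivAt_id y).const_sub x)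
  unfold pd1
  rw [h.fderiv]
  simp

theorem Smooth.comp_const_sub {f : Eu κ → ℝ} (hf : Smooth f) (x : Eu κ) :
    Smooth (fun y => f (x - y)) := ContDiff.comp (g := f) hf (contDiff_const.sub contDiff_id)

theorem pd_comp_const_sub {f : Eu κ → ℝ} (hf : Smooth f) (x : Eu κ) {n : ℕ} (s : Fin n → κ) :
    pd s (fun y => f (x - y)) = (-1 : ℝ) ^ n • fun y => pd s f (x - y) := by
  induction n with
  | zero => simp
  | succ n ih =>
    rw [pd_succ, ih, pd1_smul ((hf.pd _).comp_const_sub x), pd1_comp_const_sub (hf.pd _), pow_succ]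
    funext y
    simp [pd_succ]

theorem convolution_apply_eq (ρ a : Eu κ → ℝ) (x : Eu κ) :
    (ρ ⋆[ContinuousLinearMap.lsmul ℝ ℝ, volume] a) x = ∫ y, ρ (x - y) * a y := by
  rw [convolution_eq_swap]; rfl

theorem smooth_convolution {ρ a : Eu κ → ℝ} (hρ : Smooth ρ) (hc : HasCompactSupport ρ)
    (ha : LocallyIntegrable a) : Smooth (ρ ⋆[ContinuousLinearMap.lsmul ℝ ℝ, volume] a) :=
  hc.contDiff_convolution_left _ hρ ha

theorem pd1_convolution {ρ a : Eu κ → ℝ} (hρ : Smooth ρ) (hc : HasCompactSupport ρ)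
    (ha : LocallyIntegrable a) (i : κ) :
    pd1 i (ρ ⋆[ContinuousLinearMap.lsmul ℝ ℝ, volume] a) =
      pd1 i ρ ⋆[ContinuousLinearMap.lsmul ℝ ℝ, volume] a := by
  funext x
  have h := hc.hasFDerivAt_convolution_left (ContinuousLinearMap.lsmul ℝ ℝ) (μ := volume)
    (hρ.of_le (by simp)) ha x
  have hex := (hc.fderiv ℝ).convolutionExists_left
    ((ContinuousLinearMap.lsmul ℝ ℝ).precompL (Eu κ)) (μ := volume)
    (hρ.continuous_fderiv (by simp)) ha x
  unfold pd1
  rw [h.fderiv, convolution_def, convolution_def, ContinuousLinearMap.integral_apply hex]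
  rfl

theorem pd_convolution {ρ a : Eu κ → ℝ} (hρ : Smooth ρ) (hc : HasCompactSupport ρ)
    (ha : LocallyIntegrable a) {n : ℕ} (s : Fin n → κ) :
    pd s (ρ ⋆[ContinuousLinearMap.lsmul ℝ ℝ, volume] a) =
      pd s ρ ⋆[ContinuousLinearMap.lsmul ℝ ℝ, volume] a := by
  induction n with
  | zero => rfl
  | succ n ih =>
    rw [pd_succ, ih, pd1_convolution (hρ.pd _) (HasCompactSupport.pd hc _) ha, ← pd_succ]

/-- The function `y ↦ ρ (x - y)` is a test function, and the definition of the weak derivative moves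
`∂_s` from it to `a`. The sign from the reflection cancels the one from integration by parts. -/
theorem pd_convolution_of_hasWeakDeriv {ρ a g : Eu κ → ℝ} (hρ : Smooth ρ)
    (hc : HasCompactSupport ρ) {n : ℕ} {s : Fin n → κ} (h : HasWeakDeriv ⊤ s a g) :
    pd s (ρ ⋆[ContinuousLinearMap.lsmul ℝ ℝ, volume] a) =
      ρ ⋆[ContinuousLinearMap.lsmul ℝ ℝ, volume] g := by
  have ha := h.1
  rw [Opens.coe_top, locallyIntegrableOn_univ] at ha
  rw [pd_convolution hρ hc ha]
  funext x
  rw [convolution_apply_eq, convolution_apply_eq]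
  have hcx : HasCompactSupport fun y => ρ (x - y) :=
    hc.comp_homeomorph (Homeomorph.subLeft x)
  have e := h.integral_eq (mkTest (fun y => ρ (x - y)) (hρ.comp_const_sub x) hcx
    (Set.subset_univ _))
  simp only [coe_mkTest, pd_comp_const_sub hρ, Pi.smul_apply, smul_eq_mul] at e
  have e1 : ∀ y, a y * ((-1) ^ n * pd s ρ (x - y)) = (-1) ^ n * (pd s ρ (x - y) * a y) := fun y => by
    ring
  simp_rw [e1] at e
  rw [integral_const_mul] at e
  have e2 := mul_left_cancel₀ (pow_ne_zero n (by norm_num : (-1 : ℝ) ≠ 0)) e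
  rw [e2]
  simp_rw [mul_comm]

/-- A function in `W^{m,∞}` is the limit of a regular sequence with the same bound. -/
theorem exists_reg {a : Eu κ → ℝ} {m : ℕ} {M : ℝ} (hM : 0 ≤ M)
    (h : sobNorm ⊤ m ⊤ a ≤ ENNReal.ofReal M) :
    ∃ u, Reg Set.univ m M u ∧ LimAE u a := by
  have hne : sobNorm ⊤ m ⊤ a ≠ ⊤ := (h.trans_lt ENNReal.ofReal_lt_top).ne
  have hW : ∀ j ≤ m, ∀ s : Fin j → κ, HasWeakDeriv ⊤ s a (weakDeriv ⊤ s a) := fun j hj s =>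
    hasWeakDeriv_of_sobNorm_ne_top hne hj s
  have hL : ∀ j ≤ m, ∀ s : Fin j → κ, LocallyIntegrable (weakDeriv ⊤ s a) := by
    intro j hj s
    have := (hW j hj s).2.1
    rwa [Opens.coe_top, locallyIntegrableOn_univ] at this
  have ha := locallyIntegrable_of_sobNorm_ne_top hne
  -- The outer radius is twice the inner one. A bounded ratio of the radii is what convergence at
  -- almost every point (Lebesgue differentiation) requires.
  let φ : ℕ → ContDiffBump (0 : Eu κ) := fun k =>
    ⟨1 / ((k : ℝ) + 1), 2 / ((k : ℝ) + 1), by positivity, by gcongr; norm_num⟩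
  have hφ0 : Tendsto (fun k => (φ k).rOut) atTop (𝓝 0) := by
    have := (tendsto_one_div_add_atTop_nhds_zero_nat (𝕜 := ℝ)).const_mul 2
    simpa [φ, div_eq_mul_inv] using this
  have hφK : ∀ᶠ k in atTop, (φ k).rOut ≤ 2 * (φ k).rIn :=
    Eventually.of_forall fun k => by simp [φ, div_eq_mul_inv]
  let ρ : ℕ → Eu κ → ℝ := fun k => (φ k).normed volume
  have hρs : ∀ k, Smooth (ρ k) := fun k => (φ k).contDiff_normed
  have hρc : ∀ k, HasCompactSupport (ρ k) := fun k => (φ k).hasCompactSupport_normed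
  let u : ℕ → Eu κ → ℝ := fun k => ρ k ⋆[ContinuousLinearMap.lsmul ℝ ℝ, volume] a
  have hus : ∀ k, Smooth (u k) := fun k => smooth_convolution (hρs k) (hρc k) ha
  have hpd : ∀ k, ∀ j ≤ m, ∀ s : Fin j → κ, pd s (u k) =
      ρ k ⋆[ContinuousLinearMap.lsmul ℝ ℝ, volume] weakDeriv ⊤ s a := fun k j hj s =>
    pd_convolution_of_hasWeakDeriv (hρs k) (hρc k) (hW j hj s)
  have hlim : ∀ {g : Eu κ → ℝ}, LocallyIntegrable g →
      LimAE (fun k => ρ k ⋆[ContinuousLinearMap.lsmul ℝ ℝ, volume] g) g := fun hg =>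
    ContDiffBump.ae_convolution_tendsto_right_of_locallyIntegrable hφ0 hφK hg
  -- Averaging against a probability density does not increase an essential bound.
  have hbd : ∀ k, ∀ {g : Eu κ → ℝ} {C : ℝ}, (∀ᵐ x, |g x| ≤ C) →
      ∀ x, |(ρ k ⋆[ContinuousLinearMap.lsmul ℝ ℝ, volume] g) x| ≤ C := by
    intro k g C hC x
    rw [convolution_apply_eq]
    have hint : Integrable (fun y => ρ k (x - y) * C) :=
      (((φ k).integrable_normed (μ := volume)).comp_sub_left x).mul_const C
    have := norm_integral_le_of_norm_le hint (f := fun y => ρ k (x - y) * g y) (by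
      filter_upwards [hC] with y hy
      rw [norm_mul, Real.norm_of_nonneg ((φ k).nonneg_normed _)]
      exact mul_le_mul_of_nonneg_left hy ((φ k).nonneg_normed _))
    rw [integral_mul_const, integral_sub_left_eq_self (fun y => ρ k y) volume x,
      (φ k).integral_normed, one_mul] at this
    exact this
  refine ⟨u, ⟨hus, fun k x _ => ?_, ?_⟩, hlim ha⟩
  -- Each derivative of `u k` is at most the essential supremum of the corresponding weak
  -- derivative. Summed over all tuples these suprema make up the `W^{m,∞}`-norm of `a`, so the
  -- bound `M` is not enlarged.
  · rw [jet_eq_sum (hus k)]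
    have hb : ∀ j ∈ Finset.range (m + 1), ∀ s : Fin j → κ,
        |pd s (u k) x| ≤ (eLpNorm (weakDeriv ⊤ s a) ⊤ volume).toReal := by
      intro j hj s
      have hj' := Nat.lt_succ_iff.1 (Finset.mem_range.1 hj)
      rw [hpd k j hj' s]
      refine hbd k ?_ x
      have hfin : eLpNorm (weakDeriv ⊤ s a) ⊤ volume ≠ ⊤ :=
        ((eLpNorm_weakDeriv_le_sobNorm hj' s).trans_lt hne.lt_top).ne
      rw [eLpNorm_exponent_top] at hfin ⊢
      filter_upwards [ae_le_eLpNormEssSup (f := weakDeriv ⊤ s a) (μ := volume)] with y hy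
      rw [← Real.norm_eq_abs, ← toReal_enorm]
      exact ENNReal.toReal_mono hfin hy
    refine (Finset.sum_le_sum fun j hj => Finset.sum_le_sum fun s _ => hb j hj s).trans ?_
    have hfin : ∀ j ∈ Finset.range (m + 1), ∀ s : Fin j → κ,
        eLpNorm (weakDeriv ⊤ s a) ⊤ volume ≠ ⊤ := fun j hj s =>
      ((eLpNorm_weakDeriv_le_sobNorm (Nat.lt_succ_iff.1 (Finset.mem_range.1 hj)) s).trans_lt
        hne.lt_top).ne
    rw [← ENNReal.toReal_ofReal hM]
    refine le_trans (le_of_eq ?_) (ENNReal.toReal_mono ENNReal.ofReal_ne_top h)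
    rw [sobNorm_of_hasWeakDeriv (g := fun _ s => weakDeriv ⊤ s a) hW, ENNReal.toReal_sum]
    · refine Finset.sum_congr rfl fun j hj => ?_
      rw [ENNReal.toReal_sum fun s _ => hfin j hj s]
    · exact fun j hj => (ENNReal.sum_lt_top.2 fun s _ => (hfin j hj s).lt_top).ne
  · have hall : ∀ᵐ x, ∀ j ∈ Finset.range (m + 1), ∀ s : Fin j → κ,
        Tendsto (fun k => pd s (u k) x) atTop (𝓝 (weakDeriv ⊤ s a x)) := by
      refine (Finset.eventually_all _).2 fun j hj => eventually_all.2 fun s => ?_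
      have hj' := Nat.lt_succ_iff.1 (Finset.mem_range.1 hj)
      simp_rw [hpd _ j hj' s]
      exact hlim (hL j hj' s)
    filter_upwards [hall] with x hx
    have : ∀ p : ℕ × ℕ, jet m (u p.1 - u p.2) x = ∑ j ∈ Finset.range (m + 1),
        ∑ s : Fin j → κ, |pd s (u p.1) x - pd s (u p.2) x| := by
      intro p
      rw [jet_eq_sum ((hus _).sub (hus _))]
      simp_rw [pd_sub (hus _) (hus _)]
      rfl
    simp_rw [this]
    have z : (0 : ℝ) = ∑ j ∈ Finset.range (m + 1), ∑ s : Fin j → κ,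
        |weakDeriv ⊤ s a x - weakDeriv ⊤ s a x| := by simp
    rw [z, ← prod_atTop_atTop_eq]
    refine tendsto_finsetSum _ fun j hj => tendsto_finsetSum _ fun s _ => ?_
    exact (((hx j hj s).comp tendsto_fst).sub ((hx j hj s).comp tendsto_snd)).abs

end

/-! ### The norms of `H^k` -/

section

theorem hNorm_negSucc {m : ℕ} {f : Eu κ → ℝ} (hf : LocallyIntegrable f) :
    hNorm (Int.negSucc m) f =
      ⨆ (ψ : 𝓓((⊤ : Opens (Eu κ)), ℝ)) (_ : sobNorm ⊤ (m + 1) 2 (ψ : Eu κ → ℝ) ≤ 1),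
        ‖∫ x, f x * ψ x‖ₑ := if_pos hf

theorem locallyIntegrable_of_hNorm_ne_top {k : ℤ} {f : Eu κ → ℝ} (h : hNorm k f ≠ ⊤) :
    LocallyIntegrable f := by
  cases k with
  | ofNat m => exact locallyIntegrable_of_sobNorm_ne_top h
  | negSucc m =>
    by_contra hf
    exact h (if_neg hf)

theorem hNorm_congr {f g : Eu κ → ℝ} (h : f =ᵐ[volume] g) (k : ℤ) : hNorm k f = hNorm k g := by
  cases k with
  | ofNat m => exact sobNorm_congr m 2 (by simpa using h)
  | negSucc m =>
    by_cases hf : LocallyIntegrable f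
    · have hg : LocallyIntegrable g := hf.congr h
      rw [hNorm_negSucc hf, hNorm_negSucc hg]
      congr 1; funext ψ; congr 1; funext _; congr 1
      exact integral_congr_ae (h.mono fun x hx => by simp only [hx])
    · have hg : ¬LocallyIntegrable g := fun hg => hf (hg.congr h.symm)
      rw [hNorm, hNorm, if_neg hf, if_neg hg]

theorem integrable_mul_test_of_locallyIntegrable {f : Eu κ → ℝ} (hf : LocallyIntegrable f)
    (ψ : 𝓓((⊤ : Opens (Eu κ)), ℝ)) : Integrable (fun x => f x * ψ x) :=
  RoughDriver.integrable_mul_test (hf.locallyIntegrableOn _) ψ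

theorem pd_smul {f : Eu κ → ℝ} (hf : Smooth f) (c : ℝ) {n : ℕ} (s : Fin n → κ) :
    pd s (c • f) = c • pd s f := by
  induction n with
  | zero => rfl
  | succ n ih => rw [pd_succ, ih, pd1_smul (hf.pd _)]; rfl

theorem sobNorm_smul_test (c : ℝ) (ψ : 𝓓((⊤ : Opens (Eu κ)), ℝ)) (m : ℕ) (p : ℝ≥0∞) :
    sobNorm ⊤ m p (c • (ψ : Eu κ → ℝ)) = ‖c‖ₑ * sobNorm ⊤ m p (ψ : Eu κ → ℝ) := by
  have hψ := smooth_test ψ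
  rw [sobNorm_smooth (hψ.smul c), sobNorm_smooth hψ, Finset.mul_sum]
  refine Finset.sum_congr rfl fun j _ => ?_
  rw [Finset.mul_sum]
  refine Finset.sum_congr rfl fun s _ => ?_
  rw [pd_smul hψ, eLpNorm_const_smul]

/-- Duality between `H^{-j}` and `H^j`. -/
theorem enorm_integral_mul_le (f : Eu κ → ℝ) (ψ : 𝓓((⊤ : Opens (Eu κ)), ℝ)) (j : ℕ) :
    ‖∫ x, f x * ψ x‖ₑ ≤ hNorm (-(j : ℤ)) f * sobNorm ⊤ j 2 (ψ : Eu κ → ℝ) := by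
  -- This case is separate because the right side is zero even when the norm of `f` is infinite. The
  -- normalisation of `ψ` below also divides by its norm.
  by_cases hψ : sobNorm ⊤ j 2 (ψ : Eu κ → ℝ) = 0
  · have h0 : eLpNorm ψ 2 volume = 0 := le_antisymm (hψ ▸ eLpNorm_le_sobNorm) zero_le
    rw [eLpNorm_eq_zero_iff ψ.continuous.aestronglyMeasurable (by simp)] at h0
    have : ∫ x, f x * ψ x = 0 := by
      rw [integral_congr_ae (g := fun _ => 0) (h0.mono fun x hx => by simp [hx])]
      simp
    simp [this]
  by_cases hf : hNorm (-(j : ℤ)) f = ⊤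
  · rw [hf, ENNReal.top_mul hψ]; exact le_top
  have hL := locallyIntegrable_of_hNorm_ne_top hf
  cases j with
  | zero =>
    calc ‖∫ x, f x * ψ x‖ₑ ≤ ∫⁻ x, ‖f x * ψ x‖ₑ := enorm_integral_le_lintegral_enorm _
      _ = eLpNorm (f • (ψ : Eu κ → ℝ)) 1 volume := by rw [eLpNorm_one_eq_lintegral_enorm]; rfl
      _ ≤ eLpNorm f 2 volume * eLpNorm ψ 2 volume :=
          eLpNorm_smul_le_mul_eLpNorm ψ.continuous.aestronglyMeasurable hL.aestronglyMeasurable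
      _ ≤ _ := mul_le_mul' (eLpNorm_le_sobNorm (m := 0)) eLpNorm_le_sobNorm
  | succ m =>
    have hN : sobNorm ⊤ (m + 1) 2 (ψ : Eu κ → ℝ) ≠ ⊤ := sobNorm_test_ne_top ψ _ _
    set N := sobNorm ⊤ (m + 1) 2 (ψ : Eu κ → ℝ)
    have hN' : 0 < N.toReal := ENNReal.toReal_pos hψ hN
    have hk : (-((m + 1 : ℕ) : ℤ)) = Int.negSucc m := by omega
    rw [hk, hNorm_negSucc hL]
    have hc : ‖N.toReal⁻¹‖ₑ = N⁻¹ := by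
      rw [Real.enorm_of_nonneg (by positivity), ENNReal.ofReal_inv_of_pos hN', ENNReal.ofReal_toReal hN]
    have h1 : sobNorm ⊤ (m + 1) 2 ((N.toReal⁻¹ • ψ : 𝓓((⊤ : Opens (Eu κ)), ℝ)) : Eu κ → ℝ) ≤ 1 := by
      have := sobNorm_smul_test N.toReal⁻¹ ψ (m + 1) 2
      rw [hc, ENNReal.inv_mul_cancel hψ hN] at this
      exact this.le
    have h2 := le_iSup₂ (f := fun (ψ : 𝓓((⊤ : Opens (Eu κ)), ℝ))
      (_ : sobNorm ⊤ (m + 1) 2 (ψ : Eu κ → ℝ) ≤ 1) => ‖∫ x, f x * ψ x‖ₑ) _ h1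
    have h3 : ‖∫ x, f x * (N.toReal⁻¹ • ψ : 𝓓((⊤ : Opens (Eu κ)), ℝ)) x‖ₑ =
        N⁻¹ * ‖∫ x, f x * ψ x‖ₑ := by
      have : ∀ x, f x * (N.toReal⁻¹ • ψ : 𝓓((⊤ : Opens (Eu κ)), ℝ)) x =
          N.toReal⁻¹ * (f x * ψ x) := fun x => by
        change f x * (N.toReal⁻¹ * ψ x) = _
        ring
      simp_rw [this]
      rw [integral_const_mul, enorm_mul, hc]
    rw [h3] at h2
    calc ‖∫ x, f x * ψ x‖ₑ = N⁻¹ * ‖∫ x, f x * ψ x‖ₑ * N := by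
          rw [mul_right_comm, ENNReal.inv_mul_cancel hψ hN, one_mul]
      _ ≤ _ := mul_le_mul' h2 le_rfl

theorem hNorm_negSucc_le {m : ℕ} {f : Eu κ → ℝ} (hf : LocallyIntegrable f) {C : ℝ≥0∞}
    (h : ∀ ψ : 𝓓((⊤ : Opens (Eu κ)), ℝ),
      ‖∫ x, f x * ψ x‖ₑ ≤ C * sobNorm ⊤ (m + 1) 2 (ψ : Eu κ → ℝ)) :
    hNorm (Int.negSucc m) f ≤ C := by
  rw [hNorm_negSucc hf]
  refine iSup₂_le fun ψ hψ => (h ψ).trans ?_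
  calc _ ≤ C * 1 := mul_le_mul' le_rfl hψ
    _ = C := mul_one C

theorem hNorm_le_succ (k : ℤ) (f : Eu κ → ℝ) : hNorm k f ≤ hNorm (k + 1) f := by
  by_cases hf : hNorm (k + 1) f = ⊤
  · rw [hf]; exact le_top
  have hL := locallyIntegrable_of_hNorm_ne_top hf
  cases k with
  | ofNat m => exact sobNorm_mono (Nat.le_succ m) 2 f
  | negSucc m =>
    refine hNorm_negSucc_le hL fun ψ => ?_
    have e : Int.negSucc m + 1 = -(m : ℤ) := by omega
    rw [e]
    exact (enorm_integral_mul_le f ψ m).trans (mul_le_mul' le_rfl (sobNorm_mono (Nat.le_succ m) 2 _))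

theorem hNorm_mono {k k' : ℤ} (h : k ≤ k') (f : Eu κ → ℝ) : hNorm k f ≤ hNorm k' f :=
  monotone_int_of_le_succ (f := fun k => hNorm k f) (fun k => hNorm_le_succ k f) h

theorem hNorm_add_le (k : ℤ) (f g : Eu κ → ℝ) : hNorm k (f + g) ≤ hNorm k f + hNorm k g := by
  cases k with
  | ofNat m => exact sobNorm_add_le (by norm_num) f g
  | negSucc m =>
    by_cases hf : hNorm (Int.negSucc m) f = ⊤
    · simp [hf]
    by_cases hg : hNorm (Int.negSucc m) g = ⊤
    · simp [hg]
    have hF := locallyIntegrable_of_hNorm_ne_top hf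
    have hG := locallyIntegrable_of_hNorm_ne_top hg
    refine hNorm_negSucc_le (hF.add hG) fun ψ => ?_
    have e : ∫ x, (f + g) x * ψ x = (∫ x, f x * ψ x) + ∫ x, g x * ψ x := by
      rw [← integral_add (integrable_mul_test_of_locallyIntegrable hF ψ)
        (integrable_mul_test_of_locallyIntegrable hG ψ)]
      simp [add_mul]
    rw [e, add_mul]
    exact (enorm_add_le _ _).trans (add_le_add (enorm_integral_mul_le f ψ (m + 1))
      (enorm_integral_mul_le g ψ (m + 1)))

theorem hNorm_zero (k : ℤ) : hNorm k (0 : Eu κ → ℝ) = 0 := by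
  cases k with
  | ofNat m => exact sobNorm_zero m 2
  | negSucc m =>
    have : LocallyIntegrable (0 : Eu κ → ℝ) := locallyIntegrable_zero
    exact le_antisymm (hNorm_negSucc_le this fun ψ => by simp) zero_le

theorem hNorm_sum_le {α : Type*} (k : ℤ) (t : Finset α) (f : α → Eu κ → ℝ) :
    hNorm k (∑ a ∈ t, f a) ≤ ∑ a ∈ t, hNorm k (f a) :=
  Finset.le_sum_of_subadditive _ (hNorm_zero k).le (hNorm_add_le k) t f

theorem sobNorm_pd1_le (φ : 𝓓((⊤ : Opens (Eu κ)), ℝ)) (i : κ) (m : ℕ) (p : ℝ≥0∞) :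
    sobNorm ⊤ m p (pd1 i φ) ≤ sobNorm ⊤ (m + 1) p (φ : Eu κ → ℝ) := by
  have hφ := smooth_test φ
  rw [sobNorm_smooth (hφ.pd1 i), sobNorm_smooth hφ, Finset.sum_range_succ' _ (m + 1)]
  refine le_add_right (Finset.sum_le_sum fun j _ => ?_)
  rw [sum_fin_succ_fun]
  refine le_trans (le_of_eq ?_) (Finset.single_le_sum
    (f := fun i => ∑ t : Fin j → κ, eLpNorm (pd (Fin.cons i t : Fin (j + 1) → κ) φ) p volume)
    (fun _ _ => zero_le) (Finset.mem_univ i))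
  refine Finset.sum_congr rfl fun t _ => ?_
  rw [pd_succ, Fin.cons_zero, Fin.tail_cons, pd1_pd hφ]

theorem LocallyIntegrable.of_smooth {f : Eu κ → ℝ} (hf : Smooth f) : LocallyIntegrable f :=
  hf.continuous.locallyIntegrable

/-- For `k > 0` the norm of the derivative is a partial sum of the norm of `φ`. For `k ≤ 0`, the
passage from `L²` to `H^{-1}` included, the derivative is shifted to the dual test function. -/
theorem hNorm_pd1_le (φ : 𝓓((⊤ : Opens (Eu κ)), ℝ)) (i : κ) (k : ℤ) :
    hNorm (k - 1) (pd1 i φ) ≤ hNorm k (φ : Eu κ → ℝ) := by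
  have hφ := smooth_test φ
  have neg : ∀ j : ℕ, hNorm (-(j : ℤ) - 1) (pd1 i φ) ≤ hNorm (-(j : ℤ)) (φ : Eu κ → ℝ) := by
    intro j
    have e : -(j : ℤ) - 1 = Int.negSucc j := by omega
    rw [e]
    refine hNorm_negSucc_le (LocallyIntegrable.of_smooth (hφ.pd1 i)) fun ψ => ?_
    rw [integral_pd1_mul hφ (smooth_test ψ) ψ.hasCompactSupport, enorm_neg]
    exact (enorm_integral_mul_le φ (pdTest ![i] ψ) j).trans
      (mul_le_mul' le_rfl (sobNorm_pd1_le ψ i j 2))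
  rcases lt_or_ge 0 k with hk | hk
  · obtain ⟨m, rfl⟩ : ∃ m : ℕ, k = (m + 1 : ℕ) := ⟨(k - 1).toNat, by omega⟩
    have e : ((m + 1 : ℕ) : ℤ) - 1 = (m : ℕ) := by push_cast; ring
    rw [e]
    exact sobNorm_pd1_le φ i m 2
  · obtain ⟨j, rfl⟩ : ∃ j : ℕ, k = -(j : ℤ) := ⟨(-k).toNat, by omega⟩
    exact neg j

/-- The constant in the estimates of products in `H^k`, `|k| ≤ m`. -/
def mulConst (κ : Type) [Fintype κ] (m : ℕ) : ℝ :=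
  (∑ j ∈ Finset.range (m + 1), (Fintype.card κ : ℝ) ^ j) * 2 ^ m

theorem mulConst_nonneg (m : ℕ) : 0 ≤ mulConst κ m := by unfold mulConst; positivity

theorem mulConst_mono {m n : ℕ} (h : m ≤ n) : mulConst κ m ≤ mulConst κ n := by
  unfold mulConst
  refine mul_le_mul ?_ (pow_le_pow_right₀ (by norm_num) h) (by positivity) (by positivity)
  exact Finset.sum_le_sum_of_subset_of_nonneg (Finset.range_mono (by omega))
    fun _ _ _ => by positivity

variable {m : ℕ} {M : ℝ} {u : ℕ → Eu κ → ℝ} {a : Eu κ → ℝ}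

theorem Reg.mulTest (hu : Reg Set.univ m M u) (φ : 𝓓((⊤ : Opens (Eu κ)), ℝ)) :
    ∃ C, Reg Set.univ m C (fun n => u n * (φ : Eu κ → ℝ)) := by
  obtain ⟨C, -, hC⟩ := exists_jet_le (smooth_test φ) φ.hasCompactSupport m
  exact ⟨_, hu.mul (Reg.fixed (smooth_test φ) fun x _ => hC x)⟩

theorem eLpNorm_jet_le (φ : 𝓓((⊤ : Opens (Eu κ)), ℝ)) (j : ℕ) :
    eLpNorm (jet j φ) 2 volume ≤ sobNorm ⊤ j 2 (φ : Eu κ → ℝ) := by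
  have hφ := smooth_test φ
  have hm : ∀ {i : ℕ} (s : Fin i → κ), AEStronglyMeasurable (fun x => |pd s φ x|) :=
    fun s => (hφ.pd s).continuous.abs.aestronglyMeasurable
  have e : jet j (φ : Eu κ → ℝ) =
      ∑ i ∈ Finset.range (j + 1), ∑ s : Fin i → κ, fun x => |pd s φ x| := by
    funext x; rw [jet_eq_sum hφ]; simp
  rw [e, sobNorm_smooth hφ]
  refine (eLpNorm_sum_le (fun i _ => ?_) (by norm_num)).trans (Finset.sum_le_sum fun i _ => ?_)
  · exact Finset.aestronglyMeasurable_sum _ fun s _ => hm s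
  refine (eLpNorm_sum_le (fun s _ => hm s) (by norm_num)).trans (Finset.sum_le_sum fun s _ => ?_)
  exact (eLpNorm_norm (pd s (φ : Eu κ → ℝ))).le

/-- By the Leibniz rule every derivative of the product is at most `2 ^ j * M` times the jet of `φ`,
whose `L²`-norm is bounded by the `H^j`-norm. The other factor of `mulConst` counts the tuples of
length at most `j`. -/
theorem sobNorm_mul_le (hu : Reg Set.univ m M u) (ha : LimAE u a) {j : ℕ} (hj : j ≤ m)
    (φ : 𝓓((⊤ : Opens (Eu κ)), ℝ)) : sobNorm ⊤ j 2 (a * (φ : Eu κ → ℝ)) ≤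
      ENNReal.ofReal (mulConst κ j * M) * sobNorm ⊤ j 2 (φ : Eu κ → ℝ) := by
  have hφ := smooth_test φ
  have hM : 0 ≤ M := hu.nonneg_bound (Set.mem_univ 0)
  obtain ⟨C, hC⟩ := hu.mulTest φ
  have hlim : LimAE (fun n => u n * (φ : Eu κ → ℝ)) (a * φ) := ha.mul (LimAE.fixed _)
  rw [sobNorm_of_hasWeakDeriv (g := fun _ s => limD s fun n => u n * (φ : Eu κ → ℝ))
    fun i hi s => hC.hasWeakDeriv_top (hi.trans hj) s hlim]
  have hb : ∀ i ∈ Finset.range (j + 1), ∀ s : Fin i → κ,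
      eLpNorm (limD s fun n => u n * (φ : Eu κ → ℝ)) 2 volume ≤
        ENNReal.ofReal (2 ^ j * M) * sobNorm ⊤ j 2 (φ : Eu κ → ℝ) := by
    intro i hi s
    have hi' := Nat.lt_succ_iff.1 (Finset.mem_range.1 hi)
    refine (eLpNorm_le_mul_eLpNorm_of_ae_le_mul (c := 2 ^ j * M) (g := jet j φ) ?_ 2).trans
      (mul_le_mul' le_rfl (eLpNorm_jet_le φ j))
    filter_upwards [hC.tendsto_limD (hi'.trans hj) s] with x hx
    refine le_of_tendsto hx.norm (Eventually.of_forall fun k => ?_)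
    refine (abs_pd_le_jet ((hu.smooth k).mul hφ) s x).trans ((jet_mono hi' _ _).trans
      ((jet_mul_le (hu.smooth k) hφ j x).trans ?_))
    rw [Real.norm_of_nonneg (jet_nonneg _ _ _), mul_assoc]
    have := (jet_mono hj (u k) x).trans (hu.bound k x trivial)
    have := mul_le_mul_of_nonneg_right this (jet_nonneg j φ x)
    gcongr
  calc _ ≤ ∑ i ∈ Finset.range (j + 1), ∑ _s : Fin i → κ,
        ENNReal.ofReal (2 ^ j * M) * sobNorm ⊤ j 2 (φ : Eu κ → ℝ) :=
        Finset.sum_le_sum fun i hi => Finset.sum_le_sum fun s _ => hb i hi s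
    _ = _ := by
        have e : ∀ i : ℕ, ∑ _s : Fin i → κ,
            ENNReal.ofReal (2 ^ j * M) * sobNorm ⊤ j 2 (φ : Eu κ → ℝ) =
            ENNReal.ofReal ((Fintype.card κ : ℝ) ^ i) *
              (ENNReal.ofReal (2 ^ j * M) * sobNorm ⊤ j 2 (φ : Eu κ → ℝ)) := by
          intro i
          rw [Finset.sum_const, Finset.card_univ, nsmul_eq_mul, Fintype.card_fun, Fintype.card_fin]
          congr 1
          rw [ENNReal.ofReal_pow (by positivity)]
          simp
        simp_rw [e]
        rw [← Finset.sum_mul, ← ENNReal.ofReal_sum_of_nonneg fun _ _ => by positivity, ← mul_assoc,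
          ← ENNReal.ofReal_mul (by positivity), mulConst, mul_assoc]

theorem LimAE.integral_mul_test {O : Opens (Eu κ)} (hu : ∀ n, Smooth (u n))
    (hb : ∀ n, ∀ x, |u n x| ≤ M) (ha : LimAE u a) (ψ : 𝓓(O, ℝ)) :
    Tendsto (fun n => ∫ x, u n x * ψ x) atTop (𝓝 (∫ x, a x * ψ x)) := by
  refine tendsto_integral_of_dominated_convergence (fun x => M * |ψ x|)
    (fun k => ((hu k).continuous.mul ψ.continuous).aestronglyMeasurable) ?_ ?_ ?_
  · exact (ψ.continuous.integrable_of_hasCompactSupport ψ.hasCompactSupport).abs.const_mul M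
  · intro k
    refine Eventually.of_forall fun x => ?_
    rw [Real.norm_eq_abs, abs_mul]
    exact mul_le_mul_of_nonneg_right (hb k x) (abs_nonneg _)
  · filter_upwards [ha] with x hx
    exact hx.mul_const _

/-- Negative orders follow by duality, the factor being moved to the test function. This is done for
`u n`, since `u n * ψ` is again a test function while `a * ψ` need not be smooth. The bound does not
depend on `n`. -/
theorem hNorm_mul_le (hu : Reg Set.univ m M u) (ha : LimAE u a) {k : ℤ} (hk : k.natAbs ≤ m)
    (φ : 𝓓((⊤ : Opens (Eu κ)), ℝ)) : hNorm k (a * (φ : Eu κ → ℝ)) ≤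
      ENNReal.ofReal (mulConst κ m * M) * hNorm k (φ : Eu κ → ℝ) := by
  have hM : 0 ≤ M := hu.nonneg_bound (Set.mem_univ 0)
  have hc : ∀ {j : ℕ}, j ≤ m → ENNReal.ofReal (mulConst κ j * M) ≤
      ENNReal.ofReal (mulConst κ m * M) := fun hj =>
    ENNReal.ofReal_le_ofReal (mul_le_mul_of_nonneg_right (mulConst_mono hj) hM)
  cases k with
  | ofNat j => exact (sobNorm_mul_le hu ha hk φ).trans (mul_le_mul' (hc hk) le_rfl)
  | negSucc j =>
    have hk' : j + 1 ≤ m := hk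
    obtain ⟨C, hC⟩ := hu.mulTest φ
    have hlim : LimAE (fun n => u n * (φ : Eu κ → ℝ)) (a * φ) := ha.mul (LimAE.fixed _)
    have hL : LocallyIntegrable (a * (φ : Eu κ → ℝ)) := by
      have := (hC.hasWeakDeriv_top (Nat.zero_le m) Fin.elim0 hlim).1
      rwa [Opens.coe_top, locallyIntegrableOn_univ] at this
    refine hNorm_negSucc_le hL fun ψ => ?_
    have hI := hlim.integral_mul_test hC.smooth
      (fun n x => (abs_le_jet m _ x).trans (hC.bound n x trivial)) ψ
    refine le_of_tendsto (continuous_enorm.continuousAt.tendsto.comp hI)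
      (Eventually.of_forall fun n => ?_)
    have e : ∫ x, (u n * (φ : Eu κ → ℝ)) x * ψ x =
        ∫ x, φ x * RoughDriver.mulTest (u n) (hu.smooth n) ψ x := by
      congr 1; funext x; simp; ring
    have hs : sobNorm ⊤ (j + 1) 2 (u n * (ψ : Eu κ → ℝ)) ≤
        ENNReal.ofReal (mulConst κ m * M) * sobNorm ⊤ (j + 1) 2 (ψ : Eu κ → ℝ) :=
      (sobNorm_mul_le (Reg.fixed (hu.smooth n) (hu.bound n)) (LimAE.fixed _) hk' ψ).trans
        (mul_le_mul' (hc hk') le_rfl)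
    simp only [Function.comp_apply]
    rw [e]
    refine (enorm_integral_mul_le φ (RoughDriver.mulTest (u n) (hu.smooth n) ψ) (j + 1)).trans ?_
    have ek : (-((j + 1 : ℕ) : ℤ)) = Int.negSucc j := by omega
    rw [ek, coe_mulTest, mul_comm (ENNReal.ofReal _), mul_assoc]
    exact mul_le_mul' le_rfl hs

/-- A coefficient of regularity `m` acts only on `H^j` with `|j| ≤ m`. Terms of lower order leave
derivatives to spare, so such a `j` can be chosen between the target and source orders. -/
theorem hNorm_mul_le_of_between (hu : Reg Set.univ m M u) (ha : LimAE u a) {k l j : ℤ}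
    (h1 : k ≤ j) (h2 : j ≤ l) (hj : j.natAbs ≤ m) (φ : 𝓓((⊤ : Opens (Eu κ)), ℝ)) :
    hNorm k (a * (φ : Eu κ → ℝ)) ≤
      ENNReal.ofReal (mulConst κ m * M) * hNorm l (φ : Eu κ → ℝ) :=
  (hNorm_mono h1 _).trans ((hNorm_mul_le hu ha hj φ).trans (mul_le_mul' le_rfl (hNorm_mono h2 _)))

/-! ### Differential operators on smooth functions -/

/-- The action of a first order operator on smooth functions. -/
def Op1.cl (V : Op1 κ) (f : Eu κ → ℝ) : Eu κ → ℝ := ∑ i, V.X i * pd1 i f + V.Y * f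

/-- The action of a second order operator on smooth functions. -/
def Op2.cl (P : Op2 κ) (f : Eu κ → ℝ) : Eu κ → ℝ :=
  ∑ i, ∑ j, P.X i j * pd1 i (pd1 j f) + ∑ i, P.Y i * pd1 i f + P.Z * f

theorem Op1.apply_ae (V : Op1 κ) {f : Eu κ → ℝ} (hf : Smooth f) :
    V.apply f =ᵐ[volume] V.cl f := by
  have h : ∀ᵐ x, ∀ i, weakDeriv ⊤ ![i] f x = pd1 i f x :=
    eventually_all.2 fun i => hf.weakDeriv_ae ![i]
  filter_upwards [h] with x hx
  simp [Op1.apply, Op1.cl, hx]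

theorem Op2.apply_ae (P : Op2 κ) {f : Eu κ → ℝ} (hf : Smooth f) :
    P.apply f =ᵐ[volume] P.cl f := by
  have h : ∀ᵐ x, ∀ i, weakDeriv ⊤ ![i] f x = pd1 i f x :=
    eventually_all.2 fun i => hf.weakDeriv_ae ![i]
  have h' : ∀ᵐ x, ∀ i j, weakDeriv ⊤ ![i, j] f x = pd1 i (pd1 j f) x :=
    eventually_all.2 fun i => eventually_all.2 fun j => hf.weakDeriv_ae ![i, j]
  filter_upwards [h, h'] with x hx hx'
  simp [Op2.apply, Op2.cl, hx, hx']

/-- `W n` is a regular sequence of smooth operators converging to `V`. -/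
structure Op1.Approx (V : Op1 κ) (m : ℕ) (M : ℝ) (W : ℕ → Op1 κ) : Prop where
  regX : ∀ i, Reg Set.univ (m + 1) M fun n => (W n).X i
  regY : Reg Set.univ m M fun n => (W n).Y
  limX : ∀ i, LimAE (fun n => (W n).X i) (V.X i)
  limY : LimAE (fun n => (W n).Y) V.Y

/-- `Q n` is a regular sequence of smooth operators converging to `P`. -/
structure Op2.Approx (P : Op2 κ) (M : ℝ) (Q : ℕ → Op2 κ) : Prop where
  regX : ∀ i j, Reg Set.univ 3 M fun n => (Q n).X i j
  regY : ∀ i, Reg Set.univ 2 M fun n => (Q n).Y i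
  regZ : Reg Set.univ 1 M fun n => (Q n).Z
  limX : ∀ i j, LimAE (fun n => (Q n).X i j) (P.X i j)
  limY : ∀ i, LimAE (fun n => (Q n).Y i) (P.Y i)
  limZ : LimAE (fun n => (Q n).Z) P.Z

theorem Op1.exists_approx {V : Op1 κ} {M : ℝ} (hM : 0 ≤ M)
    (h : V.coefNorm ≤ ENNReal.ofReal M) : ∃ W, V.Approx 2 M W := by
  have hX : ∀ i, sobNorm ⊤ 3 ⊤ (V.X i) ≤ ENNReal.ofReal M := fun i =>
    (Finset.single_le_sum (f := fun i => sobNorm ⊤ 3 ⊤ (V.X i)) (fun _ _ => zero_le)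
      (Finset.mem_univ i)).trans ((le_add_right le_rfl).trans h)
  have hY : sobNorm ⊤ 2 ⊤ V.Y ≤ ENNReal.ofReal M := (le_add_left le_rfl).trans h
  choose u hu hu' using fun i => exists_reg hM (hX i)
  obtain ⟨v, hv, hv'⟩ := exists_reg hM hY
  exact ⟨fun n => ⟨fun i => u i n, v n⟩, hu, hv, hu', hv'⟩

theorem Op2.exists_approx {P : Op2 κ} {M : ℝ} (hM : 0 ≤ M)
    (h : P.coefNorm ≤ ENNReal.ofReal M) : ∃ Q, P.Approx M Q := by
  have hX : ∀ i j, sobNorm ⊤ 3 ⊤ (P.X i j) ≤ ENNReal.ofReal M := fun i j =>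
    (Finset.single_le_sum (f := fun j => sobNorm ⊤ 3 ⊤ (P.X i j)) (fun _ _ => zero_le)
      (Finset.mem_univ j)).trans ((Finset.single_le_sum
      (f := fun i => ∑ j, sobNorm ⊤ 3 ⊤ (P.X i j)) (fun _ _ => zero_le)
      (Finset.mem_univ i)).trans ((le_add_right (le_add_right le_rfl)).trans h))
  have hY : ∀ i, sobNorm ⊤ 2 ⊤ (P.Y i) ≤ ENNReal.ofReal M := fun i =>
    (Finset.single_le_sum (f := fun i => sobNorm ⊤ 2 ⊤ (P.Y i)) (fun _ _ => zero_le)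
      (Finset.mem_univ i)).trans ((le_add_right (le_add_left le_rfl)).trans h)
  have hZ : sobNorm ⊤ 1 ⊤ P.Z ≤ ENNReal.ofReal M := (le_add_left le_rfl).trans h
  choose u hu hu' using fun i j => exists_reg hM (hX i j)
  choose v hv hv' using fun i => exists_reg hM (hY i)
  obtain ⟨w, hw, hw'⟩ := exists_reg hM hZ
  exact ⟨fun n => ⟨fun i j => u i j n, fun i => v i n, w n⟩, hu, hv, hw, hu', hv', hw'⟩

theorem Op1.Approx.memD {V : Op1 κ} {W : ℕ → Op1 κ} (h : V.Approx 2 M W) : V.MemD :=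
  ENNReal.add_lt_top.2 ⟨ENNReal.sum_lt_top.2 fun i _ => (h.regX i).sobNorm_lt_top (h.limX i),
    h.regY.sobNorm_lt_top h.limY⟩

theorem Op2.Approx.memD {P : Op2 κ} {Q : ℕ → Op2 κ} (h : P.Approx M Q) : P.MemD :=
  ENNReal.add_lt_top.2 ⟨ENNReal.add_lt_top.2 ⟨ENNReal.sum_lt_top.2 fun i _ =>
    ENNReal.sum_lt_top.2 fun j _ => (h.regX i j).sobNorm_lt_top (h.limX i j),
    ENNReal.sum_lt_top.2 fun i _ => (h.regY i).sobNorm_lt_top (h.limY i)⟩,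
    h.regZ.sobNorm_lt_top h.limZ⟩

theorem Op1.Approx.opBound {V : Op1 κ} {W : ℕ → Op1 κ} (h : V.Approx 2 M W) :
    OpBound 1 V.apply ((Fintype.card κ + 1) * (mulConst κ 3 * M)) := by
  intro k hk1 hk2 φ
  push_cast at hk1 ⊢
  have hM : 0 ≤ M := h.regY.nonneg_bound (Set.mem_univ 0)
  have hM' : 0 ≤ mulConst κ 3 * M := mul_nonneg (mulConst_nonneg 3) hM
  rw [hNorm_congr (V.apply_ae (smooth_test φ))]
  have hX : ∀ i, hNorm (k - 1) (V.X i * pd1 i φ) ≤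
      ENNReal.ofReal (mulConst κ 3 * M) * hNorm k (φ : Eu κ → ℝ) := fun i =>
    (hNorm_mul_le (h.regX i) (h.limX i) (k := k - 1) (by omega) (pdTest ![i] φ)).trans
      (mul_le_mul' le_rfl (hNorm_pd1_le φ i k))
  have hY : hNorm (k - 1) (V.Y * (φ : Eu κ → ℝ)) ≤
      ENNReal.ofReal (mulConst κ 3 * M) * hNorm k (φ : Eu κ → ℝ) := by
    -- As `Y` has two derivatives, `k = 3` is treated through `H²`. All other `k` in the range
    -- satisfy `|k| ≤ 2`.
    refine (hNorm_mul_le_of_between h.regY h.limY (k := k - 1) (l := k) (j := min k 2)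
      (by omega) (by omega) (by omega) φ).trans (mul_le_mul' (ENNReal.ofReal_le_ofReal ?_) le_rfl)
    exact mul_le_mul_of_nonneg_right (mulConst_mono (by norm_num)) hM
  calc hNorm (k - 1) (V.cl φ) ≤ ∑ i, hNorm (k - 1) (V.X i * pd1 i φ) +
        hNorm (k - 1) (V.Y * (φ : Eu κ → ℝ)) :=
        (hNorm_add_le _ _ _).trans (add_le_add (hNorm_sum_le _ _ _) le_rfl)
    _ ≤ ∑ _i : κ, ENNReal.ofReal (mulConst κ 3 * M) * hNorm k (φ : Eu κ → ℝ) +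
        ENNReal.ofReal (mulConst κ 3 * M) * hNorm k (φ : Eu κ → ℝ) :=
        add_le_add (Finset.sum_le_sum fun i _ => hX i) hY
    _ = _ := by
        rw [Finset.sum_const, Finset.card_univ, nsmul_eq_mul,
          ENNReal.ofReal_mul (by positivity : (0 : ℝ) ≤ Fintype.card κ + 1),
          ENNReal.ofReal_add (by positivity) zero_le_one, ENNReal.ofReal_natCast, ENNReal.ofReal_one]
        ring

/-- The regularities 3, 2, 1 fit the range `-1 ≤ k ≤ 3` exactly: there `|k - 2| ≤ 3`, `|k - 1| ≤ 2`,
and `min k 1` lies between `k - 2` and `k` with absolute value at most 1. -/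
theorem Op2.Approx.opBound {P : Op2 κ} {Q : ℕ → Op2 κ} (h : P.Approx M Q) :
    OpBound 2 P.apply ((Fintype.card κ * Fintype.card κ + Fintype.card κ + 1) *
      (mulConst κ 3 * M)) := by
  intro k hk1 hk2 φ
  push_cast at hk1 ⊢
  have hM : 0 ≤ M := h.regZ.nonneg_bound (Set.mem_univ 0)
  have hM' : 0 ≤ mulConst κ 3 * M := mul_nonneg (mulConst_nonneg 3) hM
  have hc : ∀ {m}, m ≤ 3 → ENNReal.ofReal (mulConst κ m * M) ≤
      ENNReal.ofReal (mulConst κ 3 * M) := fun hm =>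
    ENNReal.ofReal_le_ofReal (mul_le_mul_of_nonneg_right (mulConst_mono hm) hM)
  rw [hNorm_congr (P.apply_ae (smooth_test φ))]
  have hX : ∀ i j, hNorm (k - 2) (P.X i j * pd1 i (pd1 j φ)) ≤
      ENNReal.ofReal (mulConst κ 3 * M) * hNorm k (φ : Eu κ → ℝ) := by
    intro i j
    refine (hNorm_mul_le (h.regX i j) (h.limX i j) (k := k - 2) (by omega)
      (pdTest ![i, j] φ)).trans (mul_le_mul' le_rfl ?_)
    have e1 := hNorm_pd1_le (pdTest ![j] φ) i (k - 1)
    rw [show k - 1 - 1 = k - 2 by ring] at e1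
    exact e1.trans (hNorm_pd1_le φ j k)
  have hY : ∀ i, hNorm (k - 2) (P.Y i * pd1 i φ) ≤
      ENNReal.ofReal (mulConst κ 3 * M) * hNorm k (φ : Eu κ → ℝ) := fun i =>
    (hNorm_mul_le_of_between (h.regY i) (h.limY i) (k := k - 2) (l := k - 1) (j := k - 1)
      (by omega) (by omega) (by omega) (pdTest ![i] φ)).trans
      (mul_le_mul' (hc (by norm_num)) (hNorm_pd1_le φ i k))
  have hZ : hNorm (k - 2) (P.Z * (φ : Eu κ → ℝ)) ≤
      ENNReal.ofReal (mulConst κ 3 * M) * hNorm k (φ : Eu κ → ℝ) :=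
    (hNorm_mul_le_of_between h.regZ h.limZ (k := k - 2) (l := k) (j := min k 1)
      (by omega) (by omega) (by omega) φ).trans (mul_le_mul' (hc (by norm_num)) le_rfl)
  calc hNorm (k - 2) (P.cl φ) ≤ ∑ i, ∑ j, hNorm (k - 2) (P.X i j * pd1 i (pd1 j φ)) +
        ∑ i, hNorm (k - 2) (P.Y i * pd1 i φ) + hNorm (k - 2) (P.Z * (φ : Eu κ → ℝ)) := by
        refine (hNorm_add_le _ _ _).trans (add_le_add ((hNorm_add_le _ _ _).trans
          (add_le_add ?_ (hNorm_sum_le _ _ _))) le_rfl)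
        exact (hNorm_sum_le _ _ _).trans (Finset.sum_le_sum fun i _ => hNorm_sum_le _ _ _)
    _ ≤ ∑ _i : κ, ∑ _j : κ, ENNReal.ofReal (mulConst κ 3 * M) * hNorm k (φ : Eu κ → ℝ) +
        ∑ _i : κ, ENNReal.ofReal (mulConst κ 3 * M) * hNorm k (φ : Eu κ → ℝ) +
        ENNReal.ofReal (mulConst κ 3 * M) * hNorm k (φ : Eu κ → ℝ) :=
        add_le_add (add_le_add (Finset.sum_le_sum fun i _ => Finset.sum_le_sum fun j _ => hX i j)
          (Finset.sum_le_sum fun i _ => hY i)) hZ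
    _ = _ := by
        simp only [Finset.sum_const, Finset.card_univ, nsmul_eq_mul]
        rw [ENNReal.ofReal_mul (by positivity :
            (0 : ℝ) ≤ Fintype.card κ * Fintype.card κ + Fintype.card κ + 1),
          ENNReal.ofReal_add (by positivity) zero_le_one,
          ENNReal.ofReal_add (by positivity) (by positivity),
          ENNReal.ofReal_mul (p := (Fintype.card κ : ℝ)) (by positivity),
          ENNReal.ofReal_natCast, ENNReal.ofReal_one]
        ring

end

/-! ### Operators up to the symmetry of second derivatives -/

section

/-- `P` and `Q` have the same value at `x` on every smooth function. -/
structure Op2.EqAt (P Q : Op2 κ) (x : Eu κ) : Prop where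
  X : ∀ i j, P.X i j x + P.X j i x = Q.X i j x + Q.X j i x
  Y : ∀ i, P.Y i x = Q.Y i x
  Z : P.Z x = Q.Z x

/-- The coefficients of `Q n` converge to those of `P` at `x`. -/
structure Op2.TendstoAt (Q : ℕ → Op2 κ) (P : Op2 κ) (x : Eu κ) : Prop where
  X : ∀ i j, Tendsto (fun n => (Q n).X i j x) atTop (𝓝 (P.X i j x))
  Y : ∀ i, Tendsto (fun n => (Q n).Y i x) atTop (𝓝 (P.Y i x))
  Z : Tendsto (fun n => (Q n).Z x) atTop (𝓝 (P.Z x))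

/-- A first order operator viewed as a second order operator. -/
def Op1.toOp2 (V : Op1 κ) : Op2 κ := ⟨0, V.X, V.Y⟩

/-- The composition `W ∘ V` for smooth `V`. -/
def Op1.comp (W V : Op1 κ) : Op2 κ where
  X i j := W.X i * V.X j
  Y j := ∑ i, W.X i * pd1 i (V.X j) + W.X j * V.Y + W.Y * V.X j
  Z := ∑ i, W.X i * pd1 i V.Y + W.Y * V.Y

/-- The composition `W ∘ V`. -/
def Op1.weakComp (W V : Op1 κ) : Op2 κ where
  X i j := W.X i * V.X j
  Y j := ∑ i, W.X i * weakDeriv ⊤ ![i] (V.X j) + W.X j * V.Y + W.Y * V.X j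
  Z := ∑ i, W.X i * weakDeriv ⊤ ![i] V.Y + W.Y * V.Y

/-- `V ⊗ id + id ⊗ V`. -/
def Op1.dbl (V : Op1 ι) : Op1 (ι ⊕ ι) := V.onX + V.onY

section

variable (V W : Op1 κ) (P Q : Op2 κ) (f g : Eu κ → ℝ) (i j : κ) (c : ℝ)

@[simp] theorem Op1.add_X : (V + W).X = V.X + W.X := rfl
@[simp] theorem Op1.add_Y : (V + W).Y = V.Y + W.Y := rfl
@[simp] theorem Op1.sub_X : (V - W).X = V.X - W.X := rfl
@[simp] theorem Op1.sub_Y : (V - W).Y = V.Y - W.Y := rfl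
@[simp] theorem Op1.smul_X : (c • V).X = c • V.X := rfl
@[simp] theorem Op1.smul_Y : (c • V).Y = c • V.Y := rfl
@[simp] theorem Op2.add_X : (P + Q).X = P.X + Q.X := rfl
@[simp] theorem Op2.add_Y : (P + Q).Y = P.Y + Q.Y := rfl
@[simp] theorem Op2.add_Z : (P + Q).Z = P.Z + Q.Z := rfl
@[simp] theorem Op2.sub_X : (P - Q).X = P.X - Q.X := rfl
@[simp] theorem Op2.sub_Y : (P - Q).Y = P.Y - Q.Y := rfl
@[simp] theorem Op2.sub_Z : (P - Q).Z = P.Z - Q.Z := rfl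

theorem Op1.cl_apply (x : Eu κ) : V.cl f x = ∑ i, V.X i x * pd1 i f x + V.Y x * f x := by
  simp [Op1.cl]

theorem Op2.cl_apply (x : Eu κ) : P.cl f x = ∑ i, ∑ j, P.X i j x * pd1 i (pd1 j f) x +
    ∑ i, P.Y i x * pd1 i f x + P.Z x * f x := by
  simp [Op2.cl]

theorem Op1.add_cl : (V + W).cl f = V.cl f + W.cl f := by
  funext x; simp [Op1.cl, add_mul, Finset.sum_add_distrib]; ring

theorem Op2.add_cl : (P + Q).cl f = P.cl f + Q.cl f := by
  funext x; simp [Op2.cl, add_mul, Finset.sum_add_distrib]; ring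

theorem Op2.sub_cl : (P - Q).cl f = P.cl f - Q.cl f := by
  funext x; simp [Op2.cl, sub_mul, Finset.sum_sub_distrib]; ring

theorem Op1.toOp2_cl : V.toOp2.cl f = V.cl f := by
  funext x; simp [Op1.cl, Op2.cl, Op1.toOp2]

end

theorem Op2.EqAt.cl_eq {P Q : Op2 κ} {x : Eu κ} (h : P.EqAt Q x) {f : Eu κ → ℝ} (hf : Smooth f) :
    P.cl f x = Q.cl f x := by
  have key : ∀ P : Op2 κ, 2 * ∑ i, ∑ j, P.X i j x * pd1 i (pd1 j f) x =
      ∑ i, ∑ j, (P.X i j x + P.X j i x) * pd1 i (pd1 j f) x := by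
    intro P
    have : ∑ i, ∑ j, P.X i j x * pd1 i (pd1 j f) x = ∑ i, ∑ j, P.X j i x * pd1 i (pd1 j f) x := by
      rw [Finset.sum_comm]
      exact Finset.sum_congr rfl fun i _ => Finset.sum_congr rfl fun j _ => by rw [pd1_comm hf]
    simp only [add_mul, Finset.sum_add_distrib]
    rw [← this]; ring
  have e : ∑ i, ∑ j, P.X i j x * pd1 i (pd1 j f) x = ∑ i, ∑ j, Q.X i j x * pd1 i (pd1 j f) x := by
    have h1 := key P
    simp only [h.X] at h1
    rw [← key Q] at h1
    linarith
  rw [Op2.cl_apply, Op2.cl_apply, e, h.Z]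
  simp [h.Y]

theorem Op2.EqAt.of_tendsto {P Q : ℕ → Op2 κ} {P' Q' : Op2 κ} {x : Eu κ}
    (hP : Op2.TendstoAt P P' x) (hQ : Op2.TendstoAt Q Q' x) (h : ∀ n, (P n).EqAt (Q n) x) :
    P'.EqAt Q' x where
  X i j := tendsto_nhds_unique (((hP.X i j).add (hP.X j i)).congr fun n => (h n).X i j)
    ((hQ.X i j).add (hQ.X j i))
  Y i := tendsto_nhds_unique ((hP.Y i).congr fun n => (h n).Y i) (hQ.Y i)
  Z := tendsto_nhds_unique (hP.Z.congr fun n => (h n).Z) hQ.Z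

theorem Op2.TendstoAt.add {P Q : ℕ → Op2 κ} {P' Q' : Op2 κ} {x : Eu κ}
    (hP : Op2.TendstoAt P P' x) (hQ : Op2.TendstoAt Q Q' x) :
    Op2.TendstoAt (fun n => P n + Q n) (P' + Q') x :=
  ⟨fun i j => (hP.X i j).add (hQ.X i j), fun i => (hP.Y i).add (hQ.Y i), hP.Z.add hQ.Z⟩

theorem Op2.TendstoAt.cl {Q : ℕ → Op2 κ} {P : Op2 κ} {x : Eu κ} (h : Op2.TendstoAt Q P x)
    (f : Eu κ → ℝ) : Tendsto (fun n => (Q n).cl f x) atTop (𝓝 (P.cl f x)) := by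
  simp only [Op2.cl_apply]
  exact ((tendsto_finsetSum _ fun i _ => tendsto_finsetSum _ fun j _ =>
    (h.X i j).mul_const _).add (tendsto_finsetSum _ fun i _ => (h.Y i).mul_const _)).add
    (h.Z.mul_const _)

/-! ### Coefficients are determined by the operator -/

/-- The coordinate functions are smooth. -/
theorem smooth_coord (i : κ) : Smooth (fun x : Eu κ => x i) := by
  unfold Smooth; fun_prop

theorem pd1_coord (i j : κ) : pd1 i (fun x : Eu κ => x j) = fun _ => if i = j then 1 else 0 := by
  funext x
  have : HasFDerivAt (fun x : Eu κ => x j) (EuclideanSpace.proj j : Eu κ →L[ℝ] ℝ) x :=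
    (EuclideanSpace.proj j : Eu κ →L[ℝ] ℝ).hasFDerivAt
  rw [pd1, this.fderiv]
  simp [eq_comm]

/-- Smooth cut-off functions that equal `1` on balls. -/
theorem exists_cutoff (R : ℕ) : ∃ χ : 𝓓((⊤ : Opens (Eu κ)), ℝ),
    ∀ x ∈ Metric.ball (0 : Eu κ) (R + 1), χ x = 1 := by
  let b : ContDiffBump (0 : Eu κ) := ⟨R + 1, R + 2, by positivity, by linarith⟩
  refine ⟨mkTest b b.contDiff b.hasCompactSupport (Set.subset_univ _), fun x hx => ?_⟩
  exact b.one_of_mem_closedBall (Metric.ball_subset_closedBall hx)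

theorem pd1_eq_of_eqOn {f g : Eu κ → ℝ} {s : Set (Eu κ)} (hs : IsOpen s) (h : Set.EqOn f g s)
    (i : κ) : Set.EqOn (pd1 i f) (pd1 i g) s := by
  intro x hx
  unfold pd1
  rw [Filter.EventuallyEq.fderiv_eq (h.eventuallyEq_of_mem (hs.mem_nhds hx))]

theorem Op2.cl_eqOn (P : Op2 κ) {f g : Eu κ → ℝ} {s : Set (Eu κ)} (hs : IsOpen s)
    (h : Set.EqOn f g s) : Set.EqOn (P.cl f) (P.cl g) s := by
  intro x hx
  have h1 := fun i => pd1_eq_of_eqOn hs h i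
  have h2 := fun i j => pd1_eq_of_eqOn hs (h1 j) i
  rw [Op2.cl_apply, Op2.cl_apply, h hx]
  congr 2
  · exact Finset.sum_congr rfl fun i _ => Finset.sum_congr rfl fun j _ => by rw [h2 i j hx]
  · exact Finset.sum_congr rfl fun i _ => by rw [h1 i hx]

/-- Differential operators are local, so a smooth function may be replaced by its product with a
cut-off equal to one near the point. Countably many cut-offs suffice, which keeps the exceptional
set null. -/
theorem Op2.ae_cl_eq (P Q : Op2 κ)
    (h : ∀ φ : 𝓓((⊤ : Opens (Eu κ)), ℝ), P.cl φ =ᵐ[volume] Q.cl φ) {f : Eu κ → ℝ}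
    (hf : Smooth f) : P.cl f =ᵐ[volume] Q.cl f := by
  choose χ hχ using exists_cutoff (κ := κ)
  have h' : ∀ᵐ x, ∀ R, P.cl (RoughDriver.mulTest f hf (χ R)) x =
      Q.cl (RoughDriver.mulTest f hf (χ R)) x := ae_all_iff.2 fun R => h _
  filter_upwards [h'] with x hx
  obtain ⟨R, hR⟩ := exists_nat_gt ‖x‖
  have hxR : x ∈ Metric.ball (0 : Eu κ) (R + 1) := by simp; linarith
  have e : Set.EqOn (RoughDriver.mulTest f hf (χ R)) f (Metric.ball (0 : Eu κ) (R + 1)) := by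
    intro y hy
    simp [hχ R y hy]
  have := hx R
  rwa [P.cl_eqOn Metric.isOpen_ball e hxR, Q.cl_eqOn Metric.isOpen_ball e hxR] at this

theorem Op2.cl_one (P : Op2 κ) (x : Eu κ) : P.cl (fun _ => 1) x = P.Z x := by
  simp [Op2.cl_apply]

theorem Op2.cl_coord (P : Op2 κ) (j : κ) (x : Eu κ) :
    P.cl (fun x => x j) x = P.Y j x + P.Z x * x j := by
  simp [Op2.cl_apply, pd1_coord]

theorem pd1_coord_mul (i j k : κ) : pd1 k (fun x : Eu κ => x i * x j) =
    (if k = i then 1 else 0 : ℝ) • (fun x : Eu κ => x j) +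
      (if k = j then 1 else 0 : ℝ) • fun x : Eu κ => x i := by
  have := pd1_mul (smooth_coord i) (smooth_coord j) k
  rw [pd1_coord, pd1_coord] at this
  refine Eq.trans this ?_
  funext x
  split_ifs <;> simp <;> ring

theorem Op2.cl_coord_mul (P : Op2 κ) (i j : κ) (x : Eu κ) :
    P.cl (fun x => x i * x j) x =
      P.X i j x + P.X j i x + P.Y i x * x j + P.Y j x * x i + P.Z x * (x i * x j) := by
  have e : ∀ k l, pd1 l (pd1 k (fun x : Eu κ => x i * x j)) x =
      (if k = i then 1 else 0) * (if l = j then 1 else 0) +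
      (if k = j then 1 else 0) * (if l = i then 1 else 0) := by
    intro k l
    rw [pd1_coord_mul, pd1_add ((smooth_coord j).smul _) ((smooth_coord i).smul _),
      pd1_smul (smooth_coord j), pd1_smul (smooth_coord i), pd1_coord, pd1_coord]
    split_ifs <;> simp
  have e' : ∀ k, pd1 k (fun x : Eu κ => x i * x j) x =
      (if k = i then 1 else 0) * x j + (if k = j then 1 else 0) * x i := by
    intro k
    rw [pd1_coord_mul]
    split_ifs <;> simp
  rw [Op2.cl_apply]
  simp only [e, e']
  simp [mul_add, Finset.sum_add_distrib]
  ring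

/-- The values on `1`, `x i`, `x i * x j` determine successively `Z`, `Y` and the symmetric part of
`X`. Chen's relations on test functions thus become pointwise identities of coefficients, which can
be pulled back to either half of the doubled space. -/
theorem Op2.ae_eqAt {P Q : Op2 κ}
    (h : ∀ φ : 𝓓((⊤ : Opens (Eu κ)), ℝ), P.cl φ =ᵐ[volume] Q.cl φ) : ∀ᵐ x, P.EqAt Q x := by
  have h0 := P.ae_cl_eq Q h (f := fun _ => 1) contDiff_const
  have h1 : ∀ᵐ x, ∀ i, P.cl (fun x => x i) x = Q.cl (fun x => x i) x :=
    ae_all_iff.2 fun i => P.ae_cl_eq Q h (smooth_coord i)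
  have h2 : ∀ᵐ x, ∀ i j, P.cl (fun x => x i * x j) x = Q.cl (fun x => x i * x j) x :=
    ae_all_iff.2 fun i => ae_all_iff.2 fun j =>
      P.ae_cl_eq Q h ((smooth_coord i).mul (smooth_coord j))
  filter_upwards [h0, h1, h2] with x h0 h1 h2
  simp only [Op2.cl_one, Op2.cl_coord, Op2.cl_coord_mul] at h0 h1 h2
  have hY : ∀ i, P.Y i x = Q.Y i x := fun i => by have := h1 i; rw [h0] at this; linarith
  refine ⟨fun i j => ?_, hY, h0⟩
  have := h2 i j
  rw [h0, hY, hY] at this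
  linarith

theorem Op1.ae_eq {V W : Op1 κ}
    (h : ∀ φ : 𝓓((⊤ : Opens (Eu κ)), ℝ), V.cl φ =ᵐ[volume] W.cl φ) :
    ∀ᵐ x, (∀ i, V.X i x = W.X i x) ∧ V.Y x = W.Y x := by
  have := Op2.ae_eqAt (P := V.toOp2) (Q := W.toOp2) fun φ => by
    simpa [Op1.toOp2_cl] using h φ
  filter_upwards [this] with x hx using ⟨hx.Y, hx.Z⟩

/-! ### Composition -/

/-- The coefficients of `V` are smooth. -/
def Op1.IsSmooth (V : Op1 κ) : Prop := (∀ i, Smooth (V.X i)) ∧ Smooth V.Y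

theorem Op1.IsSmooth.cl {V : Op1 κ} (hV : V.IsSmooth) {f : Eu κ → ℝ} (hf : Smooth f) :
    Smooth (V.cl f) :=
  (Smooth.sum fun i _ => (hV.1 i).mul (hf.pd1 i)).add (hV.2.mul hf)

theorem Op1.IsSmooth.pd1_cl {V : Op1 κ} (hV : V.IsSmooth) {f : Eu κ → ℝ} (hf : Smooth f) (k : κ) :
    pd1 k (V.cl f) = ∑ i, (pd1 k (V.X i) * pd1 i f + V.X i * pd1 k (pd1 i f)) +
      (pd1 k V.Y * f + V.Y * pd1 k f) := by
  unfold Op1.cl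
  rw [pd1_add (Smooth.sum fun i _ => (hV.1 i).mul (hf.pd1 i)) (hV.2.mul hf),
    pd1_sum _ fun i _ => (hV.1 i).mul (hf.pd1 i), pd1_mul hV.2 hf]
  simp_rw [pd1_mul (hV.1 _) (hf.pd1 _)]

theorem Op1.IsSmooth.cl_cl {V : Op1 κ} (hV : V.IsSmooth) (W : Op1 κ) {f : Eu κ → ℝ}
    (hf : Smooth f) : W.cl (V.cl f) = (W.comp V).cl f := by
  funext x
  rw [Op1.cl_apply, Op2.cl_apply]
  simp_rw [hV.pd1_cl hf]
  simp only [Op1.comp, Op1.cl_apply, Pi.add_apply, Pi.mul_apply, Finset.sum_apply,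
    mul_add, add_mul, Finset.sum_add_distrib, Finset.mul_sum, Finset.sum_mul]
  rw [Finset.sum_comm (f := fun i j => W.X i x * (pd1 i (V.X j) x * pd1 j f x))]
  simp only [← mul_assoc]
  ring

theorem Op1.Approx.isSmooth {V : Op1 κ} {m : ℕ} {M : ℝ} {U : ℕ → Op1 κ} (h : V.Approx m M U)
    (n : ℕ) : (U n).IsSmooth := ⟨fun i => (h.regX i).smooth n, h.regY.smooth n⟩

theorem Op1.Approx.limAE_cl {V : Op1 κ} {m : ℕ} {M : ℝ} {U : ℕ → Op1 κ} (h : V.Approx m M U)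
    (f : Eu κ → ℝ) : LimAE (fun n => (U n).cl f) (V.cl f) :=
  (LimAE.sum fun i _ => (h.limX i).mul (LimAE.fixed _)).add (h.limY.mul (LimAE.fixed _))

theorem Op1.Approx.reg_cl {V : Op1 κ} {m : ℕ} {M : ℝ} {U : ℕ → Op1 κ} (h : V.Approx m M U)
    (φ : 𝓓((⊤ : Opens (Eu κ)), ℝ)) : ∃ C, Reg Set.univ m C (fun n => (U n).cl φ) := by
  have hX : ∀ i, ∃ C, Reg Set.univ m C (fun n => (U n).X i * pd1 i φ) := fun i =>
    ((h.regX i).of_le (Nat.le_succ m) le_rfl subset_rfl).mulTest (pdTest ![i] φ)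
  choose C hC using hX
  obtain ⟨C', hC'⟩ := h.regY.mulTest φ
  exact ⟨_, (Reg.sum fun i _ => hC i).add hC'⟩

theorem Op1.Approx.tendsto_comp {V : Op1 κ} {m : ℕ} {M : ℝ} {U : ℕ → Op1 κ}
    (h : V.Approx (m + 1) M U) (W : Op1 κ) :
    ∀ᵐ x, Op2.TendstoAt (fun n => W.comp (U n)) (W.weakComp V) x := by
  have h1 : ∀ᵐ x, ∀ j, Tendsto (fun n => (U n).X j x) atTop (𝓝 (V.X j x)) :=
    ae_all_iff.2 h.limX
  have h2 : ∀ᵐ x, ∀ i j, Tendsto (fun n => pd1 i ((U n).X j) x) atTop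
      (𝓝 (weakDeriv ⊤ ![i] (V.X j) x)) :=
    ae_all_iff.2 fun i => ae_all_iff.2 fun j => (h.regX j).limAE_weakDeriv_one i (h.limX j)
  have h3 : ∀ᵐ x, ∀ i, Tendsto (fun n => pd1 i (U n).Y x) atTop
      (𝓝 (weakDeriv ⊤ ![i] V.Y x)) :=
    ae_all_iff.2 fun i => h.regY.limAE_weakDeriv_one i h.limY
  filter_upwards [h1, h2, h3, h.limY] with x h1 h2 h3 h4
  refine ⟨fun i j => (h1 j).const_mul _, fun j => ?_, ?_⟩
  · simp only [Op1.comp, Op1.weakComp, Pi.add_apply, Finset.sum_apply, Pi.mul_apply]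
    exact ((tendsto_finsetSum _ fun i _ => (h2 i j).const_mul _).add (h4.const_mul _)).add
      ((h1 j).const_mul _)
  · simp only [Op1.comp, Op1.weakComp, Pi.add_apply, Finset.sum_apply, Pi.mul_apply]
    exact (tendsto_finsetSum _ fun i _ => (h3 i).const_mul _).add (h4.const_mul _)

theorem Op1.apply_congr (V : Op1 κ) {f g : Eu κ → ℝ} (h : f =ᵐ[volume] g) :
    V.apply f =ᵐ[volume] V.apply g := by
  filter_upwards [h] with x hx
  have : ∀ i, weakDeriv ⊤ ![i] f = weakDeriv ⊤ ![i] g := fun i => weakDeriv_congr (by simpa using h)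
  simp [Op1.apply, hx, this]

/-- The function `V.apply φ` is only weakly differentiable. The composition formula is used for the
smooth `U n` and passed to the limit; `W` merely multiplies and needs no regularity. -/
theorem Op1.Approx.apply_apply {V : Op1 κ} {m : ℕ} {M : ℝ} {U : ℕ → Op1 κ}
    (h : V.Approx (m + 1) M U) (W : Op1 κ) (φ : 𝓓((⊤ : Opens (Eu κ)), ℝ)) :
    W.apply (V.apply φ) =ᵐ[volume] (W.weakComp V).cl φ := by
  have hφ := smooth_test φ
  refine (W.apply_congr (V.apply_ae hφ)).trans ?_
  obtain ⟨C, hC⟩ := h.reg_cl φ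
  have h1 : ∀ᵐ x, ∀ i, Tendsto (fun n => pd1 i ((U n).cl φ) x) atTop
      (𝓝 (weakDeriv ⊤ ![i] (V.cl φ) x)) :=
    ae_all_iff.2 fun i => hC.limAE_weakDeriv_one i (h.limAE_cl φ)
  filter_upwards [h1, h.limAE_cl φ, h.tendsto_comp W] with x h1 h2 h3
  have h4 : Tendsto (fun n => W.cl ((U n).cl φ) x) atTop (𝓝 (W.apply (V.cl φ) x)) := by
    simp only [Op1.cl_apply W, Op1.apply]
    exact (tendsto_finsetSum _ fun i _ => (h1 i).const_mul _).add (h2.const_mul _)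
  refine tendsto_nhds_unique h4 ((h3.cl φ).congr fun n => ?_)
  rw [(h.isSmooth n).cl_cl W hφ]

/-! ### Doubling -/

theorem Op2.TendstoAt.onX {P : ℕ → Op2 ι} {Q : Op2 ι} {z : Eu (ι ⊕ ι)}
    (h : Op2.TendstoAt P Q (xPart z)) : Op2.TendstoAt (fun n => (P n).onX) Q.onX z where
  X i j := by rcases i with i | i <;> rcases j with j | j <;> simp [Op2.onX, h.X]
  Y i := by rcases i with i | i <;> simp [Op2.onX, h.Y]
  Z := h.Z

theorem Op2.TendstoAt.onY {P : ℕ → Op2 ι} {Q : Op2 ι} {z : Eu (ι ⊕ ι)}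
    (h : Op2.TendstoAt P Q (yPart z)) : Op2.TendstoAt (fun n => (P n).onY) Q.onY z where
  X i j := by rcases i with i | i <;> rcases j with j | j <;> simp [Op2.onY, h.X]
  Y i := by rcases i with i | i <;> simp [Op2.onY, h.Y]
  Z := h.Z

theorem pd1_inl_comp_xPart {f : Eu ι → ℝ} (hf : Smooth f) (i : ι) :
    pd1 (Sum.inl i) (fun z : Eu (ι ⊕ ι) => f (xPart z)) = fun z => pd1 i f (xPart z) := by
  simpa using pd1_inl_comp_comb hf 1 0 i

theorem pd1_inr_comp_xPart {f : Eu ι → ℝ} (hf : Smooth f) (i : ι) :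
    pd1 (Sum.inr i) (fun z : Eu (ι ⊕ ι) => f (xPart z)) = 0 := by
  simpa using pd1_inr_comp_comb hf 1 0 i

theorem pd1_inl_comp_yPart {f : Eu ι → ℝ} (hf : Smooth f) (i : ι) :
    pd1 (Sum.inl i) (fun z : Eu (ι ⊕ ι) => f (yPart z)) = 0 := by
  simpa using pd1_inl_comp_comb hf 0 1 i

theorem pd1_inr_comp_yPart {f : Eu ι → ℝ} (hf : Smooth f) (i : ι) :
    pd1 (Sum.inr i) (fun z : Eu (ι ⊕ ι) => f (yPart z)) = fun z => pd1 i f (yPart z) := by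
  simpa using pd1_inr_comp_comb hf 0 1 i

theorem Smooth.comp_xPart {f : Eu ι → ℝ} (hf : Smooth f) :
    Smooth (fun z : Eu (ι ⊕ ι) => f (xPart z)) := by simpa using hf.comp_comb 1 0

theorem Smooth.comp_yPart {f : Eu ι → ℝ} (hf : Smooth f) :
    Smooth (fun z : Eu (ι ⊕ ι) => f (yPart z)) := by simpa using hf.comp_comb 0 1

theorem Op1.dbl_X_inl (V : Op1 ι) (i : ι) :
    V.dbl.X (Sum.inl i) = fun z => V.X i (xPart z) := by
  funext z; simp [Op1.dbl, Op1.onX, Op1.onY]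

theorem Op1.dbl_X_inr (V : Op1 ι) (i : ι) :
    V.dbl.X (Sum.inr i) = fun z => V.X i (yPart z) := by
  funext z; simp [Op1.dbl, Op1.onX, Op1.onY]

theorem Op1.dbl_Y (V : Op1 ι) :
    V.dbl.Y = (fun z => V.Y (xPart z)) + fun z => V.Y (yPart z) := rfl

/-- The composition of doubled operators, after reordering the cross terms. -/
theorem Op1.IsSmooth.comp_dbl {V : Op1 ι} (hV : V.IsSmooth) (W : Op1 ι) (z : Eu (ι ⊕ ι)) :
    (W.dbl.comp V.dbl).EqAt
      ((W.comp V).onX + W.tensor V + V.tensor W + (W.comp V).onY) z where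
  X i j := by
    rcases i with i | i <;> rcases j with j | j <;>
      simp [Op1.comp, Op1.dbl_X_inl, Op1.dbl_X_inr, Op2.onX, Op2.onY, Op1.tensor] <;> ring
  Y i := by
    rcases i with i | i <;>
      simp [Op1.comp, Op1.dbl_X_inl, Op1.dbl_X_inr, Op1.dbl_Y, Op2.onX, Op2.onY, Op1.tensor,
        pd1_inl_comp_xPart (hV.1 _), pd1_inr_comp_xPart (hV.1 _), pd1_inl_comp_yPart (hV.1 _),
        pd1_inr_comp_yPart (hV.1 _)] <;> ring
  Z := by
    have h : ∀ k, pd1 k ((fun z : Eu (ι ⊕ ι) => V.Y (xPart z)) + fun z => V.Y (yPart z)) =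
        pd1 k (fun z : Eu (ι ⊕ ι) => V.Y (xPart z)) + pd1 k fun z => V.Y (yPart z) :=
      fun k => pd1_add hV.2.comp_xPart hV.2.comp_yPart k
    simp [Op1.comp, Op1.dbl_X_inl, Op1.dbl_X_inr, Op1.dbl_Y, Op2.onX, Op2.onY, Op1.tensor, h,
      pd1_inl_comp_xPart hV.2, pd1_inr_comp_xPart hV.2, pd1_inl_comp_yPart hV.2,
      pd1_inr_comp_yPart hV.2]
    ring

theorem Op1.Approx.dbl {V : Op1 ι} {m : ℕ} {M : ℝ} {U : ℕ → Op1 ι} (h : V.Approx m M U) :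
    V.dbl.Approx m (M + M) (fun n => (U n).dbl) where
  regX i := by
    have hM : 0 ≤ M := h.regY.nonneg_bound (Set.mem_univ 0)
    rcases i with i | i
    · simp_rw [Op1.dbl_X_inl]; exact (h.regX i).xPart.of_le le_rfl (by linarith) subset_rfl
    · simp_rw [Op1.dbl_X_inr]; exact (h.regX i).yPart.of_le le_rfl (by linarith) subset_rfl
  regY := h.regY.xPart.add h.regY.yPart
  limX i := by
    rcases i with i | i
    · simp_rw [Op1.dbl_X_inl]; exact (h.limX i).xPart
    · simp_rw [Op1.dbl_X_inr]; exact (h.limX i).yPart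
  limY := h.limY.xPart.add h.limY.yPart

/-- This is the limit of `Op1.IsSmooth.comp_dbl`. Only `EqAt` can hold: the composition puts mixed
coefficients in both off-diagonal blocks, whereas `tensor` records them all in the `(x, y)` block.
-/
theorem Op1.Approx.ae_weakComp_dbl {V : Op1 ι} {m : ℕ} {M : ℝ} {U : ℕ → Op1 ι}
    (h : V.Approx (m + 1) M U) (W : Op1 ι) :
    ∀ᵐ z, (W.dbl.weakComp V.dbl).EqAt
      ((W.weakComp V).onX + W.tensor V + V.tensor W + (W.weakComp V).onY) z := by
  have hX : ∀ᵐ z : Eu (ι ⊕ ι), ∀ j, Tendsto (fun n => (U n).X j (xPart z)) atTop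
      (𝓝 (V.X j (xPart z))) := ae_all_iff.2 fun j => (h.limX j).xPart
  have hY : ∀ᵐ z : Eu (ι ⊕ ι), ∀ j, Tendsto (fun n => (U n).X j (yPart z)) atTop
      (𝓝 (V.X j (yPart z))) := ae_all_iff.2 fun j => (h.limX j).yPart
  filter_upwards [h.dbl.tendsto_comp W.dbl, ae_comp_xPart (h.tendsto_comp W),
    ae_comp_yPart (h.tendsto_comp W), hX, hY, h.limY.xPart, h.limY.yPart]
    with z h1 h2 h3 h4 h5 h6 h7
  have t1 : Op2.TendstoAt (fun n => W.tensor (U n)) (W.tensor V) z := by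
    refine ⟨fun i j => ?_, fun i => ?_, h7.const_mul _⟩
    · rcases i with i | i <;> rcases j with j | j <;> simp [Op1.tensor]
      exact (h5 j).const_mul _
    · rcases i with i | i <;> simp [Op1.tensor]
      · exact h7.const_mul _
      · exact (h5 i).const_mul _
  have t2 : Op2.TendstoAt (fun n => (U n).tensor W) (V.tensor W) z := by
    refine ⟨fun i j => ?_, fun i => ?_, h6.mul_const _⟩
    · rcases i with i | i <;> rcases j with j | j <;> simp [Op1.tensor]
      exact (h4 i).mul_const _
    · rcases i with i | i <;> simp [Op1.tensor]
      · exact (h4 i).mul_const _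
      · exact h6.mul_const _
  exact Op2.EqAt.of_tendsto h1 (((h2.onX.add t1).add t2).add h3.onY)
    fun n => (h.isSmooth n).comp_dbl W z

end

/-! ### The doubled driver -/

section

/-- `P ⊗ id + V ⊗ V + id ⊗ P`. -/
def Op2.dbl (P : Op2 ι) (V : Op1 ι) : Op2 (ι ⊕ ι) := P.onX + V.tensor V + P.onY

section

variable (P : Op2 ι) (V : Op1 ι) (i j : ι)

theorem Op2.dbl_X_inl_inl :
    (P.dbl V).X (Sum.inl i) (Sum.inl j) = fun z => P.X i j (xPart z) := by
  funext z; simp [Op2.dbl, Op2.onX, Op2.onY, Op1.tensor]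

theorem Op2.dbl_X_inl_inr : (P.dbl V).X (Sum.inl i) (Sum.inr j) =
    (fun z => V.X i (xPart z)) * fun z => V.X j (yPart z) := by
  funext z; simp [Op2.dbl, Op2.onX, Op2.onY, Op1.tensor]

theorem Op2.dbl_X_inr_inl : (P.dbl V).X (Sum.inr i) (Sum.inl j) = 0 := by
  funext z; simp [Op2.dbl, Op2.onX, Op2.onY, Op1.tensor]

theorem Op2.dbl_X_inr_inr :
    (P.dbl V).X (Sum.inr i) (Sum.inr j) = fun z => P.X i j (yPart z) := by
  funext z; simp [Op2.dbl, Op2.onX, Op2.onY, Op1.tensor]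

theorem Op2.dbl_Y_inl : (P.dbl V).Y (Sum.inl i) =
    (fun z => P.Y i (xPart z)) + (fun z => V.X i (xPart z)) * fun z => V.Y (yPart z) := by
  funext z; simp [Op2.dbl, Op2.onX, Op2.onY, Op1.tensor]

theorem Op2.dbl_Y_inr : (P.dbl V).Y (Sum.inr i) =
    (fun z => V.Y (xPart z)) * (fun z => V.X i (yPart z)) + fun z => P.Y i (yPart z) := by
  funext z; simp [Op2.dbl, Op2.onX, Op2.onY, Op1.tensor]

theorem Op2.dbl_Z : (P.dbl V).Z = (fun z => P.Z (xPart z)) +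
    (fun z => V.Y (xPart z)) * (fun z => V.Y (yPart z)) + fun z => P.Z (yPart z) := rfl

end

/-- The factor `8 = 2 ^ 3` is the Leibniz constant for `X i (x) * X j (y)` at order three. The bound
is linear in `M` and quadratic in `N`, so `N` of size `ω^α` and `M` of size `ω^{2α}` give `ω^{2α}`.
-/
theorem Op2.Approx.dbl {P : Op2 ι} {V : Op1 ι} {M N : ℝ} {Q : ℕ → Op2 ι} {U : ℕ → Op1 ι}
    (h : P.Approx M Q) (h' : V.Approx 2 N U) :
    (P.dbl V).Approx (2 * M + 8 * (N * N)) (fun n => (Q n).dbl (U n)) := by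
  have hM : 0 ≤ M := h.regZ.nonneg_bound (Set.mem_univ 0)
  have hN : 0 ≤ N := h'.regY.nonneg_bound (Set.mem_univ 0)
  have hNN : 0 ≤ N * N := mul_nonneg hN hN
  refine ⟨fun i j => ?_, fun i => ?_, ?_, fun i j => ?_, fun i => ?_, ?_⟩
  · rcases i with i | i <;> rcases j with j | j
    · simp_rw [Op2.dbl_X_inl_inl]; exact (h.regX i j).xPart.of_le le_rfl (by linarith) subset_rfl
    · simp_rw [Op2.dbl_X_inl_inr]
      exact ((h'.regX i).xPart.mul (h'.regX j).yPart).of_le le_rfl (by norm_num; linarith) subset_rfl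
    · simp_rw [Op2.dbl_X_inr_inl]; exact Reg.zero _ _ (by linarith)
    · simp_rw [Op2.dbl_X_inr_inr]; exact (h.regX i j).yPart.of_le le_rfl (by linarith) subset_rfl
  · rcases i with i | i
    · simp_rw [Op2.dbl_Y_inl]
      exact ((h.regY i).xPart.add (((h'.regX i).of_le (Nat.le_succ 2) le_rfl subset_rfl).xPart.mul
        h'.regY.yPart)).of_le le_rfl (by norm_num; linarith) subset_rfl
    · simp_rw [Op2.dbl_Y_inr]
      exact ((h'.regY.xPart.mul ((h'.regX i).of_le (Nat.le_succ 2) le_rfl subset_rfl).yPart).add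
        (h.regY i).yPart).of_le le_rfl (by norm_num; linarith) subset_rfl
  · simp_rw [Op2.dbl_Z]
    exact ((h.regZ.xPart.add ((h'.regY.xPart.mul h'.regY.yPart).of_le (Nat.le_succ 1) le_rfl
      subset_rfl)).add h.regZ.yPart).of_le le_rfl (by norm_num; linarith) subset_rfl
  · rcases i with i | i <;> rcases j with j | j
    · simp_rw [Op2.dbl_X_inl_inl]; exact (h.limX i j).xPart
    · simp_rw [Op2.dbl_X_inl_inr]; exact (h'.limX i).xPart.mul (h'.limX j).yPart
    · simp_rw [Op2.dbl_X_inr_inl]; exact LimAE.fixed 0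
    · simp_rw [Op2.dbl_X_inr_inr]; exact (h.limX i j).yPart
  · rcases i with i | i
    · simp_rw [Op2.dbl_Y_inl]; exact (h.limY i).xPart.add ((h'.limX i).xPart.mul h'.limY.yPart)
    · simp_rw [Op2.dbl_Y_inr]; exact (h'.limY.xPart.mul (h'.limX i).yPart).add (h.limY i).yPart
  · simp_rw [Op2.dbl_Z]
    exact (h.limZ.xPart.add (h'.limY.xPart.mul h'.limY.yPart)).add h.limZ.yPart

theorem OpBound.mono {i : ℕ} {P : (Eu κ → ℝ) → Eu κ → ℝ} {M M' : ℝ} (h : OpBound i P M)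
    (hM : M ≤ M') : OpBound i P M' := fun k h1 h2 φ =>
  (h k h1 h2 φ).trans (mul_le_mul' (ENNReal.ofReal_le_ofReal hM) le_rfl)

theorem IsControl.const_mul {T : ℝ} {w : ℝ → ℝ → ℝ} (h : IsControl T w) {A : ℝ} (hA : 0 ≤ A) :
    IsControl T fun s t => A * w s t where
  continuousOn := h.continuousOn.const_mul A
  nonneg s t hst := mul_nonneg hA (h.nonneg s t hst)
  superadd s θ t h1 h2 h3 h4 := by
    have := mul_le_mul_of_nonneg_left (h.superadd s θ t h1 h2 h3 h4) hA
    linarith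

/-! ### Chen's relations as identities between coefficients -/

theorem IsDifferentialRoughDriver.ae_chen1 {T α : ℝ} {w : ℝ → ℝ → ℝ} {B1 : ℝ → ℝ → Op1 κ}
    {B2 : ℝ → ℝ → Op2 κ} (hB : IsDifferentialRoughDriver T α w B1 B2) {s θ t : ℝ} (h1 : 0 ≤ s)
    (h2 : s ≤ θ) (h3 : θ ≤ t) (h4 : t ≤ T) :
    ∀ᵐ x, (∀ i, (B1 s t).X i x = (B1 s θ).X i x + (B1 θ t).X i x) ∧
      (B1 s t).Y x = (B1 s θ).Y x + (B1 θ t).Y x := by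
  refine Op1.ae_eq (W := B1 s θ + B1 θ t) fun φ => ?_
  have hφ := smooth_test φ
  filter_upwards [hB.chen1 s θ t h1 h2 h3 h4 φ, (B1 s t).apply_ae hφ, (B1 s θ).apply_ae hφ,
    (B1 θ t).apply_ae hφ] with x e1 e2 e3 e4
  rw [Op1.add_cl, Pi.add_apply, ← e2, ← e3, ← e4]
  simp only [Pi.sub_apply, Pi.zero_apply] at e1
  linarith

theorem IsDifferentialRoughDriver.ae_chen2 {T α : ℝ} {w : ℝ → ℝ → ℝ} {B1 : ℝ → ℝ → Op1 κ}
    {B2 : ℝ → ℝ → Op2 κ} (hB : IsDifferentialRoughDriver T α w B1 B2) {s θ t : ℝ} (h1 : 0 ≤ s)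
    (h2 : s ≤ θ) (h3 : θ ≤ t) (h4 : t ≤ T) {m : ℕ} {M : ℝ} {U : ℕ → Op1 κ}
    (hU : (B1 s θ).Approx (m + 1) M U) :
    ∀ᵐ x, (B2 s t).EqAt (B2 s θ + B2 θ t + (B1 θ t).weakComp (B1 s θ)) x := by
  refine Op2.ae_eqAt fun φ => ?_
  have hφ := smooth_test φ
  filter_upwards [hB.chen2 s θ t h1 h2 h3 h4 φ, (B2 s t).apply_ae hφ, (B2 s θ).apply_ae hφ,
    (B2 θ t).apply_ae hφ, hU.apply_apply (B1 θ t) φ] with x e1 e2 e3 e4 e5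
  rw [Op2.add_cl, Op2.add_cl, Pi.add_apply, Pi.add_apply, ← e2, ← e3, ← e4, ← e5]
  simp only [Pi.sub_apply] at e1
  linarith

theorem CoefficientsControlled.exists_pos {T α : ℝ} {w : ℝ → ℝ → ℝ} {B1 : ℝ → ℝ → Op1 κ}
    {B2 : ℝ → ℝ → Op2 κ} (hw : IsControl T w) (h : CoefficientsControlled T α w B1 B2) :
    ∃ K : ℝ, 0 ≤ K ∧ ∀ s t, (s, t) ∈ simplex T →
      (∃ U, (B1 s t).Approx 2 (K * w s t ^ α) U) ∧
      (∃ Q, (B2 s t).Approx (K * w s t ^ (2 * α)) Q) := by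
  obtain ⟨K, hK⟩ := h
  refine ⟨|K|, abs_nonneg K, fun s t hst => ?_⟩
  have h0 := hw.nonneg s t hst
  have p1 := Real.rpow_nonneg h0 α
  have p2 := Real.rpow_nonneg h0 (2 * α)
  exact ⟨Op1.exists_approx (by positivity) ((hK s t hst).1.trans (ENNReal.ofReal_le_ofReal
      (mul_le_mul_of_nonneg_right (le_abs_self K) p1))),
    Op2.exists_approx (by positivity) ((hK s t hst).2.trans (ENNReal.ofReal_le_ofReal
      (mul_le_mul_of_nonneg_right (le_abs_self K) p2)))⟩

theorem isDifferentialRoughDriver_gamma {T α : ℝ} (hα : 0 < α) {w : ℝ → ℝ → ℝ}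
    {B1 : ℝ → ℝ → Op1 ι} {B2 : ℝ → ℝ → Op2 ι} (hB : IsDifferentialRoughDriver T α w B1 B2)
    (hcoef : CoefficientsControlled T α w B1 B2) :
    ∃ A : ℝ, IsDifferentialRoughDriver T α (fun s t => A * w s t) (Gamma1 B1) (Gamma2 B1 B2) := by
  obtain ⟨K, hK0, hK⟩ := hcoef.exists_pos hB.control
  set n : ℝ := (Fintype.card (ι ⊕ ι) : ℝ)
  set c1 : ℝ := (n + 1) * (mulConst (ι ⊕ ι) 3 * (K + K))
  set c2 : ℝ := (n * n + n + 1) * (mulConst (ι ⊕ ι) 3 * (2 * K + 8 * (K * K)))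
  have hmc := mulConst_nonneg (κ := ι ⊕ ι) 3
  have hn : 0 ≤ n := by positivity
  have hc1 : 0 ≤ c1 := by positivity
  have hc2 : 0 ≤ c2 := by positivity
  -- One factor has to serve both levels: `A ^ α = 1 + c1 + c2` dominates `c1`, and its square `A ^
  -- (2 * α)` dominates `c2`.
  set A : ℝ := (1 + c1 + c2) ^ α⁻¹
  have hA : 0 ≤ A := by positivity
  have hAα : A ^ α = 1 + c1 + c2 := Real.rpow_inv_rpow (by positivity) hα.ne'
  have hAα2 : c2 ≤ A ^ (2 * α) := by
    rw [mul_comm, Real.rpow_mul hA, hAα, Real.rpow_two]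
    nlinarith
  have hΓ1 : ∀ s t, Gamma1 B1 s t = (B1 s t).dbl := fun _ _ => rfl
  have hΓ2 : ∀ s t, Gamma2 B1 B2 s t = (B2 s t).dbl (B1 s t) := fun _ _ => rfl
  have hsq : ∀ s t, (s, t) ∈ simplex T → w s t ^ (2 * α) = w s t ^ α * w s t ^ α :=
    fun s t hst => by
      rw [mul_comm, Real.rpow_mul (hB.control.nonneg s t hst), Real.rpow_two, sq]
  refine ⟨A, hB.control.const_mul hA, fun s t hst => ?_, fun s t hst => ?_, fun s t hst => ?_,
    fun s t hst => ?_, ?_, ?_⟩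
  · obtain ⟨⟨U, hU⟩, -⟩ := hK s t hst
    exact hU.dbl.memD
  · obtain ⟨⟨U, hU⟩, Q, hQ⟩ := hK s t hst
    exact (hQ.dbl hU).memD
  · obtain ⟨⟨U, hU⟩, -⟩ := hK s t hst
    refine hU.dbl.opBound.mono ?_
    have h0 := hB.control.nonneg s t hst
    have := Real.rpow_nonneg h0 α
    rw [Real.mul_rpow hA h0, hAα]
    calc _ = c1 * w s t ^ α := by ring
      _ ≤ _ := mul_le_mul_of_nonneg_right (by linarith) this
  · obtain ⟨⟨U, hU⟩, Q, hQ⟩ := hK s t hst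
    refine (hQ.dbl hU).opBound.mono ?_
    have h0 := hB.control.nonneg s t hst
    have := Real.rpow_nonneg h0 (2 * α)
    rw [Real.mul_rpow hA h0]
    calc _ = c2 * w s t ^ (2 * α) := by rw [hsq s t hst]; ring
      _ ≤ _ := mul_le_mul_of_nonneg_right hAα2 this
  · intro s θ t h1 h2 h3 h4 φ
    have hφ := smooth_test φ
    have e := hB.ae_chen1 h1 h2 h3 h4
    filter_upwards [(Gamma1 B1 s t).apply_ae hφ, (Gamma1 B1 s θ).apply_ae hφ,
      (Gamma1 B1 θ t).apply_ae hφ, ae_comp_xPart e, ae_comp_yPart e] with z e1 e2 e3 e4 e5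
    simp only [Pi.sub_apply, Pi.zero_apply, e1, e2, e3]
    simp [hΓ1, Op1.cl_apply, Op1.dbl_X_inl, Op1.dbl_X_inr, Op1.dbl_Y, e4.1, e4.2, e5.1, e5.2,
      add_mul, Finset.sum_add_distrib]
    ring
  · intro s θ t h1 h2 h3 h4 φ
    have hφ := smooth_test φ
    obtain ⟨⟨U, hU⟩, -⟩ := hK s θ ⟨h1, h2, h3.trans h4⟩
    have e := hB.ae_chen1 h1 h2 h3 h4
    have e' := hB.ae_chen2 h1 h2 h3 h4 hU
    filter_upwards [(Gamma2 B1 B2 s t).apply_ae hφ, (Gamma2 B1 B2 s θ).apply_ae hφ,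
      (Gamma2 B1 B2 θ t).apply_ae hφ, ae_comp_xPart e, ae_comp_yPart e, ae_comp_xPart e',
      ae_comp_yPart e', hU.dbl.apply_apply (Gamma1 B1 θ t) φ, hU.ae_weakComp_dbl (B1 θ t)]
      with z e1 e2 e3 e4 e5 e6 e7 e8 e9
    -- Of the four terms of `(B¹_sθ + B¹_θt) ⊗ (B¹_sθ + B¹_θt)`, the two squares belong to `Γ²_sθ`
    -- and `Γ²_θt`. The two mixed ones are the cross terms of `Γ¹_θt ∘ Γ¹_sθ`.
    have key : (Gamma2 B1 B2 s t).EqAt (Gamma2 B1 B2 s θ + Gamma2 B1 B2 θ t +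
        ((B1 θ t).weakComp (B1 s θ)).onX + (B1 θ t).tensor (B1 s θ) + (B1 s θ).tensor (B1 θ t) +
        ((B1 θ t).weakComp (B1 s θ)).onY) z := by
      simp only [hΓ2]
      refine ⟨fun i j => ?_, fun i => ?_, ?_⟩
      · rcases i with i | i <;> rcases j with j | j
        · have := e6.X i j
          simp [Op2.dbl_X_inl_inl, Op2.onX, Op2.onY, Op1.tensor] at this ⊢
          linarith
        · simp [Op2.dbl_X_inl_inr, Op2.dbl_X_inr_inl, Op2.onX, Op2.onY, Op1.tensor, e4.1, e5.1]
          ring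
        · simp [Op2.dbl_X_inl_inr, Op2.dbl_X_inr_inl, Op2.onX, Op2.onY, Op1.tensor, e4.1, e5.1]
          ring
        · have := e7.X i j
          simp [Op2.dbl_X_inr_inr, Op2.onX, Op2.onY, Op1.tensor] at this ⊢
          linarith
      · rcases i with i | i
        · have := e6.Y i
          simp [Op2.dbl_Y_inl, Op2.onX, Op2.onY, Op1.tensor, e4.1, e5.2] at this ⊢
          rw [this]; ring
        · have := e7.Y i
          simp [Op2.dbl_Y_inr, Op2.onX, Op2.onY, Op1.tensor, e5.1, e4.2] at this ⊢
          rw [this]; ring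
      · have h6 := e6.Z
        have h7 := e7.Z
        simp [Op2.dbl_Z, Op2.onX, Op2.onY, Op1.tensor, e4.2, e5.2] at h6 h7 ⊢
        rw [h6, h7]; ring
    have h8 := e9.cl_eq hφ
    have h9 := key.cl_eq hφ
    simp only [Op2.add_cl, Pi.add_apply] at h8 h9
    have e8' : (Gamma1 B1 θ t).apply ((Gamma1 B1 s θ).apply φ) z =
      ((B1 θ t).dbl.weakComp (B1 s θ).dbl).cl φ z := e8
    simp only [Pi.sub_apply, e1, e2, e3, e8', h8, h9]
    ring

end

/-! ### Sequences of differential operators with regular coefficients -/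

section

/-- On smooth functions, `Q n` is a differential operator of order at most `r` whose coefficients
are regular sequences of order `m` on `S`, with bounds that sum up to at most `M`. -/
def RegOp (S : Set (Eu κ)) (r m : ℕ) (M : ℝ) (Q : ℕ → (Eu κ → ℝ) → Eu κ → ℝ) : Prop :=
  ∃ (A : Type) (_ : Fintype A) (w : A → Σ j : ℕ, (Fin j → κ)) (N : A → ℝ)
    (c : A → ℕ → Eu κ → ℝ), (∀ a, (w a).1 ≤ r) ∧ (∀ a, 0 ≤ N a) ∧ ∑ a, N a ≤ M ∧
    (∀ a, Reg S m (N a) (c a)) ∧ ∀ n f, Smooth f → Q n f = ∑ a, c a n * pd (w a).2 f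

variable {S : Set (Eu κ)} {r r' m m' : ℕ} {M M' N : ℝ} {Q R : ℕ → (Eu κ → ℝ) → Eu κ → ℝ}

theorem RegOp.of_le (h : RegOp S r m M Q) (hr : r ≤ r') (hm : m' ≤ m) (hM : M ≤ M') :
    RegOp S r' m' M' Q := by
  obtain ⟨A, _, w, N, c, h1, h2, h3, h4, h5⟩ := h
  exact ⟨A, _, w, N, c, fun a => (h1 a).trans hr, h2, h3.trans hM,
    fun a => (h4 a).of_le hm le_rfl subset_rfl, h5⟩

theorem RegOp.congr (h : RegOp S r m M Q) (hR : ∀ n f, Smooth f → R n f = Q n f) :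
    RegOp S r m M R := by
  obtain ⟨A, _, w, N, c, h1, h2, h3, h4, h5⟩ := h
  exact ⟨A, _, w, N, c, h1, h2, h3, h4, fun n f hf => (hR n f hf).trans (h5 n f hf)⟩

theorem RegOp.nonneg (h : RegOp S r m M Q) : 0 ≤ M := by
  obtain ⟨A, _, w, N, c, h1, h2, h3, h4, h5⟩ := h
  exact (Finset.sum_nonneg fun a _ => h2 a).trans h3

theorem RegOp.single {c : ℕ → Eu κ → ℝ} (hM : 0 ≤ M) (hc : Reg S m M c) {j : ℕ} (hj : j ≤ r)
    (s : Fin j → κ) : RegOp S r m M (fun n f => c n * pd s f) :=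
  ⟨Unit, inferInstance, fun _ => ⟨j, s⟩, fun _ => M, fun _ => c, fun _ => hj, fun _ => hM,
    by simp, fun _ => hc, by simp⟩

theorem RegOp.zero (S : Set (Eu κ)) (r m : ℕ) : RegOp S r m 0 (fun _ _ => 0) :=
  ⟨Empty, inferInstance, fun a => a.elim, fun a => a.elim, fun a => a.elim, fun a => a.elim,
    fun a => a.elim, by simp, fun a => a.elim, by simp⟩

theorem RegOp.add (h : RegOp S r m M Q) (h' : RegOp S r m M' R) :
    RegOp S r m (M + M') (fun n f => Q n f + R n f) := by
  obtain ⟨A, _, w, N, c, h1, h2, h3, h4, h5⟩ := h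
  obtain ⟨A', _, w', N', c', h1', h2', h3', h4', h5'⟩ := h'
  refine ⟨A ⊕ A', inferInstance, Sum.elim w w', Sum.elim N N', Sum.elim c c', ?_, ?_, ?_, ?_, ?_⟩
  · rintro (a | a); exacts [h1 a, h1' a]
  · rintro (a | a); exacts [h2 a, h2' a]
  · simpa using add_le_add h3 h3'
  · rintro (a | a); exacts [h4 a, h4' a]
  · intro n f hf
    simp [h5 n f hf, h5' n f hf]

theorem RegOp.sum {α : Type*} {t : Finset α} {M : α → ℝ} {Q : α → ℕ → (Eu κ → ℝ) → Eu κ → ℝ}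
    (h : ∀ a ∈ t, RegOp S r m (M a) (Q a)) :
    RegOp S r m (∑ a ∈ t, M a) (fun n f => ∑ a ∈ t, Q a n f) := by
  classical
  induction t using Finset.induction_on with
  | empty => simpa using RegOp.zero S r m
  | insert c t hc ih =>
    simp_rw [Finset.sum_insert hc]
    exact (h c (Finset.mem_insert_self c t)).add (ih fun d hd => h d (Finset.mem_insert_of_mem hd))

theorem RegOp.mul_left {u : ℕ → Eu κ → ℝ} (hN : 0 ≤ N) (hu : Reg S m N u) (h : RegOp S r m M Q) :
    RegOp S r m (2 ^ m * (N * M)) (fun n f => u n * Q n f) := by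
  obtain ⟨A, _, w, N', c, h1, h2, h3, h4, h5⟩ := h
  refine ⟨A, inferInstance, w, fun a => 2 ^ m * (N * N' a), fun a n => u n * c a n, h1, fun a => ?_, ?_,
    fun a => hu.mul (h4 a), fun n f hf => ?_⟩
  · have := h2 a; positivity
  · rw [← Finset.mul_sum, ← Finset.mul_sum]; gcongr
  · simp only [h5 n f hf, Finset.mul_sum, mul_assoc]

theorem RegOp.smul (h : RegOp S r m M Q) (b : ℝ) :
    RegOp S r m (|b| * M) (fun n f => b • Q n f) := by
  obtain ⟨A, _, w, N', c, h1, h2, h3, h4, h5⟩ := h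
  refine ⟨A, inferInstance, w, fun a => |b| * N' a, fun a n => b • c a n, h1, fun a => ?_, ?_,
    fun a => (h4 a).smul b, fun n f hf => ?_⟩
  · have := h2 a; positivity
  · rw [← Finset.mul_sum]; gcongr
  · simp only [h5 n f hf, Finset.smul_sum, smul_mul_assoc]

theorem RegOp.smooth (h : RegOp S r m M Q) (n : ℕ) {f : Eu κ → ℝ} (hf : Smooth f) :
    Smooth (Q n f) := by
  obtain ⟨A, _, w, N', c, h1, h2, h3, h4, h5⟩ := h
  rw [h5 n f hf]
  exact Smooth.sum fun a _ => ((h4 a).smooth n).mul (hf.pd _)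

/-- The derivative falls either on a coefficient, which loses one order of regularity, or on the
function, which raises the order of the operator. Each family keeps the total bound `M`, hence the
factor two. -/
theorem RegOp.pd1_apply (h : RegOp S r (m + 1) M Q) (i : κ) :
    RegOp S (r + 1) m (2 * M) (fun n f => pd1 i (Q n f)) := by
  obtain ⟨A, _, w, N', c, h1, h2, h3, h4, h5⟩ := h
  have e1 : RegOp S (r + 1) m M (fun n f => ∑ a, RoughDriver.pd1 i (c a n) * pd (w a).2 f) :=
    ⟨A, _, w, N', fun a n => RoughDriver.pd1 i (c a n), fun a => (h1 a).trans (Nat.le_succ r), h2,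
      h3, fun a => (h4 a).pd1 i, fun _ _ _ => rfl⟩
  have e2 : RegOp S (r + 1) m M
      (fun n f => ∑ a, c a n * pd (Fin.cons i (w a).2 : Fin ((w a).1 + 1) → κ) f) :=
    ⟨A, _, fun a => ⟨(w a).1 + 1, Fin.cons i (w a).2⟩, N', c, fun a => Nat.succ_le_succ (h1 a), h2,
      h3, fun a => (h4 a).of_le (Nat.le_succ m) le_rfl subset_rfl, fun _ _ _ => rfl⟩
  rw [two_mul]
  refine (e1.add e2).congr fun n f hf => ?_
  rw [h5 n f hf, pd1_sum _ fun a _ => ((h4 a).smooth n).mul (hf.pd _), ← Finset.sum_add_distrib]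
  refine Finset.sum_congr rfl fun a _ => ?_
  rw [pd1_mul ((h4 a).smooth n) (hf.pd _), pd_succ, Fin.cons_zero, Fin.tail_cons]

theorem RegOp.pd_apply {j : ℕ} (h : RegOp S r (m + j) M Q) (s : Fin j → κ) :
    RegOp S (r + j) m (2 ^ j * M) (fun n f => pd s (Q n f)) := by
  induction j generalizing m with
  | zero => simpa using h
  | succ j ih =>
    have := (ih (m := m + 1) (by rwa [add_assoc, add_comm 1 j]) (Fin.tail s)).pd1_apply (s 0)
    rw [pow_succ', mul_assoc]
    exact this

/-- The coefficients of `R` must withstand the `r` derivatives of `Q`, hence the order `m + r`. The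
factor `2 ^ r` comes from these derivatives, `2 ^ m` from the products of coefficients. -/
theorem RegOp.comp (h : RegOp S r m M Q) (h' : RegOp S r' (m + r) M' R) :
    RegOp S (r + r') m (2 ^ m * (M * (2 ^ r * M'))) (fun n f => Q n (R n f)) := by
  have hM' := h'.nonneg
  have hR := fun n f (hf : Smooth f) => h'.smooth n hf
  obtain ⟨A, _, w, N', c, h1, h2, h3, h4, h5⟩ := h
  have e : RegOp S (r + r') m (∑ a, 2 ^ m * (N' a * (2 ^ r * M')))
      (fun n f => ∑ a, c a n * RoughDriver.pd (w a).2 (R n f)) := by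
    refine RegOp.sum fun a _ => RegOp.mul_left (h2 a) (h4 a) ?_
    refine ((h'.of_le le_rfl (Nat.add_le_add_left (h1 a) m) le_rfl).pd_apply (w a).2).of_le ?_ le_rfl ?_
    · have := h1 a; omega
    · exact mul_le_mul_of_nonneg_right (pow_le_pow_right₀ (by norm_num) (h1 a)) hM'
  refine (e.of_le le_rfl le_rfl ?_).congr fun n f hf => h5 n _ (hR n f hf)
  rw [← Finset.mul_sum, ← Finset.sum_mul]
  gcongr

theorem RegOp.tsupport_subset (h : RegOp S r m M Q) (n : ℕ) {f : Eu κ → ℝ} (hf : Smooth f) :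
    tsupport (Q n f) ⊆ tsupport f := by
  obtain ⟨A, _, w, N', c, h1, h2, h3, h4, h5⟩ := h
  rw [h5 n f hf]
  refine closure_minimal (fun x hx => ?_) (isClosed_tsupport f)
  by_contra hxf
  refine hx ?_
  rw [Finset.sum_apply]
  refine Finset.sum_eq_zero fun a _ => ?_
  have : RoughDriver.pd (w a).2 f x = 0 :=
    image_eq_zero_of_notMem_tsupport fun h => hxf (tsupport_pd_subset _ f h)
  simp [this]

/-- `Q n` maps test functions to test functions. -/
def RegOp.test {O : Opens (Eu κ)} (h : RegOp S r m M Q) (n : ℕ) (φ : 𝓓(O, ℝ)) : 𝓓(O, ℝ) :=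
  mkTest (Q n φ) (h.smooth n (smooth_test φ))
    (φ.hasCompactSupport.of_isClosed_subset (isClosed_tsupport _)
      (h.tsupport_subset n (smooth_test φ)))
    ((h.tsupport_subset n (smooth_test φ)).trans φ.tsupport_subset)

@[simp] theorem RegOp.coe_test {O : Opens (Eu κ)} (h : RegOp S r m M Q) (n : ℕ) (φ : 𝓓(O, ℝ)) :
    (h.test n φ : Eu κ → ℝ) = Q n φ := rfl

theorem RegOp.reg_apply {O : Opens (Eu κ)} (h : RegOp S r m M Q) (φ : 𝓓(O, ℝ)) :
    ∃ C, Reg S m C (fun n => Q n φ) := by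
  obtain ⟨A, _, w, N', c, h1, h2, h3, h4, h5⟩ := h
  have : ∀ a, ∃ C, Reg S m C (fun n => c a n * RoughDriver.pd (w a).2 φ) := fun a => by
    have hs := (smooth_test φ).pd (w a).2
    obtain ⟨C, -, hC⟩ := exists_jet_le hs (HasCompactSupport.pd φ.hasCompactSupport (w a).2) m
    exact ⟨_, (h4 a).mul (Reg.fixed hs fun x _ => hC x)⟩
  choose C hC using this
  simp_rw [h5 _ _ (smooth_test φ)]
  exact ⟨_, Reg.sum fun a _ => hC a⟩

end

/-! ### Operators on Sobolev spaces of negative order -/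

section

theorem exists_isAntideriv {O : Opens (Eu κ)} {m : ℕ} (f : Antideriv κ m)
    (hf : ∀ j s, IntegrableOn (f j s) O) : ∃ v : 𝓓'(O, ℝ), IsAntideriv v f := by
  let L : 𝓓(O, ℝ) →L[ℝ] ℝ := ∑ j : Fin (m + 1), ∑ s : Fin j → κ, ((-1 : ℝ) ^ (j : ℕ)) •
    (TestFunction.integralAgainstBilinCLM (ContinuousLinearMap.mul ℝ ℝ)
      (volume.restrict (O : Set (Eu κ))) (f j s)).comp
      (LineDeriv.iteratedLineDerivOpCLM ℝ 𝓓(O, ℝ) (dirs s))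
  refine ⟨L, hf, fun φ => ?_⟩
  have hL : L φ = ∑ j : Fin (m + 1), ∑ s : Fin j → κ,
      (-1) ^ (j : ℕ) * ∫ x in O, f j s x * (∂^{dirs s} φ) x := by
    simp only [L, sum_apply, smul_apply, smul_eq_mul,
      ContinuousLinearMap.comp_apply, LineDeriv.iteratedLineDerivOpCLM_apply]
    refine Finset.sum_congr rfl fun j _ => Finset.sum_congr rfl fun s _ => ?_
    rw [TestFunction.integralAgainstBilinCLM_eq_integral
      ((hf j s).locallyIntegrable.locallyIntegrableOn _)]
    simp [mul_comm]
  exact hL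

theorem sum_words {r : ℕ} {A : Type*} [AddCommMonoid A]
    (G : (j : Fin (r + 1)) → (Fin j → κ) → A) :
    ∑ j, ∑ s, G j s = ∑ q : Σ j : Fin (r + 1), (Fin j → κ), G q.1 q.2 :=
  (Fintype.sum_sigma fun q : Σ j : Fin (r + 1), (Fin j → κ) => G q.1 q.2).symm

/-- Terms belonging to the same derivative can be collected. -/
theorem exists_collect {O : Opens (Eu κ)} {r : ℕ} {A : Type} [Fintype A]
    (w : A → Σ j : ℕ, (Fin j → κ)) (hw : ∀ a, (w a).1 ≤ r) (g : A → Eu κ → ℝ)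
    (hg : ∀ a, IntegrableOn (g a) O) :
    ∃ F : Antideriv κ r, (∀ j s, IntegrableOn (F j s) O) ∧
      (∀ Φ : 𝓓(O, ℝ), ∑ j : Fin (r + 1), ∑ s : Fin j → κ,
        (-1) ^ (j : ℕ) * ∫ x in O, F j s x * pd s Φ x = ∑ a, ∫ x in O, g a x * pd (w a).2 Φ x) ∧
      ∑ j : Fin (r + 1), ∑ s : Fin j → κ, ∫⁻ x in O, ‖F j s x‖ₑ ≤ ∑ a, ∫⁻ x in O, ‖g a x‖ₑ := by
  let p : A → Σ j : Fin (r + 1), (Fin j → κ) := fun a =>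
    ⟨⟨(w a).1, Nat.lt_succ_of_le (hw a)⟩, (w a).2⟩
  -- The sign is chosen to cancel the `(-1) ^ j` of the pairing.
  let F : Antideriv κ r := fun j s x =>
    (-1) ^ (j : ℕ) * ∑ a with p a = ⟨j, s⟩, g a x
  have hgΦ : ∀ (Φ : 𝓓(O, ℝ)) a, Integrable (fun x => g a x * pd (w a).2 Φ x)
      (volume.restrict (O : Set (Eu κ))) := fun Φ a => by
    obtain ⟨C, -, hC⟩ := exists_jet_le ((smooth_test Φ).pd (w a).2)
      (HasCompactSupport.pd Φ.hasCompactSupport (w a).2) 0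
    exact (hg a).mul_bdd (c := C) ((smooth_test Φ).pd _).continuous.aestronglyMeasurable
      (Eventually.of_forall fun x => hC x)
  refine ⟨F, fun j s => ?_, fun Φ => ?_, ?_⟩
  · exact (integrable_finsetSum _ fun a _ => hg a).const_mul _
  · rw [sum_words fun j s => (-1) ^ (j : ℕ) * ∫ x in O, F j s x * pd s Φ x,
      ← Finset.sum_fiberwise Finset.univ p fun a => ∫ x in O, g a x * pd (w a).2 Φ x]
    refine Finset.sum_congr rfl fun q _ => ?_
    obtain ⟨j, s⟩ := q
    rw [← integral_finsetSum _ fun a _ => hgΦ Φ a, ← integral_const_mul]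
    congr 1
    funext x
    have e : ((-1 : ℝ) ^ (j : ℕ)) * (-1) ^ (j : ℕ) = 1 := by
      rw [← mul_pow]; simp
    simp only [F]
    rw [← mul_assoc, ← mul_assoc, e, one_mul, Finset.sum_mul]
    refine Finset.sum_congr rfl fun a ha => ?_
    have ha' : p a = ⟨j, s⟩ := (Finset.mem_filter.1 ha).2
    have : ∀ q : Σ j : Fin (r + 1), (Fin j → κ), p a = q → pd (w a).2 Φ x = pd q.2 Φ x := by
      rintro q rfl; rfl
    rw [this _ ha']
  · rw [sum_words fun j s => ∫⁻ x in O, ‖F j s x‖ₑ,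
      ← Finset.sum_fiberwise Finset.univ p fun a => ∫⁻ x in O, ‖g a x‖ₑ]
    refine Finset.sum_le_sum fun q _ => ?_
    obtain ⟨j, s⟩ := q
    rw [← lintegral_finsetSum' _ fun a _ => (hg a).aestronglyMeasurable.enorm]
    refine lintegral_mono fun x => ?_
    simp only [F]
    rw [enorm_mul]
    have : ‖((-1 : ℝ) ^ (j : ℕ))‖ₑ = 1 := by simp [enorm_pow]
    rw [this, one_mul]
    exact enorm_sum_le _ _

variable {S : Set (Eu κ)} {i m : ℕ} {M : ℝ} {Q : ℕ → (Eu κ → ℝ) → Eu κ → ℝ}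
  {Padj : (Eu κ → ℝ) → Eu κ → ℝ} {O : Opens (Eu κ)}

theorem RegOp.tendsto_integral (h : RegOp S i m M Q) (hO : (O : Set (Eu κ)) ⊆ S) (Φ : 𝓓(O, ℝ))
    (hΦ : ∀ᵐ x ∂volume.restrict (O : Set (Eu κ)),
      Tendsto (fun n => Q n Φ x) atTop (𝓝 (Padj Φ x))) {f : Eu κ → ℝ} (hf : IntegrableOn f O)
    {j : ℕ} (hj : j ≤ m) (s : Fin j → κ) :
    Tendsto (fun n => ∫ x in O, f x * pd s (Q n Φ) x) atTop
      (𝓝 (∫ x in O, f x * weakDeriv O s (Padj Φ) x)) := by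
  obtain ⟨C, hC⟩ := h.reg_apply Φ
  have hw := (hC.hasWeakDeriv hO hj s hΦ).weakDeriv_ae
  refine tendsto_integral_of_dominated_convergence (fun x => ‖f x‖ * C)
    (fun n => hf.aestronglyMeasurable.mul ((hC.smooth n).pd s).continuous.aestronglyMeasurable)
    (hf.norm.mul_const C) (fun n => ?_) ?_
  · filter_upwards [ae_restrict_mem O.isOpen.measurableSet] with x hx
    rw [norm_mul]
    exact mul_le_mul_of_nonneg_left ((abs_pd_le_jet (hC.smooth n) s x).trans
      ((jet_mono hj _ _).trans (hC.bound n x (hO hx)))) (norm_nonneg _)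
  · filter_upwards [hw, ae_restrict_of_ae (hC.tendsto_limD hj s)] with x h1 h2
    rw [h1]
    exact h2.const_mul _

theorem RegOp.tendsto_pairing (h : RegOp S i m M Q) (hO : (O : Set (Eu κ)) ⊆ S) (Φ : 𝓓(O, ℝ))
    (hΦ : ∀ᵐ x ∂volume.restrict (O : Set (Eu κ)),
      Tendsto (fun n => Q n Φ x) atTop (𝓝 (Padj Φ x))) {f : Antideriv κ m} {v : 𝓓'(O, ℝ)}
    (hf : IsAntideriv v f) :
    Tendsto (fun n => v (h.test n Φ)) atTop (𝓝 (pairing O f (Padj Φ))) := by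
  simp only [hf.2, coe_iteratedLineDerivOp, RegOp.coe_test]
  exact tendsto_finsetSum _ fun j _ => tendsto_finsetSum _ fun s _ =>
    (h.tendsto_integral hO Φ hΦ (hf.1 j s) (Nat.lt_succ_iff.1 j.2) s).const_mul _

/-- Expanding `∂_s (Q n Φ)` as a sum of terms `c * ∂_w Φ` turns the pairing with `f` into pairings
of the functions `f * c` with derivatives of `Φ`. In the limit the products of `f` with the limiting
coefficients are the antiderivatives of the image. Their `L¹`-norms cost the essential bounds of the
coefficients. -/
theorem RegOp.exists_antideriv_image (h : RegOp S i m M Q) (hO : (O : Set (Eu κ)) ⊆ S)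
    (hlim : ∀ Φ : 𝓓(O, ℝ), ∀ᵐ x ∂volume.restrict (O : Set (Eu κ)),
      Tendsto (fun n => Q n Φ x) atTop (𝓝 (Padj Φ x)))
    {f : Antideriv κ m} (hf : ∀ j s, IntegrableOn (f j s) O) :
    ∃ F : Antideriv κ (m + i), (∀ j s, IntegrableOn (F j s) O) ∧
      (∀ Φ : 𝓓(O, ℝ), pairing O f (Padj Φ) = ∑ j : Fin (m + i + 1), ∑ s : Fin j → κ,
        (-1) ^ (j : ℕ) * ∫ x in O, F j s x * pd s Φ x) ∧
      ∑ j : Fin (m + i + 1), ∑ s : Fin j → κ, ∫⁻ x in O, ‖F j s x‖ₑ ≤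
        ENNReal.ofReal (2 ^ m * M) * ∑ j : Fin (m + 1), ∑ s : Fin j → κ, ∫⁻ x in O, ‖f j s x‖ₑ := by
  -- The at most `m` derivatives of the pairing use up the regularity of the coefficients. Only
  -- boundedness and almost everywhere convergence remain, which is all that is needed.
  have key : ∀ q : Σ j : Fin (m + 1), (Fin j → κ),
      RegOp S (m + i) 0 (2 ^ m * M) (fun n f => pd q.2 (Q n f)) := by
    rintro ⟨j, s⟩
    have hj := Nat.lt_succ_iff.1 j.2
    refine ((h.of_le le_rfl (m' := 0 + j) (by omega) le_rfl).pd_apply s).of_le (by omega) le_rfl ?_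
    exact mul_le_mul_of_nonneg_right (pow_le_pow_right₀ (by norm_num) hj) h.nonneg
  choose A hA w N c h1 h2 h3 h4 h5 using key
  let cl : ∀ q, A q → Eu κ → ℝ := fun q a => limD (κ := κ) Fin.elim0 (c q a)
  have hcl : ∀ q a, LimAE (c q a) (cl q a) := fun q a => (h4 q a).tendsto_limD le_rfl Fin.elim0
  have hbd : ∀ q a, ∀ᵐ x ∂volume.restrict (O : Set (Eu κ)), ‖cl q a x‖ ≤ N q a := fun q a => by
    filter_upwards [ae_restrict_of_ae ((h4 q a).abs_limD_le le_rfl Fin.elim0),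
      ae_restrict_mem O.isOpen.measurableSet] with x hx hxO using hx (hO hxO)
  have hmeas : ∀ q a, AEStronglyMeasurable (cl q a) (volume.restrict (O : Set (Eu κ))) :=
    fun q a => ((hcl q a).aestronglyMeasurable (h4 q a).smooth).restrict
  let g : (Σ q, A q) → Eu κ → ℝ := fun b x =>
    (-1) ^ (b.1.1 : ℕ) * (f b.1.1 b.1.2 x * cl b.1 b.2 x)
  have hg : ∀ b, IntegrableOn (g b) O := fun b =>
    ((hf b.1.1 b.1.2).mul_bdd (hmeas b.1 b.2) (hbd b.1 b.2)).const_mul _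
  obtain ⟨F, hF1, hF2, hF3⟩ := exists_collect (fun b : Σ q, A q => w b.1 b.2)
    (fun b => h1 b.1 b.2) g hg
  refine ⟨F, hF1, fun Φ => ?_, hF3.trans ?_⟩
  · rw [hF2 Φ, Fintype.sum_sigma]
    have : pairing O f (Padj Φ) = ∑ q : Σ j : Fin (m + 1), (Fin j → κ),
        (-1) ^ (q.1 : ℕ) * ∫ x in O, f q.1 q.2 x * weakDeriv O q.2 (Padj Φ) x := by
      rw [pairing, sum_words fun j s => (-1) ^ (j : ℕ) * ∫ x in O, f j s x * weakDeriv O s (Padj Φ) x]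
    rw [this]
    refine Finset.sum_congr rfl fun q _ => ?_
    have t1 := h.tendsto_integral hO Φ (hlim Φ) (hf q.1 q.2) (Nat.lt_succ_iff.1 q.1.2) q.2
    have t2 : Tendsto (fun n => ∫ x in O, f q.1 q.2 x * pd q.2 (Q n Φ) x) atTop
        (𝓝 (∑ a, ∫ x in O, f q.1 q.2 x * cl q a x * pd (w q a).2 Φ x)) := by
      have hb : ∀ a, ∃ C, ∀ x, |pd (w q a).2 Φ x| ≤ C := fun a => by
        obtain ⟨C, -, hC⟩ := exists_jet_le ((smooth_test Φ).pd (w q a).2)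
          (HasCompactSupport.pd Φ.hasCompactSupport (w q a).2) 0
        exact ⟨C, fun x => hC x⟩
      choose C hC using hb
      have hm : ∀ a, AEStronglyMeasurable (pd (w q a).2 (Φ : Eu κ → ℝ))
          (volume.restrict (O : Set (Eu κ))) := fun a =>
        ((smooth_test Φ).pd _).continuous.aestronglyMeasurable
      have hint : ∀ (a : A q) (u : Eu κ → ℝ),
          AEStronglyMeasurable u (volume.restrict (O : Set (Eu κ))) →
          (∀ᵐ x ∂volume.restrict (O : Set (Eu κ)), ‖u x‖ ≤ N q a) →
          IntegrableOn (fun x => f q.1 q.2 x * u x * pd (w q a).2 Φ x) O := fun a u hu hu' =>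
        ((hf q.1 q.2).mul_bdd hu hu').mul_bdd (hm a) (Eventually.of_forall fun x => hC a x)
      have hcn : ∀ a n, ∀ᵐ x ∂volume.restrict (O : Set (Eu κ)), ‖c q a n x‖ ≤ N q a :=
        fun a n => by
          filter_upwards [ae_restrict_mem O.isOpen.measurableSet] with x hx
          exact (h4 q a).bound n x (hO hx)
      have e : ∀ n, ∫ x in O, f q.1 q.2 x * pd q.2 (Q n Φ) x =
          ∑ a, ∫ x in O, f q.1 q.2 x * c q a n x * pd (w q a).2 Φ x := fun n => by
        rw [← integral_finsetSum _ fun a _ =>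
          hint a _ ((h4 q a).smooth n).continuous.aestronglyMeasurable (hcn a n)]
        congr 1
        funext x
        have e' : pd q.2 (Q n Φ) = _ := h5 q n Φ (smooth_test Φ)
        rw [e', Finset.sum_apply, Finset.mul_sum]
        simp only [Pi.mul_apply, mul_assoc]
      simp_rw [e]
      refine tendsto_finsetSum _ fun a _ => ?_
      refine tendsto_integral_of_dominated_convergence (fun x => ‖f q.1 q.2 x‖ * N q a * C a)
        (fun n => (hint a _ ((h4 q a).smooth n).continuous.aestronglyMeasurable
          (hcn a n)).aestronglyMeasurable) (((hf q.1 q.2).norm.mul_const _).mul_const _)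
        (fun n => ?_) ?_
      · filter_upwards [hcn a n] with x hx
        rw [norm_mul, norm_mul]
        have := h2 q a
        exact mul_le_mul (mul_le_mul_of_nonneg_left hx (norm_nonneg _)) (hC a x) (norm_nonneg _)
          (by positivity)
      · filter_upwards [ae_restrict_of_ae (hcl q a)] with x hx
        exact (hx.const_mul _).mul_const _
    rw [tendsto_nhds_unique t1 t2, Finset.mul_sum]
    refine Finset.sum_congr rfl fun a _ => ?_
    rw [← integral_const_mul]
    congr 1
    funext x
    simp only [g]
    ring
  · rw [Fintype.sum_sigma, sum_words fun j s => ∫⁻ x in O, ‖f j s x‖ₑ,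
      Finset.mul_sum]
    refine Finset.sum_le_sum fun q _ => ?_
    have e : ∀ a, ∫⁻ x in O, ‖g ⟨q, a⟩ x‖ₑ ≤
        ENNReal.ofReal (N q a) * ∫⁻ x in O, ‖f q.1 q.2 x‖ₑ := fun a => by
      rw [← lintegral_const_mul' _ _ ENNReal.ofReal_ne_top]
      refine lintegral_mono_ae ?_
      filter_upwards [hbd q a] with x hx
      have e1 : ‖((-1 : ℝ) ^ (q.1 : ℕ))‖ₑ = 1 := by simp [enorm_pow]
      simp only [g]
      rw [enorm_mul, e1, one_mul, enorm_mul, mul_comm]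
      refine mul_le_mul' ?_ le_rfl
      rw [← ofReal_norm]
      exact ENNReal.ofReal_le_ofReal hx
    refine (Finset.sum_le_sum fun a _ => e a).trans ?_
    rw [← Finset.sum_mul, ← ENNReal.ofReal_sum_of_nonneg fun a _ => h2 q a]
    exact mul_le_mul' (ENNReal.ofReal_le_ofReal (h3 q)) le_rfl

/-- The pairing does not depend on the antiderivative of `v`, being the limit of `v` on the test
functions `Q n Φ` whichever one is used. The image is therefore well defined, and the norm bound
follows by taking the infimum over all antiderivatives. -/
theorem RegOp.negOpBound (h : RegOp S i m M Q) (hO : (O : Set (Eu κ)) ⊆ S)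
    (hlim : ∀ Φ : 𝓓(O, ℝ), ∀ᵐ x ∂volume.restrict (O : Set (Eu κ)),
      Tendsto (fun n => Q n Φ x) atTop (𝓝 (Padj Φ x))) :
    NegOpBound O m i Padj (2 ^ m * M) := by
  intro v hv
  obtain ⟨f₀, hf₀⟩ : ∃ f : Antideriv κ m, IsAntideriv v f := by
    by_contra hne
    push Not at hne
    have : negNorm m v = ⊤ := by
      refine iInf_eq_top.2 fun f => iInf_eq_top.2 fun hf => (hne f hf).elim
    exact hv.ne this
  obtain ⟨F₀, hF₀, hF₀', -⟩ := h.exists_antideriv_image hO hlim hf₀.1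
  obtain ⟨w, hw⟩ := exists_isAntideriv F₀ hF₀
  have himg : IsImage m Padj v w := by
    intro f hf Φ
    have e : w Φ = pairing O f₀ (Padj Φ) := by
      rw [hw.2, hF₀']
      simp only [coe_iteratedLineDerivOp]
    rw [e]
    exact tendsto_nhds_unique (h.tendsto_pairing hO Φ (hlim Φ) hf₀)
      (h.tendsto_pairing hO Φ (hlim Φ) hf)
  refine ⟨w, himg, ?_⟩
  have hb : ∀ f : {f : Antideriv κ m // IsAntideriv v f}, negNorm (m + i) w ≤
      ENNReal.ofReal (2 ^ m * M) *
        ∑ j : Fin (m + 1), ∑ s : Fin j → κ, ∫⁻ x in O, ‖f.1 j s x‖ₑ := by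
    rintro ⟨f, hf⟩
    obtain ⟨F, hF1, hF2, hF3⟩ := h.exists_antideriv_image hO hlim hf.1
    refine le_trans (iInf₂_le F ⟨hF1, fun Φ => ?_⟩) hF3
    rw [himg f hf Φ, hF2 Φ]
    simp only [coe_iteratedLineDerivOp]
  have : Nonempty {f : Antideriv κ m // IsAntideriv v f} := ⟨⟨f₀, hf₀⟩⟩
  have e : negNorm m v = ⨅ f : {f : Antideriv κ m // IsAntideriv v f},
      ∑ j : Fin (m + 1), ∑ s : Fin j → κ, ∫⁻ x in O, ‖f.1 j s x‖ₑ := by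
    rw [negNorm, iInf_subtype']
  rw [e, ENNReal.mul_iInf' (fun h => (ENNReal.ofReal_ne_top h).elim)
    fun _ => inferInstance]
  exact le_iInf hb

end

/-! ### Local bounds on coefficients by operator norms -/

section

/-- Lebesgue measure on the ball of radius `R`. -/
def ballMeasure (κ : Type) [Fintype κ] (R : ℕ) : Measure (Eu κ) :=
  volume.restrict (Metric.ball (0 : Eu κ) (R + 1))

instance (R : ℕ) : IsFiniteMeasure (ballMeasure κ R) :=
  ⟨by rw [ballMeasure, Measure.restrict_apply_univ]; exact measure_ball_lt_top⟩

theorem ae_of_ae_ballMeasure {p : Eu κ → Prop} (h : ∀ R, ∀ᵐ x ∂ballMeasure κ R, p x) :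
    ∀ᵐ x, p x := by
  have h' : ∀ᵐ x, ∀ R : ℕ, x ∈ Metric.ball (0 : Eu κ) (R + 1) → p x := ae_all_iff.2 fun R =>
    (ae_restrict_iff' Metric.isOpen_ball.measurableSet).1 (h R)
  filter_upwards [h'] with x hx
  obtain ⟨R, hR⟩ := exists_nat_gt ‖x‖
  exact hx R (by simp; linarith)

theorem ae_ballMeasure {p : Eu κ → Prop} (h : ∀ᵐ x, p x) (R : ℕ) : ∀ᵐ x ∂ballMeasure κ R, p x :=
  ae_restrict_of_ae h

/-- This is the bound at `k = i`, the order for which the target space is `L²`. -/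
theorem eLpNorm_le_of_opBound {i : ℕ} (hi : i ≤ 3) {F : (Eu κ → ℝ) → Eu κ → ℝ} {η : ℝ}
    (h : OpBound i F η) (φ : 𝓓((⊤ : Opens (Eu κ)), ℝ)) :
    AEStronglyMeasurable (F φ) ∧
      eLpNorm (F φ) 2 volume ≤ ENNReal.ofReal η * sobNorm ⊤ i 2 (φ : Eu κ → ℝ) := by
  have h1 := h i (by omega) (by omega) φ
  rw [sub_self] at h1
  have h2 : sobNorm ⊤ 0 2 (F φ) ≤ ENNReal.ofReal η * sobNorm ⊤ i 2 (φ : Eu κ → ℝ) := h1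
  have h3 : sobNorm ⊤ 0 2 (F φ) ≠ ⊤ :=
    (h2.trans_lt (ENNReal.mul_lt_top ENNReal.ofReal_lt_top
      (sobNorm_test_ne_top φ i 2).lt_top)).ne
  exact ⟨(locallyIntegrable_of_sobNorm_ne_top h3).aestronglyMeasurable,
    eLpNorm_le_sobNorm.trans h2⟩

theorem eLpNorm_coord_mul_le (j : κ) (R : ℕ) (g : Eu κ → ℝ) :
    eLpNorm ((fun x : Eu κ => x j) * g) 2 (ballMeasure κ R) ≤
      ENNReal.ofReal (R + 1) * eLpNorm g 2 (ballMeasure κ R) := by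
  refine eLpNorm_le_mul_eLpNorm_of_ae_le_mul ?_ 2
  filter_upwards [ae_restrict_mem Metric.isOpen_ball.measurableSet] with x hx
  rw [Pi.mul_apply, norm_mul]
  have h1 : ‖x j‖ ≤ ‖x‖ := PiLp.norm_apply_le x j
  have h2 : ‖x‖ < R + 1 := by simpa using hx
  gcongr
  linarith

theorem aestronglyMeasurable_coord (j : κ) (R : ℕ) :
    AEStronglyMeasurable (fun x : Eu κ => x j) (ballMeasure κ R) :=
  (smooth_coord j).continuous.aestronglyMeasurable

/-- With `χ` equal to one on the ball, the symmetric coefficient is there `F (x i x j χ) - x j F (x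
i χ) - x i F (x j χ) + x i x j F χ`, and each term is bounded from `H²` to `L²`. The constant does
not depend on the operator, so convergence in operator norm yields local `L²` convergence. The
separate `F` accommodates Riemann sums, which are not literally of the form `P.apply`. -/
theorem exists_eLpNorm_symX_le (i j : κ) (R : ℕ) : ∃ C : ℝ≥0∞, C ≠ ⊤ ∧
    ∀ (P : Op2 κ) (F : (Eu κ → ℝ) → Eu κ → ℝ) (η : ℝ), OpBound 2 F η →
      (∀ φ : 𝓓((⊤ : Opens (Eu κ)), ℝ), F φ =ᵐ[volume] P.cl φ) →
      AEStronglyMeasurable (P.X i j + P.X j i) (ballMeasure κ R) ∧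
      eLpNorm (P.X i j + P.X j i) 2 (ballMeasure κ R) ≤ ENNReal.ofReal η * C := by
  obtain ⟨χ, hχ⟩ := exists_cutoff (κ := κ) R
  let φ0 := χ
  let φi := RoughDriver.mulTest _ (smooth_coord i) χ
  let φj := RoughDriver.mulTest _ (smooth_coord j) χ
  let φij := RoughDriver.mulTest _ ((smooth_coord i).mul (smooth_coord j)) χ
  let r := ENNReal.ofReal (R + 1)
  let n : 𝓓((⊤ : Opens (Eu κ)), ℝ) → ℝ≥0∞ := fun φ => sobNorm ⊤ 2 2 (φ : Eu κ → ℝ)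
  have hn : ∀ φ, n φ ≠ ⊤ := fun φ => sobNorm_test_ne_top φ 2 2
  have hr : r ≠ ⊤ := ENNReal.ofReal_ne_top
  refine ⟨n φij + r * n φi + r * n φj + r * (r * n φ0), ?_, fun P F η hF hP => ?_⟩
  · have m : ∀ {a b : ℝ≥0∞}, a ≠ ⊤ → b ≠ ⊤ → a * b ≠ ⊤ := fun ha hb => ENNReal.mul_ne_top ha hb
    exact ENNReal.add_ne_top.2 ⟨ENNReal.add_ne_top.2 ⟨ENNReal.add_ne_top.2 ⟨hn _, m hr (hn _)⟩,
      m hr (hn _)⟩, m hr (m hr (hn _))⟩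
  · let xi : Eu κ → ℝ := fun x => x i
    let xj : Eu κ → ℝ := fun x => x j
    let μ := ballMeasure κ R
    have hm : ∀ φ : 𝓓((⊤ : Opens (Eu κ)), ℝ), AEStronglyMeasurable (F φ) μ := fun φ =>
      (eLpNorm_le_of_opBound (by norm_num) hF φ).1.restrict
    have hb : ∀ φ : 𝓓((⊤ : Opens (Eu κ)), ℝ), eLpNorm (F φ) 2 μ ≤ ENNReal.ofReal η * n φ :=
      fun φ => (eLpNorm_restrict_le _ _ _ _).trans (eLpNorm_le_of_opBound (by norm_num) hF φ).2
    have hxi := aestronglyMeasurable_coord i R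
    have hxj := aestronglyMeasurable_coord j R
    have e : F φij - xj * F φi - xi * F φj + xi * (xj * F φ0) =ᵐ[μ] P.X i j + P.X j i := by
      filter_upwards [ae_ballMeasure (hP φij) R, ae_ballMeasure (hP φi) R, ae_ballMeasure (hP φj) R,
        ae_ballMeasure (hP φ0) R, ae_restrict_mem Metric.isOpen_ball.measurableSet]
        with x h1 h2 h3 h4 hx
      have e0 := P.cl_eqOn (f := φ0) (g := fun _ => 1) Metric.isOpen_ball (fun y hy => hχ y hy) hx
      have e1 := P.cl_eqOn (f := φi) (g := fun x => x i) Metric.isOpen_ball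
        (fun y hy => by simp [φi, hχ y hy]) hx
      have e2 := P.cl_eqOn (f := φj) (g := fun x => x j) Metric.isOpen_ball
        (fun y hy => by simp [φj, hχ y hy]) hx
      have e3 := P.cl_eqOn (f := φij) (g := fun x => x i * x j) Metric.isOpen_ball
        (fun y hy => by simp [φij, hχ y hy]) hx
      simp only [Pi.add_apply, Pi.sub_apply, Pi.mul_apply, h1, h2, h3, h4, e0, e1, e2, e3,
        Op2.cl_one, Op2.cl_coord, Op2.cl_coord_mul, xi, xj]
      ring
    have s1 : AEStronglyMeasurable (F φij - xj * F φi) μ := (hm _).sub (hxj.mul (hm _))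
    have s2 := s1.sub (hxi.mul (hm φj))
    have s3 : AEStronglyMeasurable (xi * (xj * F φ0)) μ := hxi.mul (hxj.mul (hm _))
    refine ⟨(s2.add s3).congr e, ?_⟩
    rw [← eLpNorm_congr_ae e]
    calc _ ≤ eLpNorm (F φij) 2 μ + eLpNorm (xj * F φi) 2 μ + eLpNorm (xi * F φj) 2 μ +
          eLpNorm (xi * (xj * F φ0)) 2 μ := by
          refine (eLpNorm_add_le s2 s3 (by norm_num)).trans (add_le_add ?_ le_rfl)
          refine (eLpNorm_sub_le s1 (hxi.mul (hm _)) (by norm_num)).trans (add_le_add ?_ le_rfl)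
          exact eLpNorm_sub_le (hm _) (hxj.mul (hm _)) (by norm_num)
      _ ≤ ENNReal.ofReal η * n φij + r * (ENNReal.ofReal η * n φi) +
          r * (ENNReal.ofReal η * n φj) + r * (r * (ENNReal.ofReal η * n φ0)) := by
          refine add_le_add (add_le_add (add_le_add (hb _) ?_) ?_) ?_
          · exact (eLpNorm_coord_mul_le j R _).trans (mul_le_mul' le_rfl (hb _))
          · exact (eLpNorm_coord_mul_le i R _).trans (mul_le_mul' le_rfl (hb _))
          · exact (eLpNorm_coord_mul_le i R _).trans (mul_le_mul' le_rfl
              ((eLpNorm_coord_mul_le j R _).trans (mul_le_mul' le_rfl (hb _))))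
      _ = _ := by ring

theorem exists_eLpNorm_X_le (i : κ) (R : ℕ) : ∃ C : ℝ≥0∞, C ≠ ⊤ ∧
    ∀ (V : Op1 κ) (η : ℝ), OpBound 1 V.apply η →
      AEStronglyMeasurable (V.X i) (ballMeasure κ R) ∧
      eLpNorm (V.X i) 2 (ballMeasure κ R) ≤ ENNReal.ofReal η * C := by
  obtain ⟨χ, hχ⟩ := exists_cutoff (κ := κ) R
  let φi := RoughDriver.mulTest _ (smooth_coord i) χ
  let r := ENNReal.ofReal (R + 1)
  let n : 𝓓((⊤ : Opens (Eu κ)), ℝ) → ℝ≥0∞ := fun φ => sobNorm ⊤ 1 2 (φ : Eu κ → ℝ)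
  have hn : ∀ φ, n φ ≠ ⊤ := fun φ => sobNorm_test_ne_top φ 1 2
  refine ⟨n φi + r * n χ, ENNReal.add_ne_top.2
    ⟨hn _, ENNReal.mul_ne_top ENNReal.ofReal_ne_top (hn _)⟩, fun V η hV => ?_⟩
  let xi : Eu κ → ℝ := fun x => x i
  let μ := ballMeasure κ R
  have hm : ∀ φ : 𝓓((⊤ : Opens (Eu κ)), ℝ), AEStronglyMeasurable (V.apply φ) μ := fun φ =>
    (eLpNorm_le_of_opBound (by norm_num) hV φ).1.restrict
  have hb : ∀ φ : 𝓓((⊤ : Opens (Eu κ)), ℝ), eLpNorm (V.apply φ) 2 μ ≤ ENNReal.ofReal η * n φ :=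
    fun φ => (eLpNorm_restrict_le _ _ _ _).trans (eLpNorm_le_of_opBound (by norm_num) hV φ).2
  have hxi := aestronglyMeasurable_coord i R
  have e : V.apply φi - xi * V.apply χ =ᵐ[μ] V.X i := by
    filter_upwards [ae_ballMeasure (V.apply_ae (smooth_test φi)) R,
      ae_ballMeasure (V.apply_ae (smooth_test χ)) R,
      ae_restrict_mem Metric.isOpen_ball.measurableSet] with x h1 h2 hx
    have e0 := V.toOp2.cl_eqOn (f := χ) (g := fun _ => 1) Metric.isOpen_ball
      (fun y hy => hχ y hy) hx
    have e1 := V.toOp2.cl_eqOn (f := φi) (g := fun x => x i) Metric.isOpen_ball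
      (fun y hy => by simp [φi, hχ y hy]) hx
    rw [Op2.cl_one, Op1.toOp2_cl] at e0
    rw [Op2.cl_coord, Op1.toOp2_cl] at e1
    simp only [Pi.sub_apply, Pi.mul_apply, h1, h2, e0, e1, xi, Op1.toOp2]
    ring
  have hx := hxi.mul (hm χ)
  refine ⟨((hm _).sub hx).congr e, ?_⟩
  rw [← eLpNorm_congr_ae e]
  calc _ ≤ eLpNorm (V.apply φi) 2 μ + eLpNorm (xi * V.apply χ) 2 μ :=
        eLpNorm_sub_le (hm _) hx (by norm_num)
    _ ≤ ENNReal.ofReal η * n φi + r * (ENNReal.ofReal η * n χ) :=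
        add_le_add (hb _) ((eLpNorm_coord_mul_le i R _).trans (mul_le_mul' le_rfl (hb _)))
    _ = _ := by ring

/-! ### Paths of class `C¹` -/

theorem Op1.MemD.exists_approx {V : Op1 κ} (h : V.MemD) : ∃ M U, V.Approx 2 M U := by
  refine ⟨V.coefNorm.toReal, Op1.exists_approx ENNReal.toReal_nonneg ?_⟩
  rw [ENNReal.ofReal_toReal h.ne]

theorem Op1.Approx.sub {V W : Op1 κ} {m : ℕ} {M M' : ℝ} {U U' : ℕ → Op1 κ} (h : V.Approx m M U)
    (h' : W.Approx m M' U') : (V - W).Approx m (M + M') (fun n => U n - U' n) where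
  regX i := (h.regX i).sub (h'.regX i)
  regY := h.regY.sub h'.regY
  limX i := (h.limX i).sub (h'.limX i)
  limY := h.limY.sub h'.limY

theorem Op1.MemD.memLp_X {V : Op1 κ} (h : V.MemD) (i : κ) (R : ℕ) :
    MemLp (V.X i) 2 (ballMeasure κ R) := by
  obtain ⟨M, U, hU⟩ := h.exists_approx
  refine MemLp.of_bound ((hU.limX i).aestronglyMeasurable (hU.regX i).smooth).restrict M ?_
  refine ae_ballMeasure ?_ R
  filter_upwards [hU.limX i] with x hx
  exact le_of_tendsto hx.norm (Eventually.of_forall fun n =>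
    (abs_le_jet _ _ x).trans ((hU.regX i).bound n x trivial))

open Classical in
/-- The class of a square integrable function. -/
def toL2 (μ : Measure (Eu κ)) (f : Eu κ → ℝ) : Lp ℝ 2 μ :=
  if h : MemLp f 2 μ then h.toLp f else 0

theorem toL2_of_memLp {μ : Measure (Eu κ)} {f : Eu κ → ℝ} (h : MemLp f 2 μ) :
    toL2 μ f = h.toLp f := dif_pos h

theorem norm_toL2_le {μ : Measure (Eu κ)} {f : Eu κ → ℝ} (h : MemLp f 2 μ) {C : ℝ} (hC : 0 ≤ C)
    (hf : eLpNorm f 2 μ ≤ ENNReal.ofReal C) : ‖toL2 μ f‖ ≤ C := by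
  rw [toL2_of_memLp h, Lp.norm_toLp]
  exact ENNReal.toReal_le_of_le_ofReal hC hf

/-- By `exists_eLpNorm_X_le` the coefficient is a differentiable curve in `L²` of the ball with
continuous derivative. On the compact time interval the derivative is bounded, and the mean value
inequality applies. -/
theorem IsC1Path.exists_lipschitz {T : ℝ} {B : ℝ → Op1 κ} (hB : IsC1Path T B) (i : κ) (R : ℕ) :
    ∃ K : ℝ, ∀ r ∈ Set.Icc 0 T, ∀ r' ∈ Set.Icc 0 T,
      eLpNorm ((B r).X i - (B r').X i) 2 (ballMeasure κ R) ≤ ENNReal.ofReal (K * |r - r'|) := by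
  obtain ⟨hmem, dB, hdmem, hcont, hder⟩ := hB
  obtain ⟨C, hC, hCb⟩ := exists_eLpNorm_X_le i R
  let μ := ballMeasure κ R
  let g : ℝ → Lp ℝ 2 μ := fun t => toL2 μ ((B t).X i)
  let g' : ℝ → Lp ℝ 2 μ := fun t => toL2 μ ((dB t).X i)
  have hc : 0 ≤ C.toReal := ENNReal.toReal_nonneg
  have hbound : ∀ (V : Op1 κ) (η : ℝ), 0 ≤ η → OpBound 1 V.apply η →
      eLpNorm (V.X i) 2 μ ≤ ENNReal.ofReal (η * C.toReal) := fun V η hη h => by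
    rw [ENNReal.ofReal_mul hη, ENNReal.ofReal_toReal hC]
    exact (hCb V η h).2
  have hd : ∀ t ∈ Set.Icc 0 T, HasDerivWithinAt g (g' t) (Set.Icc 0 T) t := by
    intro t ht
    rw [hasDerivWithinAt_iff_isLittleO, Asymptotics.isLittleO_iff]
    intro c hcpos
    -- Dividing by `C + 1` instead of `C` avoids a division by zero.
    obtain ⟨δ, hδ, h⟩ := hder t ht (c / (C.toReal + 1)) (by positivity)
    filter_upwards [inter_mem_nhdsWithin (Set.Icc 0 T) (Metric.ball_mem_nhds t hδ)] with r hr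
    have h1 := hbound _ _ (by positivity) (h r hr.1 hr.2)
    have e : g r - g t - (r - t) • g' t = toL2 μ ((B r - B t - (r - t) • dB t).X i) := by
      have hm : MemLp ((B r - B t - (r - t) • dB t).X i) 2 μ :=
        (((hmem r hr.1).memLp_X i R).sub ((hmem t ht).memLp_X i R)).sub
          (((hdmem t ht).memLp_X i R).const_smul (r - t))
      rw [toL2_of_memLp hm]
      simp only [g, g']
      rw [toL2_of_memLp ((hmem r hr.1).memLp_X i R), toL2_of_memLp ((hmem t ht).memLp_X i R),
        toL2_of_memLp ((hdmem t ht).memLp_X i R)]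
      rfl
    rw [e]
    have hm : MemLp ((B r - B t - (r - t) • dB t).X i) 2 μ :=
      (((hmem r hr.1).memLp_X i R).sub ((hmem t ht).memLp_X i R)).sub
        (((hdmem t ht).memLp_X i R).const_smul (r - t))
    refine (norm_toL2_le hm (by positivity) h1).trans ?_
    rw [Real.norm_eq_abs]
    have h2 : c / (C.toReal + 1) * C.toReal ≤ c := by
      rw [div_mul_eq_mul_div, div_le_iff₀ (by positivity)]
      nlinarith
    calc c / (C.toReal + 1) * |r - t| * C.toReal = c / (C.toReal + 1) * C.toReal * |r - t| := by ring
      _ ≤ c * |r - t| := mul_le_mul_of_nonneg_right h2 (abs_nonneg _)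
  have hcg : ContinuousOn g' (Set.Icc 0 T) := by
    rw [Metric.continuousOn_iff]
    intro t ht c hcpos
    obtain ⟨δ, hδ, h⟩ := hcont t ht (c / (C.toReal + 1)) (by positivity)
    refine ⟨δ, hδ, fun r hr hrt => ?_⟩
    have h1 := hbound _ _ (by positivity) (h r hr hrt)
    have hm : MemLp ((dB r - dB t).X i) 2 μ :=
      ((hdmem r hr).memLp_X i R).sub ((hdmem t ht).memLp_X i R)
    have e : g' r - g' t = toL2 μ ((dB r - dB t).X i) := by
      rw [toL2_of_memLp hm]
      simp only [g']
      rw [toL2_of_memLp ((hdmem r hr).memLp_X i R), toL2_of_memLp ((hdmem t ht).memLp_X i R)]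
      rfl
    rw [dist_eq_norm, e]
    refine (norm_toL2_le hm (by positivity) h1).trans_lt ?_
    rw [div_mul_eq_mul_div, div_lt_iff₀ (by positivity)]
    nlinarith
  obtain ⟨K, hK⟩ := isCompact_Icc.exists_bound_of_continuousOn hcg
  refine ⟨K, fun r hr r' hr' => ?_⟩
  have h := (convex_Icc 0 T).norm_image_sub_le_of_norm_hasDerivWithin_le hd hK hr' hr
  have e : g r - g r' = (((hmem r hr).memLp_X i R).sub ((hmem r' hr').memLp_X i R)).toLp _ := by
    simp only [g]
    rw [toL2_of_memLp ((hmem r hr).memLp_X i R), toL2_of_memLp ((hmem r' hr').memLp_X i R)]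
    rfl
  rw [e, Lp.norm_toLp, Real.norm_eq_abs] at h
  have h2 : eLpNorm ((B r).X i - (B r').X i) 2 μ ≠ ⊤ :=
    (((hmem r hr).memLp_X i R).sub ((hmem r' hr').memLp_X i R)).2.ne
  rw [← ENNReal.ofReal_toReal h2]
  exact ENNReal.ofReal_le_ofReal h

end

/-! ### The symmetric part of geometric drivers -/

section

/-- The sum of the first `N` terms of a sequence of operators. -/
def Op2.rangeSum (N : ℕ) (P : ℕ → Op2 κ) : Op2 κ where
  X i j := ∑ l ∈ Finset.range N, (P l).X i j
  Y i := ∑ l ∈ Finset.range N, (P l).Y i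
  Z := ∑ l ∈ Finset.range N, (P l).Z

theorem Op2.rangeSum_cl (N : ℕ) (P : ℕ → Op2 κ) (f : Eu κ → ℝ) :
    (Op2.rangeSum N P).cl f = ∑ l ∈ Finset.range N, (P l).cl f := by
  induction N with
  | zero => funext x; simp [Op2.rangeSum, Op2.cl_apply]
  | succ N ih =>
    have e : Op2.rangeSum (N + 1) P = Op2.rangeSum N P + P N := by
      ext <;> simp [Op2.rangeSum, Finset.sum_range_succ]
    rw [e, Op2.add_cl, ih, Finset.sum_range_succ]

theorem riemannSum_ae {T : ℝ} {B : ℝ → Op1 κ} (hB : ∀ t ∈ Set.Icc 0 T, (B t).MemD) {s t : ℝ}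
    {N : ℕ} {p : ℕ → ℝ} (hp : ∀ l, p l = s + l * ((t - s) / N))
    (hpT : ∀ l ≤ N, p l ∈ Set.Icc 0 T) (φ : 𝓓((⊤ : Opens (Eu κ)), ℝ)) :
    riemannSum B s t N φ =ᵐ[volume] (Op2.rangeSum N fun l =>
      (B (p (l + 1)) - B (p l)).weakComp (B (p l) - B (p 0))).cl φ := by
  have hp0 : p 0 = s := by simp [hp]
  have key : ∀ l ∈ Finset.range N, (B (p (l + 1)) - B (p l)).apply ((B (p l) - B (p 0)).apply φ)
      =ᵐ[volume] ((B (p (l + 1)) - B (p l)).weakComp (B (p l) - B (p 0))).cl φ := by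
    intro l hl
    obtain ⟨M, U, hU⟩ := (hB _ (hpT l (Finset.mem_range.1 hl).le)).exists_approx
    obtain ⟨M', U', hU'⟩ := (hB _ (hpT 0 (Nat.zero_le N))).exists_approx
    exact (hU.sub hU').apply_apply _ φ
  have key' : ∀ᵐ x, ∀ l ∈ Finset.range N,
      (B (p (l + 1)) - B (p l)).apply ((B (p l) - B (p 0)).apply φ) x =
      ((B (p (l + 1)) - B (p l)).weakComp (B (p l) - B (p 0))).cl φ x :=
    (Finset.eventually_all _).2 key
  filter_upwards [key'] with x hx
  rw [Op2.rangeSum_cl, Finset.sum_apply, ← Finset.sum_congr rfl hx, riemannSum, Finset.sum_apply]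
  refine Finset.sum_congr rfl fun l _ => ?_
  rw [hp0, hp, hp]
  push_cast
  rfl

/-- Discrete integration by parts: the left sums of `∫ b da` and `∫ a db` add up to the product of
the increments minus the discrete quadratic covariation. -/
theorem sum_range_telescope (a b : ℕ → ℝ) (N : ℕ) :
    ∑ l ∈ Finset.range N, ((a (l + 1) - a l) * (b l - b 0)) +
      ∑ l ∈ Finset.range N, ((b (l + 1) - b l) * (a l - a 0)) =
    (a N - a 0) * (b N - b 0) -
      ∑ l ∈ Finset.range N, (a (l + 1) - a l) * (b (l + 1) - b l) := by
  induction N with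
  | zero => simp
  | succ N ih => simp only [Finset.sum_range_succ]; linear_combination ih

theorem eLpNorm_mul_one_le {μ : Measure (Eu κ)} {f g : Eu κ → ℝ} (hf : AEStronglyMeasurable f μ)
    (hg : AEStronglyMeasurable g μ) : eLpNorm (f * g) 1 μ ≤ eLpNorm f 2 μ * eLpNorm g 2 μ := by
  have h : eLpNorm (f • g) 1 μ ≤ eLpNorm f 2 μ * eLpNorm g 2 μ :=
    eLpNorm_smul_le_mul_eLpNorm hg hf
  have e : f • g = f * g := rfl
  rwa [e] at h

theorem exists_eLpNorm_one_le (κ : Type) [Fintype κ] (R : ℕ) : ∃ v : ℝ≥0∞, v ≠ ⊤ ∧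
    ∀ f : Eu κ → ℝ, AEStronglyMeasurable f (ballMeasure κ R) →
      eLpNorm f 1 (ballMeasure κ R) ≤ eLpNorm f 2 (ballMeasure κ R) * v :=
  ⟨_, ENNReal.rpow_ne_top_of_nonneg (by norm_num) (measure_ne_top _ _), fun _ hf =>
    eLpNorm_le_eLpNorm_mul_rpow_measure_univ (by norm_num) hf⟩

theorem ae_eq_of_eLpNorm_sub_le {μ : Measure (Eu κ)} {f g : Eu κ → ℝ}
    (hf : AEStronglyMeasurable f μ) (hg : AEStronglyMeasurable g μ) {e : ℕ → ℝ≥0∞}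
    (he : Tendsto e atTop (𝓝 0)) (h : ∀ᶠ n in atTop, eLpNorm (f - g) 1 μ ≤ e n) : f =ᵐ[μ] g := by
  have h0 : eLpNorm (f - g) 1 μ = 0 := le_antisymm (ge_of_tendsto he h) zero_le
  rw [eLpNorm_eq_zero_iff (hf.sub hg) one_ne_zero] at h0
  filter_upwards [h0] with x hx
  exact sub_eq_zero.1 hx

/-- The identity is `∫ dX i X j + ∫ dX j X i = X i * X j` for increments from time `s`. In the
Riemann sums it fails by the discrete covariation, whose `N` terms have `L¹`-norm of order `1/N²` by
the Lipschitz bound. The space is `L¹` of a ball because products of two `L²` functions occur. -/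
theorem IsCanonicalLift.ae_symm {T : ℝ} {B : ℝ → Op1 κ} {L : ℝ → ℝ → Op2 κ}
    (h : IsCanonicalLift T B L) {s t : ℝ} (hst : (s, t) ∈ simplex T) (i j : κ) :
    (L s t).X i j + (L s t).X j i =ᵐ[volume] (B t - B s).X i * (B t - B s).X j := by
  refine ae_of_ae_ballMeasure fun R => ?_
  set μ := ballMeasure κ R
  obtain ⟨hC1, hL⟩ := h
  obtain ⟨hLmem, hLim⟩ := hL s t hst
  obtain ⟨h0s, hs, htT⟩ := hst
  simp only at h0s hs htT
  have hmem := hC1.1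
  obtain ⟨Ki, hKi⟩ := hC1.exists_lipschitz i R
  obtain ⟨Kj, hKj⟩ := hC1.exists_lipschitz j R
  obtain ⟨C, hC, hCb⟩ := exists_eLpNorm_symX_le i j R
  obtain ⟨v, hv, hvb⟩ := exists_eLpNorm_one_le κ R
  have hsI : s ∈ Set.Icc 0 T := ⟨h0s, hs.trans htT⟩
  have htI : t ∈ Set.Icc 0 T := ⟨h0s.trans hs, htT⟩
  have hmX : ∀ r ∈ Set.Icc 0 T, ∀ i, AEStronglyMeasurable ((B r).X i) μ := fun r hr i =>
    ((hmem r hr).memLp_X i R).1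
  have hLX : ∀ i j, AEStronglyMeasurable ((L s t).X i j) μ := by
    intro i j
    obtain ⟨Q, hQ⟩ := Op2.exists_approx (P := L s t) (M := (L s t).coefNorm.toReal)
      ENNReal.toReal_nonneg (by rw [ENNReal.ofReal_toReal hLmem.ne])
    exact ((hQ.limX i j).aestronglyMeasurable (hQ.regX i j).smooth).restrict
  have main : ∀ η > 0, ∃ N₀ : ℕ, ∀ N ≥ N₀,
      eLpNorm ((L s t).X i j + (L s t).X j i - (B t - B s).X i * (B t - B s).X j) 1 μ ≤
      ENNReal.ofReal η * C * v + ENNReal.ofReal (|Ki| * |Kj| * (t - s) ^ 2 / N) := by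
    intro η hη
    obtain ⟨N₀, hN₀⟩ := hLim η hη
    refine ⟨max N₀ 1, fun N hN => ?_⟩
    have hN1 : 1 ≤ N := (le_max_right _ _).trans hN
    have hNpos : (0 : ℝ) < N := by exact_mod_cast hN1
    let p : ℕ → ℝ := fun l => s + l * ((t - s) / N)
    have hp0 : p 0 = s := by simp [p]
    have hpN : p N = t := by simp only [p]; field_simp; ring
    have hh : 0 ≤ (t - s) / N := div_nonneg (sub_nonneg.2 hs) hNpos.le
    have hpT : ∀ l ≤ N, p l ∈ Set.Icc 0 T := by
      intro l hl
      have h1 : (l : ℝ) * ((t - s) / N) ≤ N * ((t - s) / N) :=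
        mul_le_mul_of_nonneg_right (by exact_mod_cast hl) hh
      have h2 : (N : ℝ) * ((t - s) / N) = t - s := by field_simp
      exact ⟨by positivity, by simp only [p]; linarith⟩
    let δ : κ → ℕ → Eu κ → ℝ := fun k l => (B (p (l + 1))).X k - (B (p l)).X k
    let P : Op2 κ := (Op2.rangeSum N fun l =>
      (B (p (l + 1)) - B (p l)).weakComp (B (p l) - B (p 0))) - L s t
    have hP : ∀ φ : 𝓓((⊤ : Opens (Eu κ)), ℝ),
        (fun f => riemannSum B s t N f - (L s t).apply f) φ =ᵐ[volume] P.cl φ := by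
      intro φ
      filter_upwards [riemannSum_ae (s := s) (t := t) hmem (N := N) (p := p)
        (fun l => rfl) hpT φ, (L s t).apply_ae (smooth_test φ)] with x h1 h2
      simp only [P, Op2.sub_cl, Pi.sub_apply, h1, h2]
    obtain ⟨hPm, hPb⟩ := hCb P _ η (hN₀ N ((le_max_left _ _).trans hN)) hP
    have hδ : ∀ (k : κ) (K : ℝ), (∀ r ∈ Set.Icc 0 T, ∀ r' ∈ Set.Icc 0 T,
        eLpNorm ((B r).X k - (B r').X k) 2 μ ≤ ENNReal.ofReal (K * |r - r'|)) →
        ∀ l ∈ Finset.range N, AEStronglyMeasurable (δ k l) μ ∧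
          eLpNorm (δ k l) 2 μ ≤ ENNReal.ofReal (|K| * ((t - s) / N)) := by
      intro k K hK l hl
      have hl' := Finset.mem_range.1 hl
      have m1 := hpT (l + 1) hl'
      have m2 := hpT l hl'.le
      refine ⟨(hmX _ m1 k).sub (hmX _ m2 k), (hK _ m1 _ m2).trans (ENNReal.ofReal_le_ofReal ?_)⟩
      have : p (l + 1) - p l = (t - s) / N := by simp only [p]; push_cast; ring
      rw [this, abs_of_nonneg hh]
      exact mul_le_mul_of_nonneg_right (le_abs_self K) hh
    have hδi := hδ i Ki hKi
    have hδj := hδ j Kj hKj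
    -- The operator `P` is the Riemann sum minus the lift. Its symmetric coefficient is small by
    -- operator convergence, and the remaining sum is the covariation.
    have e : (L s t).X i j + (L s t).X j i - (B t - B s).X i * (B t - B s).X j =
        -(P.X i j + P.X j i) - ∑ l ∈ Finset.range N, δ i l * δ j l := by
      funext x
      have := sum_range_telescope (fun l => (B (p l)).X i x) (fun l => (B (p l)).X j x) N
      simp only [P, δ, Op2.rangeSum, Op1.weakComp, Op2.sub_X, Op1.sub_X, Pi.sub_apply,
        Pi.add_apply, Pi.neg_apply, Pi.mul_apply, Finset.sum_apply, hp0, hpN] at this ⊢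
      linear_combination this
    rw [e]
    have hm2 : AEStronglyMeasurable (∑ l ∈ Finset.range N, δ i l * δ j l) μ :=
      Finset.aestronglyMeasurable_sum _ fun l hl => (hδi l hl).1.mul (hδj l hl).1
    refine (eLpNorm_sub_le hPm.neg hm2 le_rfl).trans (add_le_add ?_ ?_)
    · rw [eLpNorm_neg]
      exact (hvb _ hPm).trans (mul_le_mul' hPb le_rfl)
    · refine (eLpNorm_sum_le (fun l hl => (hδi l hl).1.mul (hδj l hl).1) le_rfl).trans ?_
      calc ∑ l ∈ Finset.range N, eLpNorm (δ i l * δ j l) 1 μ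
          ≤ ∑ _l ∈ Finset.range N, ENNReal.ofReal (|Ki| * ((t - s) / N)) *
              ENNReal.ofReal (|Kj| * ((t - s) / N)) := Finset.sum_le_sum fun l hl =>
            (eLpNorm_mul_one_le (hδi l hl).1 (hδj l hl).1).trans
              (mul_le_mul' (hδi l hl).2 (hδj l hl).2)
        _ = _ := by
            rw [Finset.sum_const, Finset.card_range, nsmul_eq_mul, ← ENNReal.ofReal_mul (by positivity),
              ← ENNReal.ofReal_natCast, ← ENNReal.ofReal_mul (by positivity)]
            congr 1
            field_simp
  -- First `N` tends to infinity at fixed `η = 1 / (k + 1)`, which removes the covariation; then `k`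
  -- tends to infinity.
  refine ae_eq_of_eLpNorm_sub_le (e := fun k : ℕ => ENNReal.ofReal (1 / ((k : ℝ) + 1)) * (C * v))
    ((hLX i j).add (hLX j i)) (((hmX t htI i).sub (hmX s hsI i)).mul
      ((hmX t htI j).sub (hmX s hsI j))) ?_ (Eventually.of_forall fun k => ?_)
  · have h1 := ENNReal.tendsto_ofReal (tendsto_one_div_add_atTop_nhds_zero_nat (𝕜 := ℝ))
    have := ENNReal.Tendsto.mul_const (b := C * v) h1 (Or.inr (ENNReal.mul_ne_top hC hv))
    simpa using this
  · obtain ⟨N₀, hN₀⟩ := main (1 / ((k : ℝ) + 1)) (by positivity)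
    have hlim : Tendsto (fun N : ℕ => ENNReal.ofReal (1 / ((k : ℝ) + 1)) * C * v +
        ENNReal.ofReal (|Ki| * |Kj| * (t - s) ^ 2 / N)) atTop
        (𝓝 (ENNReal.ofReal (1 / ((k : ℝ) + 1)) * C * v + 0)) := by
      refine tendsto_const_nhds.add ?_
      have := ENNReal.tendsto_ofReal (tendsto_const_div_atTop_nhds_zero_nat (|Ki| * |Kj| * (t - s) ^ 2))
      simpa using this
    rw [add_zero] at hlim
    rw [← mul_assoc]
    exact ge_of_tendsto hlim (eventually_atTop.2 ⟨N₀, hN₀⟩)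

theorem IsControl.rpow_le {T : ℝ} {w : ℝ → ℝ → ℝ} (hw : IsControl T w) {s t : ℝ}
    (hst : (s, t) ∈ simplex T) {β : ℝ} (hβ : 0 ≤ β) : w s t ^ β ≤ w 0 T ^ β := by
  obtain ⟨h0, h1, h2⟩ := hst
  simp only at h0 h1 h2
  have a1 := hw.superadd 0 s t le_rfl h0 h1 h2
  have a2 := hw.superadd 0 t T le_rfl (h0.trans h1) h2 le_rfl
  have b1 := hw.nonneg 0 s ⟨le_rfl, h0, h1.trans h2⟩
  have b2 := hw.nonneg t T ⟨h0.trans h1, h2, le_rfl⟩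
  exact Real.rpow_le_rpow (hw.nonneg s t ⟨h0, h1, h2⟩) (by linarith) hβ

/-- The symmetric part of the second level of a geometric driver is determined by the first. -/
theorem IsGeometric.ae_symm {T α : ℝ} (hα : 0 < α) {B1 : ℝ → ℝ → Op1 κ} {B2 : ℝ → ℝ → Op2 κ}
    (h : IsGeometric T α B1 B2) {s t : ℝ} (hst : (s, t) ∈ simplex T) (h1 : (B1 s t).MemD)
    (h2 : (B2 s t).MemD) (i j : κ) :
    (B2 s t).X i j + (B2 s t).X j i =ᵐ[volume] (B1 s t).X i * (B1 s t).X j := by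
  refine ae_of_ae_ballMeasure fun R => ?_
  set μ := ballMeasure κ R
  obtain ⟨B, hBm, hB, Bn, Ln, η, hlift, hη, hn⟩ := h
  obtain ⟨C, hC, hCb⟩ := exists_eLpNorm_symX_le i j R
  obtain ⟨Ci, hCi, hCib⟩ := exists_eLpNorm_X_le i R
  obtain ⟨Cj, hCj, hCjb⟩ := exists_eLpNorm_X_le j R
  obtain ⟨v, hv, hvb⟩ := exists_eLpNorm_one_le κ R
  have hsI : s ∈ Set.Icc 0 T := ⟨hst.1, hst.2.1.trans hst.2.2⟩
  have htI : t ∈ Set.Icc 0 T := ⟨hst.1.trans hst.2.1, hst.2.2⟩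
  have hL2X : ∀ i j, AEStronglyMeasurable ((B2 s t).X i j) μ := by
    intro i j
    obtain ⟨Q, hQ⟩ := Op2.exists_approx (P := B2 s t) (M := (B2 s t).coefNorm.toReal)
      ENNReal.toReal_nonneg (by rw [ENNReal.ofReal_toReal h2.ne])
    exact ((hQ.limX i j).aestronglyMeasurable (hQ.regX i j).smooth).restrict
  have ha := h1.memLp_X i R
  have hb := h1.memLp_X j R
  set a := (B1 s t).X i
  set b := (B1 s t).X j
  refine ae_eq_of_eLpNorm_sub_le (e := fun n => ENNReal.ofReal (η n) * C * v +
    (ENNReal.ofReal (η n) * Ci * (eLpNorm b 2 μ + ENNReal.ofReal (η n) * Cj) +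
      eLpNorm a 2 μ * (ENNReal.ofReal (η n) * Cj)))
    ((hL2X i j).add (hL2X j i)) (ha.1.mul hb.1) ?_ (Eventually.of_forall fun n => ?_)
  · have t0 : ∀ {c : ℝ≥0∞}, c ≠ ⊤ → Tendsto (fun n => ENNReal.ofReal (η n) * c) atTop (𝓝 0) := by
      intro c hc
      have := ENNReal.Tendsto.mul_const (b := c) (ENNReal.tendsto_ofReal hη) (Or.inr hc)
      simpa using this
    have t1 := ENNReal.Tendsto.mul_const (b := v) (t0 hC) (Or.inr hv)
    have t2 := ENNReal.Tendsto.mul (t0 hCi) (Or.inr (by simpa using hb.2.ne))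
      (tendsto_const_nhds.add (t0 hCj) : Tendsto (fun n => eLpNorm b 2 μ +
        ENNReal.ofReal (η n) * Cj) atTop (𝓝 (eLpNorm b 2 μ + 0))) (Or.inr ENNReal.zero_ne_top)
    have t3 := ENNReal.Tendsto.const_mul (a := eLpNorm a 2 μ) (t0 hCj) (Or.inr ha.2.ne)
    simpa using t1.add (t2.add t3)
  · obtain ⟨-, ⟨w, hw, hwη, hw1⟩, w', hw', hwη', hw2⟩ := hn n
    have b1 := (hw1 s t hst).mono ((hw.rpow_le hst hα.le).trans hwη)
    have b2 := (hw2 s t hst).mono ((hw'.rpow_le hst (by positivity)).trans hwη')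
    have hBn := (hlift n).1.1
    have an := ((hBn t htI).memLp_X i R).1.sub ((hBn s hsI).memLp_X i R).1
    have bn := ((hBn t htI).memLp_X j R).1.sub ((hBn s hsI).memLp_X j R).1
    set a' := (Bn n t - Bn n s).X i
    set b' := (Bn n t - Bn n s).X j
    obtain ⟨hPm, hPb⟩ := hCb (Ln n s t - B2 s t) _ (η n) b2
      fun φ => (Ln n s t - B2 s t).apply_ae (smooth_test φ)
    obtain ⟨hAm, hAb⟩ := hCib (Bn n t - Bn n s - B1 s t) (η n) b1
    obtain ⟨hBm', hBb⟩ := hCjb (Bn n t - Bn n s - B1 s t) (η n) b1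
    have hAm' : AEStronglyMeasurable (a' - a) μ := hAm
    have hAb' : eLpNorm (a' - a) 2 μ ≤ _ := hAb
    have hBm'' : AEStronglyMeasurable (b' - b) μ := hBm'
    have hBb' : eLpNorm (b' - b) 2 μ ≤ _ := hBb
    -- For the approximating lift the symmetric coefficient equals `a' * b'`. What remains is the
    -- convergence of the second level together with `a' * b' - a * b`, split so that each product
    -- contains one small factor.
    have e : (B2 s t).X i j + (B2 s t).X j i - a * b =ᵐ[μ]
        -((Ln n s t - B2 s t).X i j + (Ln n s t - B2 s t).X j i) +
          ((a' - a) * b' + a * (b' - b)) := by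
      filter_upwards [ae_ballMeasure ((hlift n).ae_symm hst i j) R] with x hx
      simp only [Pi.add_apply, Pi.sub_apply, Pi.neg_apply, Pi.mul_apply, Op2.sub_X] at hx ⊢
      linear_combination hx
    rw [eLpNorm_congr_ae e]
    have hb' : eLpNorm b' 2 μ ≤ eLpNorm b 2 μ + ENNReal.ofReal (η n) * Cj := by
      have : b' = b + (b' - b) := by abel
      rw [this]
      exact (eLpNorm_add_le hb.1 hBm'' (by norm_num)).trans (add_le_add le_rfl hBb')
    refine (eLpNorm_add_le hPm.neg ((hAm'.mul bn).add (ha.1.mul hBm'')) le_rfl).trans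
      (add_le_add ?_ ((eLpNorm_add_le (hAm'.mul bn) (ha.1.mul hBm'') le_rfl).trans
        (add_le_add ?_ ?_)))
    · rw [eLpNorm_neg]
      exact (hvb _ hPm).trans (mul_le_mul' hPb le_rfl)
    · exact (eLpNorm_mul_one_le hAm' bn).trans (mul_le_mul' hAb' hb')
    · exact (eLpNorm_mul_one_le ha.1 hBm'').trans (mul_le_mul' le_rfl hBb')

end

/-! ### Adjoint operators -/

section

/-- The adjoint of an operator with smooth coefficients, in non-divergence form. -/
def Op1.adjOp (V : Op1 κ) : Op1 κ := ⟨fun i => -V.X i, V.Y - ∑ i, pd1 i (V.X i)⟩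

/-- The adjoint of an operator, in non-divergence form. -/
def Op1.weakAdjOp (V : Op1 κ) : Op1 κ := ⟨fun i => -V.X i, V.Y - ∑ i, weakDeriv ⊤ ![i] (V.X i)⟩

variable {m : ℕ} {M : ℝ}

/-- The zeroth order coefficient acquires the divergence of `X`. The extra order of regularity of
`X` makes the adjoint an operator of the same class. -/
theorem Op1.Approx.adjOp {V : Op1 κ} {U : ℕ → Op1 κ} (h : V.Approx m M U) :
    V.weakAdjOp.Approx m ((Fintype.card κ + 1) * M) (fun n => (U n).adjOp) := by
  have hM : 0 ≤ M := h.regY.nonneg_bound (Set.mem_univ 0)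
  refine ⟨fun i => (h.regX i).neg.of_le le_rfl ?_ subset_rfl, ?_, fun i => (h.limX i).neg, ?_⟩
  · have : (0 : ℝ) ≤ Fintype.card κ * M := by positivity
    linarith
  · refine (h.regY.sub (Reg.sum fun i _ => (h.regX i).pd1 i)).of_le le_rfl (le_of_eq ?_) subset_rfl
    rw [Finset.sum_const, Finset.card_univ, nsmul_eq_mul]; ring
  · exact h.limY.sub (LimAE.sum fun i _ => (h.regX i).limAE_weakDeriv_one i (h.limX i))

theorem Op1.IsSmooth.adjOp {V : Op1 κ} (hV : V.IsSmooth) : V.adjOp.IsSmooth :=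
  ⟨fun i => (hV.1 i).neg, hV.2.sub (Smooth.sum fun i _ => (hV.1 i).pd1 i)⟩

theorem Op1.IsSmooth.adjOp_cl {V : Op1 κ} (hV : V.IsSmooth) {f : Eu κ → ℝ} (hf : Smooth f) :
    V.adjOp.cl f = -∑ i, pd1 i (V.X i * f) + V.Y * f := by
  funext x
  simp only [Op1.cl_apply, Op1.adjOp, pd1_mul (hV.1 _) hf, Pi.add_apply, Pi.neg_apply,
    Finset.sum_apply, Pi.mul_apply, Pi.sub_apply, Finset.sum_add_distrib, sub_mul, Finset.sum_mul,
    neg_mul, Finset.sum_neg_distrib]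
  ring

theorem Op1.Approx.limAE_adjoint {V : Op1 κ} {U : ℕ → Op1 κ} (h : V.Approx m M U)
    (ψ : 𝓓((⊤ : Opens (Eu κ)), ℝ)) : LimAE (fun n => (U n).adjOp.cl ψ) (V.adjoint ψ) := by
  have e : V.adjoint ψ =
      -∑ i, weakDeriv ⊤ ![i] (V.X i * (ψ : Eu κ → ℝ)) + V.Y * (ψ : Eu κ → ℝ) := by
    funext x
    simp only [Op1.adjoint, Pi.add_apply, Pi.neg_apply, Finset.sum_apply, Pi.mul_apply]
    rfl
  rw [e]
  simp_rw [(h.isSmooth _).adjOp_cl (smooth_test ψ)]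
  refine (LimAE.sum fun i _ => ?_).neg.add (h.limY.mul (LimAE.fixed _))
  obtain ⟨C, hC⟩ := (h.regX i).mulTest ψ
  exact hC.limAE_weakDeriv_one i ((h.limX i).mul (LimAE.fixed _))

/-- The divergence on the doubled space splits into the divergences in `x` and in `y`. The analysis
of conjugated doubled operators therefore covers their adjoints. -/
theorem Op1.IsSmooth.adjOp_dbl {V : Op1 ι} (hV : V.IsSmooth) : V.dbl.adjOp = V.adjOp.dbl := by
  have hX : V.dbl.adjOp.X = V.adjOp.dbl.X := by
    funext i z
    rcases i with i | i
    · rw [Op1.dbl_X_inl]; simp [Op1.adjOp, Op1.dbl_X_inl]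
    · rw [Op1.dbl_X_inr]; simp [Op1.adjOp, Op1.dbl_X_inr]
  have hY : V.dbl.adjOp.Y = V.adjOp.dbl.Y := by
    funext z
    rw [Op1.dbl_Y]
    simp [Op1.adjOp, Op1.dbl_X_inl, Op1.dbl_X_inr, Op1.dbl_Y, pd1_inl_comp_xPart (hV.1 _),
      pd1_inr_comp_yPart (hV.1 _)]
    ring
  exact Op1.ext hX hY

/-! ### Duality between an operator and its formal adjoint -/

theorem integral_pd1_eq_zero {f : Eu κ → ℝ} (hf : Smooth f) (hc : HasCompactSupport f) (i : κ) :
    ∫ x, pd1 i f x = 0 := by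
  have h := integral_pd1_mul (f := fun _ => (1 : ℝ)) contDiff_const hf hc i
  simp at h
  simpa using h

/-- The two integrands differ by the divergence of `X * g * φ`, which has compact support through
`φ` alone. -/
theorem Op1.IsSmooth.integral_adjOp {V : Op1 κ} (hV : V.IsSmooth) (φ : 𝓓((⊤ : Opens (Eu κ)), ℝ))
    {g : Eu κ → ℝ} (hg : Smooth g) :
    ∫ x, V.adjOp.cl g x * φ x = ∫ x, V.cl φ x * g x := by
  have hφ := smooth_test φ
  have hc : ∀ {u : Eu κ → ℝ}, Smooth u → (∀ x, x ∉ tsupport φ → u x = 0) →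
      Integrable u := fun hu h0 =>
    hu.continuous.integrable_of_hasCompactSupport (HasCompactSupport.intro φ.hasCompactSupport
      fun x hx => h0 x hx)
  have z0 : ∀ x, x ∉ tsupport φ → φ x = 0 := fun x hx => image_eq_zero_of_notMem_tsupport hx
  have z1 : ∀ i x, x ∉ tsupport φ → pd1 i φ x = 0 := fun i x hx =>
    image_eq_zero_of_notMem_tsupport fun h => hx (tsupport_pd1_subset i _ h)
  have hs : ∀ i, Smooth (V.X i * g * (φ : Eu κ → ℝ)) := fun i => ((hV.1 i).mul hg).mul hφ
  have hcs : ∀ i, HasCompactSupport (V.X i * g * (φ : Eu κ → ℝ)) := fun i =>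
    φ.hasCompactSupport.mul_left
  have i1 : Integrable (fun x => V.adjOp.cl g x * φ x) :=
    hc ((hV.adjOp.cl hg).mul hφ) fun x hx => by simp [z0 x hx]
  have i2 : Integrable (fun x => V.cl φ x * g x) :=
    hc ((hV.cl hφ).mul hg) fun x hx => by simp [Op1.cl_apply, z0 x hx, z1 _ x hx]
  have e : ∀ x, V.cl φ x * g x - V.adjOp.cl g x * φ x =
      ∑ i, pd1 i (V.X i * g * (φ : Eu κ → ℝ)) x := fun x => by
    rw [hV.adjOp_cl hg, Op1.cl_apply]
    simp only [pd1_mul ((hV.1 _).mul hg) hφ, Pi.add_apply, Pi.neg_apply, Finset.sum_apply,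
      Pi.mul_apply, Finset.sum_add_distrib, add_mul, neg_mul, Finset.sum_mul]
    rw [Finset.sum_congr rfl fun i _ => (by ring : V.X i x * pd1 i φ x * g x =
      V.X i x * g x * pd1 i φ x)]
    ring
  have h0 : ∫ x, (V.cl φ x * g x - V.adjOp.cl g x * φ x) = 0 := by
    simp_rw [e]
    rw [integral_finsetSum _ fun i _ => ((hs i).pd1 i).continuous.integrable_of_hasCompactSupport
      (HasCompactSupport.pd1 (hcs i) i)]
    exact Finset.sum_eq_zero fun i _ => integral_pd1_eq_zero (hs i) (hcs i) i
  rw [integral_sub i2 i1] at h0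
  linarith

theorem Op1.Approx.regOp {V : Op1 κ} {U : ℕ → Op1 κ} (h : V.Approx m M U) :
    RegOp Set.univ 1 m ((Fintype.card κ + 1) * M) (fun n f => (U n).cl f) := by
  have hM : 0 ≤ M := h.regY.nonneg_bound (Set.mem_univ 0)
  have h1 : RegOp Set.univ 1 m (∑ _i : κ, M) (fun n f => ∑ i, (U n).X i * pd ![i] f) :=
    RegOp.sum fun i _ => RegOp.single hM ((h.regX i).of_le (Nat.le_succ m) le_rfl subset_rfl)
      le_rfl ![i]
  have h2 : RegOp Set.univ 1 m M (fun n f => (U n).Y * pd (Fin.elim0 : Fin 0 → κ) f) :=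
    RegOp.single hM h.regY (Nat.zero_le 1) _
  refine ((h1.add h2).of_le le_rfl le_rfl (le_of_eq ?_)).congr fun n f hf => rfl
  rw [Finset.sum_const, Finset.card_univ, nsmul_eq_mul]; ring

/-! ### Conjugation by the blow-up map -/

/-- The map `stretch c` as a linear map. -/
def stretchL (c : ℝ) : Eu (ι ⊕ ι) →L[ℝ] Eu (ι ⊕ ι) :=
  LinearMap.toContinuousLinearMap
    { toFun := stretch c
      map_add' := fun z z' => by
        ext i; rcases i with i | i <;> simp [stretch, mkPair, xPart, yPart] <;> ring
      map_smul' := fun b z => by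
        ext i; rcases i with i | i <;> simp [stretch, mkPair, xPart, yPart] <;> ring }

theorem stretchL_apply (c : ℝ) (z : Eu (ι ⊕ ι)) : stretchL c z = stretch c z := rfl

theorem stretchL_single_inl (c : ℝ) (i : ι) :
    stretchL c (EuclideanSpace.single (Sum.inl i) (1 : ℝ)) =
      ((1 + c) / 2) • EuclideanSpace.single (Sum.inl i) (1 : ℝ) +
        ((1 - c) / 2) • EuclideanSpace.single (Sum.inr i) (1 : ℝ) := by
  ext k
  rcases k with k | k <;> by_cases hk : k = i <;>
    simp [stretchL_apply, stretch, mkPair, xPart, yPart, hk] <;> ring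

theorem stretchL_single_inr (c : ℝ) (i : ι) :
    stretchL c (EuclideanSpace.single (Sum.inr i) (1 : ℝ)) =
      ((1 - c) / 2) • EuclideanSpace.single (Sum.inl i) (1 : ℝ) +
        ((1 + c) / 2) • EuclideanSpace.single (Sum.inr i) (1 : ℝ) := by
  ext k
  rcases k with k | k <;> by_cases hk : k = i <;>
    simp [stretchL_apply, stretch, mkPair, xPart, yPart, hk] <;> ring

theorem blowUp_eq (ε : ℝ) (f : Eu (ι ⊕ ι) → ℝ) :
    blowUp ε f = ((2 * ε) ^ Fintype.card ι)⁻¹ • fun z => f (stretchL ε⁻¹ z) := rfl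

theorem Smooth.comp_stretch {f : Eu (ι ⊕ ι) → ℝ} (hf : Smooth f) (c : ℝ) :
    Smooth (fun z => f (stretchL c z)) := by
  have h : ContDiff ℝ ∞ (fun z : Eu (ι ⊕ ι) => stretchL c z) := by fun_prop
  exact ContDiff.comp (g := f) hf h

theorem Smooth.blowUp {f : Eu (ι ⊕ ι) → ℝ} (hf : Smooth f) (ε : ℝ) : Smooth (blowUp ε f) := by
  rw [blowUp_eq]; exact (hf.comp_stretch _).smul _

theorem pd1_comp_stretch {f : Eu (ι ⊕ ι) → ℝ} (hf : Smooth f) (c : ℝ) (k : ι ⊕ ι)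
    (z : Eu (ι ⊕ ι)) : pd1 k (fun z => f (stretchL c z)) z =
      fderiv ℝ f (stretchL c z) (stretchL c (EuclideanSpace.single k 1)) := by
  have h := (hf.differentiableAt (stretchL c z)).hasFDerivAt.comp z (stretchL c).hasFDerivAt
  have e : (fun z => f (stretchL c z)) = f ∘ stretchL c := rfl
  rw [pd1, e, h.fderiv]
  rfl

theorem pd1_inl_comp_stretch {f : Eu (ι ⊕ ι) → ℝ} (hf : Smooth f) (c : ℝ) (i : ι)
    (z : Eu (ι ⊕ ι)) : pd1 (Sum.inl i) (fun z => f (stretchL c z)) z =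
      (1 + c) / 2 * pd1 (Sum.inl i) f (stretchL c z) +
        (1 - c) / 2 * pd1 (Sum.inr i) f (stretchL c z) := by
  rw [pd1_comp_stretch hf, stretchL_single_inl, map_add, map_smul, map_smul]; rfl

theorem pd1_inr_comp_stretch {f : Eu (ι ⊕ ι) → ℝ} (hf : Smooth f) (c : ℝ) (i : ι)
    (z : Eu (ι ⊕ ι)) : pd1 (Sum.inr i) (fun z => f (stretchL c z)) z =
      (1 - c) / 2 * pd1 (Sum.inl i) f (stretchL c z) +
        (1 + c) / 2 * pd1 (Sum.inr i) f (stretchL c z) := by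
  rw [pd1_comp_stretch hf, stretchL_single_inr, map_add, map_smul, map_smul]; rfl

theorem xPart_stretch (c : ℝ) (z : Eu (ι ⊕ ι)) :
    xPart (stretch c z) = comb ((1 + c) / 2) ((1 - c) / 2) z := by
  ext i; simp [comb_apply, stretch, mkPair, xPart, yPart]; ring

theorem yPart_stretch (c : ℝ) (z : Eu (ι ⊕ ι)) :
    yPart (stretch c z) = comb ((1 - c) / 2) ((1 + c) / 2) z := by
  ext i; simp [comb_apply, stretch, mkPair, xPart, yPart]; ring

/-- After conjugation the coefficients are evaluated at `p + εv` and `p - εv`, giving values `a` and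
`b`, and the chain rule supplies the weights `(1 ± 1/ε) / 2`. The coefficient of `∂_{x_i}` is thus
`(a + b)/2 + (a - b)/(2ε)`, with the opposite sign of the quotient for `∂_{y_i}`, so `1/ε` meets
differences only. The powers of `2ε` in the blow-up and its inverse cancel. -/
theorem Op1.conjAdjoint_dbl_cl (W : Op1 ι) {ε : ℝ} (hε : 0 < ε) {f : Eu (ι ⊕ ι) → ℝ}
    (hf : Smooth f) : conjAdjoint ε W.dbl.cl f =
      ∑ i, (((1 / 2 : ℝ) • ((fun z => W.X i (comb ((1 + ε) / 2) ((1 - ε) / 2) z)) +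
          fun z => W.X i (comb ((1 - ε) / 2) ((1 + ε) / 2) z)) + diffQuot ε (W.X i)) *
            pd ![Sum.inl i] f +
        ((1 / 2 : ℝ) • ((fun z => W.X i (comb ((1 + ε) / 2) ((1 - ε) / 2) z)) +
          fun z => W.X i (comb ((1 - ε) / 2) ((1 + ε) / 2) z)) - diffQuot ε (W.X i)) *
            pd ![Sum.inr i] f) +
      ((fun z => W.Y (comb ((1 + ε) / 2) ((1 - ε) / 2) z)) +
        fun z => W.Y (comb ((1 - ε) / 2) ((1 + ε) / 2) z)) * pd (Fin.elim0 : Fin 0 → ι ⊕ ι) f := by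
  funext z
  have hc : ((2 * ε) ^ Fintype.card ι) ≠ 0 := by positivity
  have hz : stretchL ε⁻¹ (stretch ε z) = z := by
    rw [stretchL_apply, stretch_stretch, inv_mul_cancel₀ hε.ne', stretch_one]
  have e : ∀ k, pd1 k (blowUp ε f) = ((2 * ε) ^ Fintype.card ι)⁻¹ •
      pd1 k (fun z => f (stretchL ε⁻¹ z)) := fun k => by
    rw [blowUp_eq, pd1_smul (hf.comp_stretch _)]
  have e0 : blowUp ε f (stretch ε z) = ((2 * ε) ^ Fintype.card ι)⁻¹ * f z := by
    rw [blowUp_eq, Pi.smul_apply, hz]; rfl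
  rw [conjAdjoint, blowUpInv, Op1.cl_apply, e0]
  simp only [e, Fintype.sum_sum_type, Op1.dbl_X_inl, Op1.dbl_X_inr, Op1.dbl_Y, Pi.smul_apply,
    Pi.add_apply, xPart_stretch, yPart_stretch, pd1_inl_comp_stretch hf, pd1_inr_comp_stretch hf,
    hz, smul_eq_mul, Pi.mul_apply, Finset.sum_apply, pd_one, pd_zero, diffQuot, Pi.sub_apply]
  rw [← Finset.sum_add_distrib, mul_add, Finset.mul_sum]
  congr 1
  · refine Finset.sum_congr rfl fun i _ => ?_
    field_simp
    ring
  · field_simp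

/-- This is the uniform estimate: the bound does not involve `ε`. Each index contributes two
derivatives, with coefficients bounded by mean plus quotient, and `Y` contributes `2 * M`. The strip
enters through the quotients only. -/
theorem Op1.Approx.regOp_conj {W : Op1 ι} {U : ℕ → Op1 ι} (h : W.Approx m M U) {ε : ℝ}
    (h0 : 0 < ε) (h1 : ε ≤ 1) : RegOp (strip ι) 1 m
      ((Fintype.card ι * (2 * (1 + (2 * Fintype.card ι + 1) ^ m)) + 2) * M)
      (fun n f => conjAdjoint ε (U n).dbl.cl f) := by
  have hM : 0 ≤ M := h.regY.nonneg_bound (Set.mem_univ 0)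
  have a1 : (1 + ε) / 2 ≠ 0 ∨ (1 - ε) / 2 ≠ 0 := Or.inl (by positivity)
  have a2 : (1 - ε) / 2 ≠ 0 ∨ (1 + ε) / 2 ≠ 0 := Or.inr (by positivity)
  have e1 : |(1 + ε) / 2| = (1 + ε) / 2 := abs_of_nonneg (by positivity)
  have e2 : |(1 - ε) / 2| = (1 - ε) / 2 := abs_of_nonneg (by linarith)
  have b1 : |(1 + ε) / 2| + |(1 - ε) / 2| ≤ 1 := by rw [e1, e2]; linarith
  have b2 : |(1 - ε) / 2| + |(1 + ε) / 2| ≤ 1 := by rw [e1, e2]; linarith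
  have hp : ∀ i, Reg (strip ι) m M (fun n => (1 / 2 : ℝ) •
      ((fun z => (U n).X i (RoughDriver.comb ((1 + ε) / 2) ((1 - ε) / 2) z)) +
        fun z => (U n).X i (RoughDriver.comb ((1 - ε) / 2) ((1 + ε) / 2) z))) := fun i =>
    ((((h.regX i).comb a1 b1).add ((h.regX i).comb a2 b2)).smul (1 / 2)).of_le (Nat.le_succ m)
      (le_of_eq (by rw [abs_of_pos (by norm_num)]; ring)) (Set.subset_univ _)
  have hq : ∀ i, Reg (strip ι) m ((2 * Fintype.card ι + 1) ^ m * M)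
      (fun n => RoughDriver.diffQuot ε ((U n).X i)) := fun i => (h.regX i).diffQuot h0 h1
  have hb : Reg (strip ι) m (M + M) (fun n =>
      (fun z => (U n).Y (RoughDriver.comb ((1 + ε) / 2) ((1 - ε) / 2) z)) +
        fun z => (U n).Y (RoughDriver.comb ((1 - ε) / 2) ((1 + ε) / 2) z)) :=
    ((h.regY.comb a1 b1).add (h.regY.comb a2 b2)).of_le le_rfl le_rfl (Set.subset_univ _)
  have hN : 0 ≤ M + (2 * (Fintype.card ι : ℝ) + 1) ^ m * M := by positivity
  refine (((RegOp.sum (t := Finset.univ) fun i _ =>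
    ((RegOp.single hN ((hp i).add (hq i)) le_rfl ![Sum.inl i]).add
      (RegOp.single hN ((hp i).sub (hq i)) le_rfl ![Sum.inr i]))).add
    (RegOp.single (by positivity) hb (Nat.zero_le 1) (Fin.elim0 : Fin 0 → ι ⊕ ι))).of_le le_rfl
    le_rfl (le_of_eq ?_)).congr fun n f hf => (U n).conjAdjoint_dbl_cl h0 hf
  rw [Finset.sum_const, Finset.card_univ, nsmul_eq_mul]
  ring

/-- The blow-up of a test function on `O` is a test function on the whole space, where convergence
is known almost everywhere. The linear bijection `stretch ε` pulls this back. -/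
theorem ae_tendsto_conjAdjoint {ε : ℝ} (hε : 0 < ε) {O : Opens (Eu (ι ⊕ ι))}
    {A : ℕ → (Eu (ι ⊕ ι) → ℝ) → Eu (ι ⊕ ι) → ℝ} {A' : (Eu (ι ⊕ ι) → ℝ) → Eu (ι ⊕ ι) → ℝ}
    (h : ∀ ψ : 𝓓((⊤ : Opens (Eu (ι ⊕ ι))), ℝ), LimAE (fun n => A n ψ) (A' ψ)) (Φ : 𝓓(O, ℝ)) :
    ∀ᵐ z ∂volume.restrict (O : Set (Eu (ι ⊕ ι))),
      Tendsto (fun n => conjAdjoint ε (A n) Φ z) atTop (𝓝 (conjAdjoint ε A' Φ z)) := by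
  have inv : ∀ z : Eu (ι ⊕ ι), stretch ε (stretch ε⁻¹ z) = z := fun z => by
    rw [stretch_stretch, mul_inv_cancel₀ hε.ne', stretch_one]
  have inv' : ∀ z : Eu (ι ⊕ ι), stretch ε⁻¹ (stretch ε z) = z := fun z => by
    rw [stretch_stretch, inv_mul_cancel₀ hε.ne', stretch_one]
  have hc : HasCompactSupport (blowUp ε (Φ : Eu (ι ⊕ ι) → ℝ)) := by
    refine HasCompactSupport.intro (K := stretchL ε '' tsupport Φ)
      (Φ.hasCompactSupport.isCompact.image (stretchL ε).continuous) fun z hz => ?_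
    have : stretch ε⁻¹ z ∉ tsupport Φ := fun h => hz ⟨_, h, inv z⟩
    rw [blowUp, image_eq_zero_of_notMem_tsupport this, mul_zero]
  have h1 := h (mkTest (blowUp ε Φ) ((smooth_test Φ).blowUp ε) hc (Set.subset_univ _))
  have h2 := ae_comp_linear (stretchL (ι := ι) ε).toLinearMap
    (fun z => ⟨stretch ε⁻¹ z, inv z⟩) h1
  refine ae_restrict_of_ae ?_
  filter_upwards [h2] with z hz
  exact hz.const_mul _

end

/-! ### Second order operators of geometric type -/

section

/-- The first order part of `P - (V ∘ V) / 2`. -/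
def Op2.rem (P : Op2 κ) (V : Op1 κ) : Op1 κ where
  X j := P.Y j - (1 / 2 : ℝ) • (V.weakComp V).Y j
  Y := P.Z - (1 / 2 : ℝ) • (V.weakComp V).Z

/-- The first order part of `P - (V ∘ V) / 2`, for smooth `V`. -/
def Op2.smoothRem (P : Op2 κ) (V : Op1 κ) : Op1 κ where
  X j := P.Y j - (1 / 2 : ℝ) • (V.comp V).Y j
  Y := P.Z - (1 / 2 : ℝ) • (V.comp V).Z

/-- The derivatives of `V` in `V ∘ V` leave coefficients of orders two and one, which is `Approx 1`.
At order two the Leibniz constant is 4; halved, it gives `2 * card κ` for the sum of derivatives and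
4 for the two further products. -/
theorem Op2.Approx.rem {P : Op2 κ} {V : Op1 κ} {M N : ℝ} {Q : ℕ → Op2 κ} {U : ℕ → Op1 κ}
    (h : P.Approx M Q) (h' : V.Approx 2 N U) :
    (P.rem V).Approx 1 (M + (2 * Fintype.card κ + 4) * (N * N))
      (fun n => (Q n).smoothRem (U n)) := by
  have hN : 0 ≤ N := h'.regY.nonneg_bound (Set.mem_univ 0)
  have hNN : 0 ≤ N * N := mul_nonneg hN hN
  have hcNN : 0 ≤ (Fintype.card κ : ℝ) * (N * N) := by positivity
  have half : |(1 / 2 : ℝ)| = 1 / 2 := abs_of_pos (by norm_num)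
  have h2 : ∀ i, Reg Set.univ 2 N fun n => (U n).X i := fun i =>
    (h'.regX i).of_le (Nat.le_succ 2) le_rfl subset_rfl
  have h1 : ∀ i, Reg Set.univ 1 N fun n => (U n).X i := fun i =>
    (h2 i).of_le (Nat.le_succ 1) le_rfl subset_rfl
  have y1 : Reg Set.univ 1 N fun n => (U n).Y := h'.regY.of_le (Nat.le_succ 1) le_rfl subset_rfl
  refine ⟨fun j => ?_, ?_, fun j => ?_, ?_⟩
  · refine ((h.regY j).sub ((((Reg.sum fun i _ => (h2 i).mul ((h'.regX j).pd1 i)).add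
      ((h2 j).mul h'.regY)).add (h'.regY.mul (h2 j))).smul (1 / 2))).of_le le_rfl ?_ subset_rfl
    rw [half, Finset.sum_const, Finset.card_univ, nsmul_eq_mul]
    linarith
  · refine (h.regZ.sub (((Reg.sum fun i _ => (h1 i).mul (h'.regY.pd1 i)).add
      (y1.mul y1)).smul (1 / 2))).of_le le_rfl ?_ subset_rfl
    rw [half, Finset.sum_const, Finset.card_univ, nsmul_eq_mul]
    linarith
  · exact (h.limY j).sub ((((LimAE.sum fun i _ => (h'.limX i).mul
      ((h'.regX j).limAE_weakDeriv_one i (h'.limX j))).add ((h'.limX j).mul h'.limY)).add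
      (h'.limY.mul (h'.limX j))).smul (1 / 2))
  · exact h.limZ.sub (((LimAE.sum fun i _ => (h'.limX i).mul
      (h'.regY.limAE_weakDeriv_one i h'.limY)).add (h'.limY.mul h'.limY)).smul (1 / 2))

/-- A doubled operator whose symmetric part is that of a square is a sum of a square and a first
order operator. -/
theorem Op2.Approx.ae_dbl_cl {P : Op2 ι} {V : Op1 ι} {N : ℝ} {U : ℕ → Op1 ι}
    (h' : V.Approx 2 N U) (hs : ∀ i j, P.X i j + P.X j i =ᵐ[volume] V.X i * V.X j)
    {f : Eu (ι ⊕ ι) → ℝ} (hf : Smooth f) : (P.dbl V).cl f =ᵐ[volume]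
      (1 / 2 : ℝ) • (V.dbl.weakComp V.dbl).cl f + (P.rem V).dbl.cl f := by
  have hs' : ∀ᵐ x, ∀ i j, P.X i j x + P.X j i x = V.X i x * V.X j x :=
    ae_all_iff.2 fun i => ae_all_iff.2 fun j => hs i j
  filter_upwards [ae_comp_xPart hs', ae_comp_yPart hs', h'.ae_weakComp_dbl V] with z hx hy hz
  -- Twice the operator is compared, to clear the factor `1/2`. The cross term `V ⊗ V` occurs once
  -- in `P.dbl V` and twice in the square, while `hs` settles the two diagonal blocks.
  have key : (P.dbl V + P.dbl V).EqAt ((V.weakComp V).onX + V.tensor V + V.tensor V +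
      (V.weakComp V).onY + ((P.rem V).dbl.toOp2 + (P.rem V).dbl.toOp2)) z := by
    refine ⟨fun i j => ?_, fun i => ?_, ?_⟩
    · rcases i with i | i <;> rcases j with j | j
      · have := hx i j
        simp [Op2.dbl_X_inl_inl, Op2.onX, Op2.onY, Op1.tensor, Op1.toOp2, Op1.weakComp]
        linarith
      · simp [Op2.dbl_X_inl_inr, Op2.dbl_X_inr_inl, Op2.onX, Op2.onY, Op1.tensor, Op1.toOp2]
      · simp [Op2.dbl_X_inl_inr, Op2.dbl_X_inr_inl, Op2.onX, Op2.onY, Op1.tensor, Op1.toOp2]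
      · have := hy i j
        simp [Op2.dbl_X_inr_inr, Op2.onX, Op2.onY, Op1.tensor, Op1.toOp2, Op1.weakComp]
        linarith
    · rcases i with i | i
      · simp [Op2.dbl_Y_inl, Op2.onX, Op2.onY, Op1.tensor, Op1.toOp2, Op1.dbl_X_inl, Op2.rem]
        ring
      · simp [Op2.dbl_Y_inr, Op2.onX, Op2.onY, Op1.tensor, Op1.toOp2, Op1.dbl_X_inr, Op2.rem]
        ring
    · simp [Op2.dbl_Z, Op2.onX, Op2.onY, Op1.tensor, Op1.toOp2, Op1.dbl_Y, Op2.rem]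
      ring
  have e1 := key.cl_eq hf
  have e2 := hz.cl_eq hf
  simp only [Op2.add_cl, Pi.add_apply, Op1.toOp2_cl] at e1 e2
  simp only [Pi.add_apply, Pi.smul_apply, smul_eq_mul, e2]
  linarith

/-- Each weak derivative in the adjoint is shifted to `φ` by its defining property. Together with
local integrability this determines `P.adjoint ψ` almost everywhere. -/
theorem Op2.Approx.integral_adjoint {P : Op2 κ} {M : ℝ} {Q : ℕ → Op2 κ} (h : P.Approx M Q)
    (φ ψ : 𝓓((⊤ : Opens (Eu κ)), ℝ)) :
    LocallyIntegrable (P.adjoint ψ) ∧ ∫ x, P.adjoint ψ x * φ x = ∫ x, P.cl φ x * ψ x := by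
  have hX : ∀ i j, HasWeakDeriv ⊤ ![i, j] (P.X i j * (ψ : Eu κ → ℝ))
      (weakDeriv ⊤ ![i, j] (P.X i j * (ψ : Eu κ → ℝ))) := fun i j => by
    obtain ⟨C, hC⟩ := (h.regX i j).mulTest ψ
    exact hasWeakDeriv_weakDeriv ⟨_, hC.hasWeakDeriv_top (by norm_num) ![i, j]
      ((h.limX i j).mul (LimAE.fixed _))⟩
  have hY : ∀ i, HasWeakDeriv ⊤ ![i] (P.Y i * (ψ : Eu κ → ℝ))
      (weakDeriv ⊤ ![i] (P.Y i * (ψ : Eu κ → ℝ))) := fun i => by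
    obtain ⟨C, hC⟩ := (h.regY i).mulTest ψ
    exact hasWeakDeriv_weakDeriv ⟨_, hC.hasWeakDeriv_top (by norm_num) ![i]
      ((h.limY i).mul (LimAE.fixed _))⟩
  have hZ : LocallyIntegrable (P.Z * (ψ : Eu κ → ℝ)) := by
    obtain ⟨C, hC⟩ := h.regZ.mulTest ψ
    have := (hC.hasWeakDeriv_top (Nat.zero_le 1) Fin.elim0 (h.limZ.mul (LimAE.fixed _))).1
    rwa [Opens.coe_top, locallyIntegrableOn_univ] at this
  have lX : ∀ i j, LocallyIntegrable (weakDeriv ⊤ ![i, j] (P.X i j * (ψ : Eu κ → ℝ))) :=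
    fun i j => by
      have := (hX i j).2.1
      rwa [Opens.coe_top, locallyIntegrableOn_univ] at this
  have lX' : ∀ i j, LocallyIntegrable (P.X i j * (ψ : Eu κ → ℝ)) := fun i j => by
    have := (hX i j).1
    rwa [Opens.coe_top, locallyIntegrableOn_univ] at this
  have lY : ∀ i, LocallyIntegrable (weakDeriv ⊤ ![i] (P.Y i * (ψ : Eu κ → ℝ))) := fun i => by
    have := (hY i).2.1
    rwa [Opens.coe_top, locallyIntegrableOn_univ] at this
  have lY' : ∀ i, LocallyIntegrable (P.Y i * (ψ : Eu κ → ℝ)) := fun i => by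
    have := (hY i).1
    rwa [Opens.coe_top, locallyIntegrableOn_univ] at this
  have e : P.adjoint ψ = ∑ i, ∑ j, weakDeriv ⊤ ![i, j] (P.X i j * (ψ : Eu κ → ℝ)) -
      ∑ i, weakDeriv ⊤ ![i] (P.Y i * (ψ : Eu κ → ℝ)) + P.Z * (ψ : Eu κ → ℝ) := by
    funext x
    simp only [Op2.adjoint, Pi.add_apply, Pi.sub_apply, Finset.sum_apply, Pi.mul_apply]
    rfl
  have sum_li : ∀ {F : κ → Eu κ → ℝ}, (∀ i, LocallyIntegrable (F i) volume) →
      LocallyIntegrable (∑ i, F i) volume := by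
    intro F hF
    refine Finset.sum_induction F (fun f => LocallyIntegrable f volume)
      (fun _ _ h1 h2 => h1.add h2) ?_ (fun i _ => hF i)
    exact locallyIntegrable_zero
  refine ⟨?_, ?_⟩
  · rw [e]
    exact ((sum_li fun i => sum_li fun j => lX i j).sub (sum_li lY)).add hZ
  · have iT : ∀ {f : Eu κ → ℝ} (χ : 𝓓((⊤ : Opens (Eu κ)), ℝ)), LocallyIntegrable f →
        Integrable (fun x => f x * χ x) := fun χ hf =>
      integrable_mul_test_of_locallyIntegrable hf χ
    have tX : ∀ i j, ∫ x, weakDeriv ⊤ ![i, j] (P.X i j * (ψ : Eu κ → ℝ)) x * φ x =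
        ∫ x, (P.X i j * (ψ : Eu κ → ℝ)) x * pdTest ![i, j] φ x := fun i j => by
      have := (hX i j).integral_eq φ
      simpa using this.symm
    have tY : ∀ i, ∫ x, weakDeriv ⊤ ![i] (P.Y i * (ψ : Eu κ → ℝ)) x * φ x =
        -∫ x, (P.Y i * (ψ : Eu κ → ℝ)) x * pdTest ![i] φ x := fun i => by
      have := (hY i).integral_eq φ
      rw [coe_pdTest, this]
      simp
    have sum1 : ∀ {F : κ → Eu κ → ℝ}, (∀ i, Integrable (F i)) →
        Integrable (fun x => ∑ i, F i x) ∧ ∫ x, ∑ i, F i x = ∑ i, ∫ x, F i x := fun hF =>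
      ⟨integrable_finsetSum _ fun i _ => hF i, integral_finsetSum _ fun i _ => hF i⟩
    have sum2 : ∀ {F : κ → κ → Eu κ → ℝ}, (∀ i j, Integrable (F i j)) →
        Integrable (fun x => ∑ i, ∑ j, F i j x) ∧
          ∫ x, ∑ i, ∑ j, F i j x = ∑ i, ∑ j, ∫ x, F i j x := fun hF =>
      ⟨(sum1 fun i => (sum1 (hF i)).1).1, (sum1 fun i => (sum1 (hF i)).1).2.trans
        (Finset.sum_congr rfl fun i _ => (sum1 (hF i)).2)⟩
    have s1 := sum2 fun i j => iT φ (lX i j)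
    have s2 := sum1 fun i => iT φ (lY i)
    have s1' := sum2 fun i j => iT (pdTest ![i, j] φ) (lX' i j)
    have s2' := sum1 fun i => iT (pdTest ![i] φ) (lY' i)
    have l : ∫ x, P.adjoint ψ x * φ x =
        (∑ i, ∑ j, ∫ x, (P.X i j * (ψ : Eu κ → ℝ)) x * pdTest ![i, j] φ x) +
        (∑ i, ∫ x, (P.Y i * (ψ : Eu κ → ℝ)) x * pdTest ![i] φ x) +
        ∫ x, (P.Z * (ψ : Eu κ → ℝ)) x * φ x := by
      rw [← Finset.sum_congr rfl fun i _ => Finset.sum_congr rfl fun j _ => tX i j,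
        Finset.sum_congr rfl fun i _ => (neg_eq_iff_eq_neg.2 (tY i)).symm, Finset.sum_neg_distrib,
        ← s1.2, ← s2.2, ← sub_eq_add_neg, ← integral_sub s1.1 s2.1]
      refine (integral_congr_ae (.of_forall fun x => ?_)).trans
        (integral_add (s1.1.sub s2.1) (iT φ hZ))
      rw [e]
      simp only [Pi.add_apply, Pi.sub_apply, Finset.sum_apply, Finset.sum_mul, add_mul, sub_mul]
    rw [l, ← s1'.2, ← s2'.2, ← integral_add s1'.1 s2'.1]
    refine (integral_add (s1'.1.add s2'.1) (iT φ hZ)).symm.trans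
      (integral_congr_ae (.of_forall fun x => ?_))
    dsimp only
    rw [Op2.cl_apply]
    simp only [Pi.mul_apply, coe_pdTest, pd_two, pd_one, add_mul, Finset.sum_mul]
    simp only [mul_right_comm]
    rfl

/-- The approximations are adjoints of squares plus first order terms, not adjoints of the doubled
`Q n`, because the identity `hs` need not hold for the mollified coefficients. That they converge is
clear from regularity. The limit is identified by testing: for each `n` the operators are moved to
`φ`, the limit is taken there by `Op2.Approx.ae_dbl_cl`, and the outcome is compared with
`Op2.Approx.integral_adjoint`. -/
theorem Op2.Approx.limAE_adjoint {P : Op2 ι} {V : Op1 ι} {M N : ℝ} {Q : ℕ → Op2 ι}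
    {U : ℕ → Op1 ι} (h : P.Approx M Q) (h' : V.Approx 2 N U)
    (hs : ∀ i j, P.X i j + P.X j i =ᵐ[volume] V.X i * V.X j)
    (ψ : 𝓓((⊤ : Opens (Eu (ι ⊕ ι))), ℝ)) :
    LimAE (fun n => (1 / 2 : ℝ) • (U n).dbl.adjOp.cl ((U n).dbl.adjOp.cl ψ) +
      ((Q n).smoothRem (U n)).dbl.adjOp.cl ψ) ((P.dbl V).adjoint ψ) := by
  have hU := h'.dbl
  have hR := (h.rem h').dbl
  have op : ∀ {U' R' : ℕ → Op1 (ι ⊕ ι)} {V' W' : Op1 (ι ⊕ ι)} {M' N' : ℝ}, V'.Approx 2 M' U' →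
      W'.Approx 1 N' R' → ∃ C, RegOp Set.univ (1 + 1) 0 C
        (fun n f => (1 / 2 : ℝ) • (U' n).cl ((U' n).cl f) + (R' n).cl f) := fun hV hW =>
    ⟨_, (((hV.regOp.of_le le_rfl (m' := 0) (by omega) le_rfl).comp
      (hV.regOp.of_le le_rfl (m' := 0 + 1) (by omega) le_rfl)).smul (1 / 2)).add
      (hW.regOp.of_le (by omega) (m' := 0) (by omega) le_rfl)⟩
  obtain ⟨C, hC⟩ := op hU.adjOp hR.adjOp
  obtain ⟨C', hC'⟩ := op hU hR
  obtain ⟨D, hD⟩ := hC.reg_apply ψ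
  have hlim : LimAE _ (limD (Fin.elim0 : Fin 0 → ι ⊕ ι) _) := hD.tendsto_limD le_rfl Fin.elim0
  simp only [pd_zero] at hlim
  refine hlim.congr ?_
  have hli := (hD.hasWeakDeriv_top le_rfl (Fin.elim0 : Fin 0 → ι ⊕ ι) hlim).1
  have key := fun φ => (h.dbl h').integral_adjoint φ ψ
  have := ae_eq_of_integral_test_eq (O := ⊤) hli ((key ψ).1.locallyIntegrableOn _) fun φ => ?_
  · simpa using this
  rw [(key φ).2]
  obtain ⟨D', hD'⟩ := hC'.reg_apply φ
  have hφ := smooth_test φ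
  have l2 : LimAE (fun n => (1 / 2 : ℝ) • (U n).dbl.cl ((U n).dbl.cl φ) +
      ((Q n).smoothRem (U n)).dbl.cl φ) ((P.dbl V).cl φ) := by
    refine LimAE.congr ?_ (Op2.Approx.ae_dbl_cl h' hs hφ).symm
    refine LimAE.add (LimAE.smul ?_ _) (hR.limAE_cl φ)
    obtain ⟨E, hE⟩ := hU.reg_cl φ
    have lc : LimAE (fun n => (U n).dbl.cl ((U n).dbl.cl φ)) (V.dbl.apply (V.dbl.cl φ)) := by
      have h1 : ∀ᵐ x, ∀ i, Tendsto (fun n => pd1 i ((U n).dbl.cl φ) x) atTop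
          (𝓝 (weakDeriv ⊤ ![i] (V.dbl.cl φ) x)) :=
        ae_all_iff.2 fun i => hE.limAE_weakDeriv_one i (hU.limAE_cl φ)
      have h2 : ∀ᵐ x, ∀ i, Tendsto (fun n => (U n).dbl.X i x) atTop (𝓝 (V.dbl.X i x)) :=
        ae_all_iff.2 hU.limX
      filter_upwards [h1, h2, hU.limAE_cl φ, hU.limY] with x h1 h2 h3 h4
      simp only [Op1.cl_apply (U _).dbl ((U _).dbl.cl φ), Op1.apply]
      exact (tendsto_finsetSum _ fun i _ => (h2 i).mul (h1 i)).add (h4.mul h3)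
    exact lc.congr ((V.dbl.apply_congr (V.dbl.apply_ae hφ)).symm.trans (hU.apply_apply V.dbl φ))
  have t1 := hlim.integral_mul_test hD.smooth
    (fun n x => (abs_le_jet 0 _ x).trans (hD.bound n x trivial)) φ
  have t2 := l2.integral_mul_test hD'.smooth
    (fun n x => (abs_le_jet 0 _ x).trans (hD'.bound n x trivial)) ψ
  refine tendsto_nhds_unique t1 (t2.congr fun n => ?_)
  have sU := hU.isSmooth n
  have sR := hR.isSmooth n
  have hψ := smooth_test ψ
  have iT : ∀ {f : Eu (ι ⊕ ι) → ℝ} (χ : 𝓓((⊤ : Opens (Eu (ι ⊕ ι))), ℝ)), Smooth f →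
      Integrable (fun x => f x * χ x) := fun χ hf =>
    integrable_mul_test_of_locallyIntegrable (LocallyIntegrable.of_smooth hf) χ
  let φ' : 𝓓((⊤ : Opens (Eu (ι ⊕ ι))), ℝ) := hU.regOp.test n φ
  -- The adjoint is moved across twice. The second time the test function is `φ'`, the image of `φ`
  -- under the smooth operator.
  have a1 : ∫ x, (U n).dbl.adjOp.cl ((U n).dbl.adjOp.cl ψ) x * φ x =
      ∫ x, (U n).dbl.cl ((U n).dbl.cl φ) x * ψ x := by
    rw [sU.integral_adjOp φ (sU.adjOp.cl hψ)]
    have : ∫ x, (U n).dbl.adjOp.cl ψ x * φ' x = ∫ x, (U n).dbl.cl φ' x * ψ x :=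
      sU.integral_adjOp φ' hψ
    rw [← show ∫ x, (U n).dbl.cl φ' x * ψ x = ∫ x, (U n).dbl.cl ((U n).dbl.cl φ) x * ψ x from rfl,
      ← this]
    congr 1
    funext x
    rw [mul_comm]
    rfl
  have a2 := sR.integral_adjOp φ hψ
  simp only [Pi.add_apply, Pi.smul_apply, smul_eq_mul, add_mul, mul_assoc]
  rw [integral_add ((iT ψ (sU.cl (sU.cl hφ))).const_mul _) (iT ψ (sR.cl hφ)),
    integral_add ((iT φ (sU.adjOp.cl (sU.adjOp.cl hψ))).const_mul _) (iT φ (sR.adjOp.cl hψ)),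
    integral_const_mul, integral_const_mul, a1, a2]

end

/-! ### Conjugated operators on spaces of negative order -/

section

theorem NegOpBound.mono {O : Opens (Eu κ)} {m i : ℕ} {Padj : (Eu κ → ℝ) → Eu κ → ℝ} {M M' : ℝ}
    (h : NegOpBound O m i Padj M) (hM : M ≤ M') : NegOpBound O m i Padj M' := fun v hv => by
  obtain ⟨u, h1, h2⟩ := h v hv
  exact ⟨u, h1, h2.trans (by gcongr)⟩

theorem OmegaD_one_subset_strip (U D : Opens (Eu ι)) :
    (OmegaD U D 1 : Set (Eu (ι ⊕ ι))) ⊆ strip ι := fun z hz => by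
  simpa [strip] using hz.2.2.2

/-- The constant in the bound for conjugated doubled operators, see `Op1.Approx.regOp_conj`. -/
def conjConst (ι : Type) [Fintype ι] (m : ℕ) : ℝ :=
  Fintype.card ι * (2 * (1 + (2 * Fintype.card ι + 1) ^ m)) + 2

theorem conjConst_nonneg (m : ℕ) : 0 ≤ conjConst ι m := by unfold conjConst; positivity

theorem Op1.Approx.regOp_conj_adjOp {V : Op1 ι} {m : ℕ} {M : ℝ} {U : ℕ → Op1 ι}
    (h : V.Approx m M U) {ε : ℝ} (h0 : 0 < ε) (h1 : ε ≤ 1) :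
    RegOp (strip ι) 1 m (conjConst ι m * ((Fintype.card ι + 1) * M))
      (fun n f => conjAdjoint ε (U n).dbl.adjOp.cl f) := by
  have := h.adjOp.regOp_conj h0 h1
  simp_rw [(h.isSmooth _).adjOp_dbl]
  exact this

theorem negOpBound_conj_one {V : Op1 ι} {M : ℝ} {W : ℕ → Op1 ι} (h : V.Approx 2 M W)
    (U D : Opens (Eu ι)) {ε : ℝ} (h0 : 0 < ε) (h1 : ε ≤ 1) {m : ℕ} (hm : m ≤ 2) :
    NegOpBound (OmegaD U D 1) m 1 (conjAdjoint ε V.dbl.adjoint)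
      (4 * (conjConst ι 2 * ((Fintype.card ι + 1) * M))) := by
  have r := h.regOp_conj_adjOp h0 h1
  refine ((r.of_le le_rfl hm le_rfl).negOpBound (OmegaD_one_subset_strip U D)
    (ae_tendsto_conjAdjoint h0 h.dbl.limAE_adjoint)).mono ?_
  refine mul_le_mul_of_nonneg_right ?_ r.nonneg
  exact (pow_le_pow_right₀ one_le_two hm).trans (by norm_num)

/-- Since `blowUp` and `blowUpInv` are inverse to each other, the conjugate of a square is the
square of the conjugate. The uniform bound for doubled first order operators then applies to both
factors and to the remainder. -/
theorem negOpBound_conj_two {P : Op2 ι} {V : Op1 ι} {M N : ℝ} {Q : ℕ → Op2 ι} {W : ℕ → Op1 ι}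
    (h : P.Approx M Q) (h' : V.Approx 2 N W)
    (hs : ∀ i j, P.X i j + P.X j i =ᵐ[volume] V.X i * V.X j)
    (U D : Opens (Eu ι)) {ε : ℝ} (h0 : 0 < ε) (h1 : ε ≤ 1) {m : ℕ} (hm : m ≤ 1) :
    NegOpBound (OmegaD U D 1) m 2 (conjAdjoint ε (P.dbl V).adjoint)
      (2 * (2 * (conjConst ι 2 * ((Fintype.card ι + 1) * N)) ^ 2 +
        conjConst ι 1 * ((Fintype.card ι + 1) * (M + (2 * Fintype.card ι + 4) * (N * N))))) := by
  have r2 := h'.regOp_conj_adjOp h0 h1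
  -- The inner factor is kept at order two and the outer one at order one, so the composite has
  -- coefficients of order one, enough for `m ≤ 1`. Composition gives four times the squared bound,
  -- and the factor `1/2` leaves two.
  have r := ((((r2.of_le le_rfl one_le_two le_rfl).comp r2).smul (1 / 2)).add
    (((h.rem h').regOp_conj_adjOp h0 h1).of_le one_le_two le_rfl le_rfl)).congr
    (R := fun n f => conjAdjoint ε (fun g =>
      (1 / 2 : ℝ) • (W n).dbl.adjOp.cl ((W n).dbl.adjOp.cl g) +
        ((Q n).smoothRem (W n)).dbl.adjOp.cl g) f) fun n f _ => by
      simp only [conjAdjoint, blowUp_blowUpInv h0]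
      funext z
      simp only [blowUpInv, Pi.add_apply, Pi.smul_apply, smul_eq_mul]
      ring
  have rm := (r.of_le le_rfl hm le_rfl)
  refine (rm.negOpBound (OmegaD_one_subset_strip U D)
    (ae_tendsto_conjAdjoint h0 (h.limAE_adjoint h' hs))).mono ?_
  refine mul_le_mul ((pow_le_pow_right₀ one_le_two hm).trans (by norm_num)) (le_of_eq ?_)
    r.nonneg zero_le_two
  rw [abs_of_pos (by norm_num)]
  ring

/-- The constants of the preceding bounds are homogeneous: with `N = K * ω^α` and `M = K * ω^{2α}`,
both `M` and `N²` scale as `ω^{2α}`, and the constants that remain depend only on the dimension and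
`K`. -/
theorem IsGeometric.exists_negOpBound {T α : ℝ} {w : ℝ → ℝ → ℝ} {B1 : ℝ → ℝ → Op1 ι}
    {B2 : ℝ → ℝ → Op2 ι} (hgeo : IsGeometric T α B1 B2) (hα : 0 < α)
    (hB : IsDifferentialRoughDriver T α w B1 B2) (hcoef : CoefficientsControlled T α w B1 B2)
    (U D : Opens (Eu ι)) :
    ∃ C > 0, ∀ ε : ℝ, 0 < ε → ε ≤ 1 → ∀ s t : ℝ, (s, t) ∈ simplex T →
      (∀ m : ℕ, m ≤ 2 → NegOpBound (OmegaD U D 1) m 1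
        (conjAdjoint ε (Gamma1 B1 s t).adjoint) (C * w s t ^ α)) ∧
      (∀ m : ℕ, m ≤ 1 → NegOpBound (OmegaD U D 1) m 2
        (conjAdjoint ε (Gamma2 B1 B2 s t).adjoint) (C * w s t ^ (2 * α))) := by
  obtain ⟨K, hK0, hK⟩ := hcoef.exists_pos hB.control
  set n : ℝ := (Fintype.card ι : ℝ)
  have hn : 0 ≤ n := by positivity
  have c1 := conjConst_nonneg (ι := ι) 1
  have c2 := conjConst_nonneg (ι := ι) 2
  set C1 := 4 * (conjConst ι 2 * ((n + 1) * K))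
  set C2 := 2 * (2 * (conjConst ι 2 * ((n + 1) * K)) ^ 2 +
    conjConst ι 1 * ((n + 1) * (K + (2 * n + 4) * (K * K))))
  have hC1 : 0 ≤ C1 := by positivity
  have hC2 : 0 ≤ C2 := by positivity
  refine ⟨1 + C1 + C2, by positivity, fun ε h0 h1 s t hst => ?_⟩
  obtain ⟨⟨W, hW⟩, ⟨Q, hQ⟩⟩ := hK s t hst
  have hw := hB.control.nonneg s t hst
  have hp : 0 ≤ w s t ^ α := Real.rpow_nonneg hw _
  have e : w s t ^ (2 * α) = w s t ^ α * w s t ^ α := by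
    rw [mul_comm, Real.rpow_mul hw, Real.rpow_two, sq]
  refine ⟨fun m hm => (negOpBound_conj_one hW U D h0 h1 hm).mono ?_, fun m hm =>
    (negOpBound_conj_two hQ hW (hgeo.ae_symm hα hst (hB.mem1 s t hst) (hB.mem2 s t hst))
      U D h0 h1 hm).mono ?_⟩
  · calc _ = C1 * w s t ^ α := by ring
      _ ≤ _ := by gcongr; linarith
  · rw [e]
    calc _ = C2 * (w s t ^ α * w s t ^ α) := by ring
      _ ≤ _ := by gcongr; linarith

end

end RoughDriver

end

theorem theorem4p6 (d : ℕ) (T α : ℝ) (hT : 0 < T) (hα : 1 / 3 < α)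
    (ω : ℝ → ℝ → ℝ)
    (B1 : ℝ → ℝ → RoughDriver.Op1 (Fin d)) (B2 : ℝ → ℝ → RoughDriver.Op2 (Fin d))
    (hB : RoughDriver.IsDifferentialRoughDriver T α ω B1 B2)
    (hcoef : RoughDriver.CoefficientsControlled T α ω B1 B2)
    (hgeo : RoughDriver.IsGeometric T α B1 B2)
    (U D : Opens (RoughDriver.Eu (Fin d)))
    (hDb : Bornology.IsBounded (D : Set (RoughDriver.Eu (Fin d)))) (hDU : D ≤ U)
    (hγ : ∃ γ > 0, ∀ x ∈ D, ∀ y ∈ frontier (U : Set (RoughDriver.Eu (Fin d))), γ ≤ dist x y) :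
    (∃ A : ℝ, RoughDriver.IsDifferentialRoughDriver T α (fun s t => A * ω s t)
      (RoughDriver.Gamma1 B1) (RoughDriver.Gamma2 B1 B2)) ∧
    ∃ C > 0, ∀ ε : ℝ, 0 < ε → ε ≤ 1 → ∀ s t : ℝ, 0 ≤ s → s ≤ t → t ≤ T →
      (∀ m : ℕ, m ≤ 2 → RoughDriver.NegOpBound (RoughDriver.OmegaD U D 1) m 1
        (RoughDriver.conjAdjoint ε (RoughDriver.Gamma1 B1 s t).adjoint) (C * ω s t ^ α)) ∧
      (∀ m : ℕ, m ≤ 1 → RoughDriver.NegOpBound (RoughDriver.OmegaD U D 1) m 2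
        (RoughDriver.conjAdjoint ε (RoughDriver.Gamma2 B1 B2 s t).adjoint)
          (C * ω s t ^ (2 * α))) := by
  have hα0 : 0 < α := lt_trans (by norm_num) hα
  obtain ⟨C, hC, h⟩ := hgeo.exists_negOpBound hα0 hB hcoef U D
  exact ⟨RoughDriver.isDifferentialRoughDriver_gamma hα0 hB hcoef, C, hC,
    fun ε h0 h1 s t hs hst ht => h ε h0 h1 s t ⟨hs, hst, ht⟩⟩
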